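/- **Theorem 1.1.** Let $T>0$ and let $\Omega\subset\mathbb R^3$ be a bounded domain with $C^2$ boundary and outward unit normal $\mathbf n$. Write $d(x)=\operatorname{dist}(x,\partial\Omega)$ and $\Omega_\varepsilon=\{x\in\Omega: d(x)<\varepsilon\}$; for $x\in\Omega$ close to $\partial\Omega$ let $m(x)\in\partial\Omega$ be the unique point with $|x-m(x)|=d(x)$. For open $\Gamma$ and $0<\alpha<1$ put $$\|f\|_{B^{\alpha}_{3,\infty}(\Gamma)}=\|f\|_{L^3(\Gamma)}+\sup_{y\ne0}|y|^{-\alpha}\,\|f-f(\cdot-y)\|_{L^3(\Gamma\cap(\Gamma+y))}.$$ Let $(\mathbf u,\mathbf b,\pi)$ be a weak solution of the ideal MHD equations in $\Omega\times(0,T)$, that is: $\mathbf u,\mathbf b\in L^\infty(0,T;L^2(\Omega;\mathbb R^3))$ and $\pi\in L^1_{loc}((0,T)\times\Omega)$; for all $\mathbf\Phi\in C_c^\infty(\Omega\times(0,T);\mathbb R^3)$ $$\int_0^T\!\!\int_\Omega\big(\mathbf u\cdot\partial_t\mathbf\Phi+\mathbf u\otimes\mathbf u:\nabla\mathbf\Phi-\mathbf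 b\otimes\mathbf b:\nabla\mathbf\Phi+\pi\,\nabla\cdot\mathbf\Phi\big)\,dx\,dt=0,$$ $$\int_0^T\!\!\int_\Omega\big(\mathbf b\cdot\partial_t\mathbf\Phi+\mathbf b\otimes\mathbf u:\nabla\mathbf\Phi-\mathbf u\otimes\mathbf b:\nabla\mathbf\Phi\big)\,dx\,dt=0,$$ where $\mathbf v\otimes\mathbf w:\nabla\mathbf\Phi=\sum_{i,j}v_iw_j\partial_j\Phi_i$; and for every $\varphi\in C_c^\infty(\Omega)$, $\int_\Omega\mathbf u\cdot\nabla\varphi\,dx=\int_\Omega\mathbf b\cdot\nabla\varphi\,dx=0$ for a.e. $t\in(0,T)$. (The boundary condition $\mathbf u\cdot\mathbf n=\mathbf b\cdot\mathbf n=0$ on $\partial\Omega$ enters only through (iii).) Let $\alpha_1,\alpha_2\in(\tfrac13,1)$ and assume: (i) (interior Besov regularity) for every open $\Gamma$ with compact closure contained in $\Omega$ there are exponents $a_1,a_2\in(\tfrac13,1)$, possibly depending on $\Gamma$ (for instance $a_1=\alpha_1$, $a_2=\alpha_2$), such that $\mathbf u\in L^3(0,T;B^{a_1}_{3,\infty}(\Gamma))$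 and $\mathbf b\in L^3(0,T;B^{a_2}_{3,\infty}(\Gamma))$; (ii) (boundedness near the boundary) for some $\sigma_0>0$, $\mathbf u,\mathbf b\in L^3(0,T;L^\infty(\Omega_{\sigma_0}))$ and $\pi\in L^{3/2}(0,T;L^\infty(\Omega_{\sigma_0}))$; (iii) (Besov-type continuity near the boundary) for some $h_0>0$, the functions $$t\mapsto\sup_{0<h<h_0}h^{-\alpha_1}\|\mathbf u(\cdot,t)\cdot\mathbf n(m(\cdot))\|_{L^3(\Omega_h)}\quad\text{and}\quad t\mapsto\sup_{0<h<h_0}h^{-\alpha_2}\|\mathbf b(\cdot,t)\cdot\mathbf n(m(\cdot))\|_{L^3(\Omega_h)}$$ belong to $L^3(0,T)$. Then there are constants $c,c'$ such that, for a.e. $t\in(0,T)$, $$\int_\Omega\big(|\mathbf u(x,t)|^2+|\mathbf b(x,t)|^2\big)\,dx=c,\qquad\int_\Omega\mathbf u(x,t)\cdot\mathbf b(x,t)\,dx=c'.$$ -/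

import Mathlib

open Set MeasureTheory Filter
open scoped ENNReal ContDiff

/-- Three-dimensional Euclidean space. -/
abbrev E3 : Type := EuclideanSpace ℝ (Fin 3)

/-! ### Bounded domains with boundary of class `C²` -/

/-- `ρ` is a `C²` function on the open set `U` without critical points there, and `Ω` is
the sublevel set `{ρ < 0}` inside `U`; so `∂Ω ∩ U = {ρ = 0} ∩ U`. -/
structure IsLocalDefiningFunction (Ω U : Set E3) (ρ : E3 → ℝ) : Prop where
  isOpen : IsOpen U
  contDiffOn : ContDiffOn ℝ 2 ρ U
  gradient_ne_zero : ∀ x ∈ U, gradient ρ x ≠ 0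
  inter_eq : Ω ∩ U = {x ∈ U | ρ x < 0}

/-- `Ω` is a bounded domain of `ℝ³` with boundary of class `C²`. -/
structure IsBoundedC2Domain (Ω : Set E3) : Prop where
  isOpen : IsOpen Ω
  isConnected : IsConnected Ω
  isBounded : Bornology.IsBounded Ω
  boundary : ∀ p ∈ frontier Ω, ∃ U : Set E3, ∃ ρ : E3 → ℝ,
    p ∈ U ∧ IsLocalDefiningFunction Ω U ρ

/-- `ν` is the outward unit normal of `Ω` at the boundary point `p`: it is the normalized
gradient at `p` of a local defining function. (At a boundary point of a `C²` domain there is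
exactly one such vector.) -/
def IsOutwardUnitNormal (Ω : Set E3) (p ν : E3) : Prop :=
  ‖ν‖ = 1 ∧ ∃ U : Set E3, ∃ ρ : E3 → ℝ,
    p ∈ U ∧ IsLocalDefiningFunction Ω U ρ ∧ gradient ρ p = ‖gradient ρ p‖ • ν

/-- The outward unit normal `n` on `∂Ω`. -/
noncomputable def outwardNormal (Ω : Set E3) (p : E3) : E3 :=
  Classical.epsilon (fun ν => IsOutwardUnitNormal Ω p ν)

/-- The distance `d(x)` to the boundary. -/
noncomputable def bdryDist (Ω : Set E3) (x : E3) : ℝ :=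
  Metric.infDist x (frontier Ω)

/-- The boundary point `m(x)` with `d(x) = |x - m(x)|`; for a bounded `C²` domain it is unique
when `x` is close enough to the boundary. -/
noncomputable def nearestBdryPoint (Ω : Set E3) (x : E3) : E3 :=
  Classical.epsilon (fun y => y ∈ frontier Ω ∧ dist x y = bdryDist Ω x)

/-- The boundary layer `Ω_ε = {x ∈ Ω | d(x) < ε}`. -/
def bdryLayer (Ω : Set E3) (ε : ℝ) : Set E3 :=
  {x ∈ Ω | bdryDist Ω x < ε}

/-! ### Function spaces

Space-time functions are written `w t x`, and only their values for `t ∈ (0,T)`, `x ∈ Ω`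
matter. Joint measurability is part of the notion of weak solution below; for jointly
measurable functions `w ∈ L^q(0,T;X)` means that the `q`-th power of `t ↦ ‖w(t)‖_X` has a
finite integral. -/

/-- The Besov norm of `B^α_{p,∞}(Γ)`, with values in `[0,∞]`:
`‖f‖_{L^p(Γ)} + sup_{y ≠ 0} ‖f - f(· - y)‖_{L^p(Γ ∩ (Γ + y))} / |y|^α`. -/
noncomputable def eBesovNorm (p : ℝ≥0∞) (α : ℝ) (Γ : Set E3) (f : E3 → E3) : ℝ≥0∞ :=
  eLpNorm f p (volume.restrict Γ) +
    ⨆ (y : E3) (_ : y ≠ 0),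
      eLpNorm (fun x => f x - f (x - y)) p (volume.restrict (Γ ∩ {x | x - y ∈ Γ})) /
        ENNReal.ofReal (‖y‖ ^ α)

/-- A `[0,∞]`-valued function `N` of time has finite `L^q(0,T)` norm, `0 < q < ∞`. -/
def FiniteLqTime (T q : ℝ) (N : ℝ → ℝ≥0∞) : Prop :=
  ∫⁻ t in Ioo 0 T, N t ^ q < (⊤ : ℝ≥0∞)

/-- `w ∈ L^q(0,T; B^α_{p,∞}(Γ))`. -/
def MemLqBesov (T q : ℝ) (p : ℝ≥0∞) (α : ℝ) (Γ : Set E3) (w : ℝ → E3 → E3) : Prop :=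
  FiniteLqTime T q (fun t => eBesovNorm p α Γ (w t))

/-- `w ∈ L^q(0,T; L^p(S))`. -/
def MemLqLp {F : Type*} [NormedAddCommGroup F]
    (T q : ℝ) (p : ℝ≥0∞) (S : Set E3) (w : ℝ → E3 → F) : Prop :=
  FiniteLqTime T q (fun t => eLpNorm (w t) p (volume.restrict S))

/-- Besov-type continuity near the boundary with exponent `α`:
`sup_h h^{-α} ‖w(t) · n(m(x))‖_{L³(Ω_h)} ∈ L³(0,T)`. The supremum runs over `0 < h < h₀` for
some `h₀ > 0`, since the point `m(x)` is only determined close to the boundary. -/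
def BesovContinuousNearBdry (Ω : Set E3) (T α : ℝ) (w : ℝ → E3 → E3) : Prop :=
  ∃ h₀ : ℝ, 0 < h₀ ∧
    FiniteLqTime T 3 (fun t => ⨆ (h : ℝ) (_ : h ∈ Ioo 0 h₀),
      eLpNorm (fun x => inner ℝ (w t x) (outwardNormal Ω (nearestBdryPoint Ω x))) 3
          (volume.restrict (bdryLayer Ω h)) /
        ENNReal.ofReal (h ^ α))

/-! ### Weak solutions of the ideal MHD equations -/

/-- The spatial divergence of a vector field, `∑ᵢ ∂ᵢ Φᵢ`. -/
noncomputable def divergence (Φ : E3 → E3) (x : E3) : ℝ :=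
  ∑ i : Fin 3, fderiv ℝ Φ x (EuclideanSpace.single i 1) i

/-- `v ⊗ w : ∇Φ = ∑ᵢⱼ vᵢ wⱼ ∂ⱼΦᵢ` at the point `x`. -/
noncomputable def tensorGrad (v w : E3) (Φ : E3 → E3) (x : E3) : ℝ :=
  inner ℝ v (fderiv ℝ Φ x w)

/-- `Φ ∈ C_c^∞((0,T) × Ω; ℝ³)`. -/
structure IsSpaceTimeTest (Ω : Set E3) (T : ℝ) (Φ : ℝ × E3 → E3) : Prop where
  contDiff : ContDiff ℝ ∞ Φ
  hasCompactSupport : HasCompactSupport Φ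
  tsupport_subset : tsupport Φ ⊆ Ioo 0 T ×ˢ Ω

/-- `w ∈ L^∞(0,T; L²(Ω))`, including joint measurability of `w` on `(0,T) × Ω`. -/
def MemLinftyL2 (Ω : Set E3) (T : ℝ) (w : ℝ → E3 → E3) : Prop :=
  AEStronglyMeasurable (fun z : ℝ × E3 => w z.1 z.2) (volume.restrict (Ioo 0 T ×ˢ Ω)) ∧
    ∃ C : ℝ, ∀ᵐ t ∂(volume.restrict (Ioo 0 T)),
      eLpNorm (w t) 2 (volume.restrict Ω) ≤ ENNReal.ofReal C

/-- `w(t)` is weakly divergence free in `Ω` for a.e. `t ∈ (0,T)`. -/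
def WeaklyDivFree (Ω : Set E3) (T : ℝ) (w : ℝ → E3 → E3) : Prop :=
  ∀ φ : E3 → ℝ, ContDiff ℝ ∞ φ → HasCompactSupport φ → tsupport φ ⊆ Ω →
    ∀ᵐ t ∂(volume.restrict (Ioo 0 T)), ∫ x in Ω, inner ℝ (w t x) (gradient φ x) = 0

/-- Weak solutions `(u, b, π)` of the ideal MHD equations in `Ω × (0,T)`, where `π` is the
magnetic pressure. No separate clause expresses the boundary condition `u·n = b·n = 0`. -/
structure IsWeakMHDSolution (Ω : Set E3) (T : ℝ) (u b : ℝ → E3 → E3) (π : ℝ → E3 → ℝ) :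
    Prop where
  u_mem : MemLinftyL2 Ω T u
  b_mem : MemLinftyL2 Ω T b
  pressure_mem : LocallyIntegrableOn (fun z : ℝ × E3 => π z.1 z.2) (Ioo 0 T ×ˢ Ω)
  momentum : ∀ Φ : ℝ × E3 → E3, IsSpaceTimeTest Ω T Φ →
    ∫ t in Ioo 0 T, ∫ x in Ω,
      (inner ℝ (u t x) (deriv (fun s => Φ (s, x)) t)
        + tensorGrad (u t x) (u t x) (fun y => Φ (t, y)) x
        - tensorGrad (b t x) (b t x) (fun y => Φ (t, y)) x
        + π t x * divergence (fun y => Φ (t, y)) x) = 0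
  induction : ∀ Φ : ℝ × E3 → E3, IsSpaceTimeTest Ω T Φ →
    ∫ t in Ioo 0 T, ∫ x in Ω,
      (inner ℝ (b t x) (deriv (fun s => Φ (s, x)) t)
        + tensorGrad (b t x) (u t x) (fun y => Φ (t, y)) x
        - tensorGrad (u t x) (b t x) (fun y => Φ (t, y)) x) = 0
  u_divFree : WeaklyDivFree Ω T u
  b_divFree : WeaklyDivFree Ω T b

/-- The total energy `∫_Ω |u(t)|² + |b(t)|²`. -/
noncomputable def totalEnergy (Ω : Set E3) (u b : ℝ → E3 → E3) (t : ℝ) : ℝ :=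
  ∫ x in Ω, (‖u t x‖ ^ 2 + ‖b t x‖ ^ 2)

/-- The cross-helicity `∫_Ω u(t) · b(t)`. -/
noncomputable def crossHelicity (Ω : Set E3) (u b : ℝ → E3 → E3) (t : ℝ) : ℝ :=
  ∫ x in Ω, inner ℝ (u t x) (b t x)

/-!
In the Elsässer variables `Z = u + b` and `V = u - b` the sum of the two equations reads
`∂ₜZ + div (Z ⊗ V) + ∇π = 0` with `div Z = div V = 0`
(`IsWeakMHDSolution.isWeakTransport`), and `(u, -b, π)` is a solution as well, for which `Z` and `V`
trade places. So it is enough that `∫ |Z|²` is constant in time: with both energies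
`∫ |u ± b|²` constant, the total energy and the cross helicity are linear combinations of the two.

*Interior.* Smooth the equation in space at scale `ε`, multiply by the smoothed `Z` and a cutoff `φ`,
and integrate. All resulting integrals are double integrals of `Z(y)`, `V(y)`, `Z(y')` against
the kernels `pairKernel`, `pairGrad` and `pairCut`. Writing
`2 Z(y) · Z(y') = |Z(y)|² + |Z(y')|² - |Z(y) - Z(y')|²` and using `div V = div Z = 0`, the power equals
the flux through the support of `∇φ`, up to errors that are quadratic in the increments of `Z` and
linear in those of `V`, as in the argument of Constantin, E and Titi (`enorm_flux_add_le`). If the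
increments in `L³` are of order `r > 1/3`, the errors are `O(ε^(3r-1)) + O(ε^(1/2))`, and the limit is
the local energy balance `IsWeakTransport.local_balance`. It holds for Lipschitz cutoffs, and asks
for integrability of the pressure beyond `L¹` only near the support of `∇φ`.

*Boundary.* Take for `φ` the function `collarCutoff` of the distance to the complement of `Ω`, which
rises from `0` to `1` between the distances `h` and `2h`. Wherever the distance is differentiable,
hence almost everywhere by Rademacher's theorem, its gradient at `x` is `-n(m(x))`
(`fderiv_infDist_compl`), because the ball around `x` that touches the boundary at `m(x)` has the
same normal there as `Ω`. The flux is therefore `h⁻¹` times an integral over a collar, of volume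
`O(h)` by `exists_volume_collar_le`, of `|Z|²` or `π` times a normal component of `V` or `Z`. The
cubes of the normal components have integral `O(h^β)` with `β > 1`, and Young's inequality with
the weight `h^((β-1)/4)` shows that the flux tends to zero (`IsWeakTransport.ae_energy_eq_const`).
Thus the distributional time derivative of `∫ |Z|²` vanishes, and the lemma of du Bois-Reymond,
`ae_eq_const_of_integral_deriv_mul_eq_zero`, applies.
-/

/-! ### Distributional derivatives in one variable -/

/-- The primitive of a smooth function with vanishing integral and compact support in `(a,b)`
is again a test function on `(a,b)`. -/
theorem exists_primitive_of_integral_eq_zero {a b : ℝ} {θ : ℝ → ℝ}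
    (hθ : ContDiff ℝ ∞ θ) (hc : HasCompactSupport θ) (hs : tsupport θ ⊆ Ioo a b)
    (h0 : ∫ t, θ t = 0) :
    ∃ ψ : ℝ → ℝ, ContDiff ℝ ∞ ψ ∧ HasCompactSupport ψ ∧ tsupport ψ ⊆ Ioo a b ∧ deriv ψ = θ := by
  obtain hem | hne := (tsupport θ).eq_empty_or_nonempty
  · refine ⟨0, contDiff_const, HasCompactSupport.zero, by simp [tsupport], ?_⟩
    have : θ = 0 := by
      rw [← tsupport_eq_empty_iff]; exact hem
    rw [this]; ext; simp
  have hcc : IsCompact (tsupport θ) := hc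
  obtain ⟨c, hc1, hc2⟩ := hcc.exists_isLeast hne
  obtain ⟨d, hd1, hd2⟩ := hcc.exists_isGreatest hne
  have hz : ∀ t, t ∉ Icc c d → θ t = 0 := fun t ht =>
    image_eq_zero_of_notMem_tsupport fun h => ht ⟨hc2 h, hd2 h⟩
  have hder : ∀ t, HasDerivAt (fun t => ∫ s in a..t, θ s) (θ t) t := fun t =>
    intervalIntegral.integral_hasDerivAt_right (hθ.continuous.intervalIntegrable _ _)
      hθ.continuous.stronglyMeasurable.stronglyMeasurableAtFilter hθ.continuous.continuousAt
  have hac : a < c := (hs hc1).1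
  have hdb : d < b := (hs hd1).2
  have hsupp : Function.support (fun t => ∫ s in a..t, θ s) ⊆ Icc c d := by
    intro t ht
    by_contra hn
    apply ht
    rw [mem_Icc, not_and_or, not_le, not_le] at hn
    rcases hn with hn | hn
    · apply intervalIntegral.integral_zero_ae
      filter_upwards with s hs'
      apply hz
      rcases le_total a t with h | h
      · rw [uIoc_of_le h] at hs'; exact fun h' => absurd h'.1 (by linarith [hs'.2])
      · rw [uIoc_of_ge h] at hs'; exact fun h' => absurd h'.1 (by linarith [hs'.2])
    · have had : a ≤ t := by linarith [hc2 hd1]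
      have : ∫ s in a..t, θ s = ∫ s, θ s := by
        rw [intervalIntegral.integral_of_le had]
        apply setIntegral_eq_integral_of_forall_compl_eq_zero
        intro s hs'
        apply hz
        rintro ⟨h1, h2⟩
        exact hs' ⟨by linarith, by linarith⟩
      simp only [this, h0]
  have hts : tsupport (fun t => ∫ s in a..t, θ s) ⊆ Icc c d :=
    closure_minimal hsupp isClosed_Icc
  have hd' : deriv (fun t => ∫ s in a..t, θ s) = θ := funext fun t => (hder t).deriv
  refine ⟨fun t => ∫ s in a..t, θ s, ?_, ?_, ?_, hd'⟩
  · rw [contDiff_infty_iff_deriv]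
    exact ⟨fun t => (hder t).differentiableAt, by rw [hd']; exact hθ⟩
  · exact isCompact_Icc.of_isClosed_subset (isClosed_tsupport _) hts
  · exact hts.trans (Icc_subset_Ioo hac hdb)

/-- The lemma of du Bois-Reymond: a function with vanishing distributional derivative on an
interval is constant almost everywhere. -/
theorem ae_eq_const_of_integral_deriv_mul_eq_zero {a b : ℝ} (hab : a < b) {f : ℝ → ℝ}
    (hf : IntegrableOn f (Ioo a b))
    (h : ∀ ψ : ℝ → ℝ, ContDiff ℝ ∞ ψ → HasCompactSupport ψ → tsupport ψ ⊆ Ioo a b →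
      ∫ t in Ioo a b, deriv ψ t * f t = 0) :
    ∃ c : ℝ, ∀ᵐ t ∂(volume.restrict (Ioo a b)), f t = c := by
  -- a fixed bump `ρ` of integral one: `χ - (∫ χ) ρ` is a derivative for every test function `χ`
  let w : ContDiffBump ((a + b) / 2) := ⟨(b - a) / 8, (b - a) / 4, by linarith, by linarith⟩
  set ρ : ℝ → ℝ := w.normed volume with hρ
  have hρ1 : ContDiff ℝ ∞ ρ := w.contDiff_normed
  have hρ2 : HasCompactSupport ρ := w.hasCompactSupport_normed
  have hρ3 : tsupport ρ ⊆ Ioo a b := by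
    rw [hρ, w.tsupport_normed_eq]
    intro t ht
    rw [Metric.mem_closedBall, Real.dist_eq, abs_le] at ht
    change _ ≤ t - (a + b) / 2 ∧ t - (a + b) / 2 ≤ (b - a) / 4 at ht
    have h1 : -((b - a) / 4) ≤ t - (a + b) / 2 := ht.1
    constructor <;> linarith [ht.2]
  have hρ4 : ∫ t, ρ t = 1 := w.integral_normed
  have hint : ∀ χ : ℝ → ℝ, ContDiff ℝ ∞ χ → HasCompactSupport χ →
      Integrable (fun t => χ t * f t) (volume.restrict (Ioo a b)) := fun χ h1 h2 => by
    obtain ⟨C, hC⟩ := h1.continuous.bounded_above_of_compact_support h2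
    exact Integrable.bdd_mul (c := C) hf h1.continuous.aestronglyMeasurable
      (Eventually.of_forall hC)
  refine ⟨∫ t in Ioo a b, ρ t * f t, ?_⟩
  set c := ∫ t in Ioo a b, ρ t * f t with hcdef
  have key := isOpen_Ioo.ae_eq_zero_of_integral_contDiff_smul_eq_zero (μ := volume) (U := Ioo a b)
    (f := fun t => f t - c) ?_ ?_
  · rw [ae_restrict_iff' measurableSet_Ioo]
    filter_upwards [key] with t ht hm
    linarith [ht hm]
  · exact (hf.sub (integrableOn_const (by simp))).locallyIntegrableOn
  · intro χ h1 h2 h3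
    have hout : ∫ x, χ x • (f x - c) = ∫ x in Ioo a b, χ x * (f x - c) := by
      symm
      apply setIntegral_eq_integral_of_forall_compl_eq_zero
      intro x hx
      rw [image_eq_zero_of_notMem_tsupport fun h => hx (h3 h), zero_mul]
    have hχ : ∫ t in Ioo a b, χ t = ∫ t, χ t := by
      apply setIntegral_eq_integral_of_forall_compl_eq_zero
      intro x hx
      exact image_eq_zero_of_notMem_tsupport fun h => hx (h3 h)
    set k := ∫ t, χ t with hk
    have hiχ : Integrable χ := h1.continuous.integrable_of_hasCompactSupport h2
    have hiρ : Integrable ρ := hρ1.continuous.integrable_of_hasCompactSupport hρ2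
    obtain ⟨ψ, p1, p2, p3, p4⟩ := exists_primitive_of_integral_eq_zero (a := a) (b := b)
      (θ := fun t => χ t - k * ρ t) (h1.sub (contDiff_const.mul hρ1))
      (h2.sub hρ2.mul_left)
      ((tsupport_sub _ _).trans (union_subset h3 ((tsupport_mul_subset_right).trans hρ3)))
      (by rw [integral_sub hiχ (hiρ.const_mul _), integral_const_mul, hρ4, ← hk]; ring)
    have := h ψ p1 p2 p3
    rw [p4] at this
    simp_rw [sub_mul, mul_assoc] at this
    rw [integral_sub (hint χ h1 h2) ((hint ρ hρ1 hρ2).const_mul _), integral_const_mul,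
      ← hcdef] at this
    rw [hout]
    simp_rw [mul_sub]
    rw [integral_sub (hint χ h1 h2) (hiχ.integrableOn.mul_const _), integral_mul_const, hχ]
    linarith

/-- If `f' = -g` in the sense of distributions on `(0,T)`, with `f` bounded and `g` locally
integrable, then `(f²)' = -2 f g`. -/
theorem integral_deriv_mul_sq {T : ℝ} (hT : 0 < T) {f g : ℝ → ℝ} {C : ℝ}
    (hfm : Measurable f) (hfb : ∀ᵐ t ∂(volume.restrict (Ioo 0 T)), |f t| ≤ C)
    (hg : ∀ a b, 0 < a → b < T → IntegrableOn g (Icc a b))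
    (h : ∀ ψ : ℝ → ℝ, ContDiff ℝ ∞ ψ → HasCompactSupport ψ → tsupport ψ ⊆ Ioo 0 T →
      ∫ t in Ioo 0 T, deriv ψ t * f t = ∫ t in Ioo 0 T, ψ t * g t)
    {ψ : ℝ → ℝ} (hψ : ContDiff ℝ ∞ ψ) (hψc : HasCompactSupport ψ) (hψs : tsupport ψ ⊆ Ioo 0 T) :
    ∫ t in Ioo 0 T, deriv ψ t * f t ^ 2 = 2 * ∫ t in Ioo 0 T, ψ t * (f t * g t) := by
  obtain ⟨a, b, ha, hab, hbT, hsab⟩ :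
      ∃ a b : ℝ, 0 < a ∧ a < b ∧ b < T ∧ tsupport ψ ⊆ Ioo a b := by
    obtain hem | hne := (tsupport ψ).eq_empty_or_nonempty
    · exact ⟨T / 3, T / 2, by linarith, by linarith, by linarith, by simp [hem]⟩
    · have hcc : IsCompact (tsupport ψ) := hψc
      obtain ⟨c, hc1, hc2⟩ := hcc.exists_isLeast hne
      obtain ⟨d, hd1, hd2⟩ := hcc.exists_isGreatest hne
      have := hψs hc1
      have := hψs hd1
      have := hc2 hd1
      simp only [mem_Ioo] at *
      exact ⟨c / 2, (d + T) / 2, by linarith, by linarith, by linarith, fun t ht =>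
        ⟨by linarith [hc2 ht], by linarith [hd2 ht]⟩⟩
  have hsub : Ioo a b ⊆ Ioo 0 T := Ioo_subset_Ioo ha.le hbT.le
  have hgi : IntervalIntegrable g volume a b :=
    (intervalIntegrable_iff_integrableOn_Icc_of_le hab.le).2 (hg a b ha hbT)
  -- integrals against functions supported in `(a,b)`
  have hloc : ∀ χ : ℝ → ℝ, tsupport χ ⊆ Ioo a b → ∀ k : ℝ → ℝ,
      ∫ t in Ioo 0 T, χ t * k t = ∫ t in a..b, χ t * k t := fun χ hχ k => by
    rw [intervalIntegral.integral_of_le hab.le, integral_Ioc_eq_integral_Ioo]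
    apply setIntegral_eq_of_subset_of_forall_sdiff_eq_zero measurableSet_Ioo hsub
    intro x hx
    rw [image_eq_zero_of_notMem_tsupport fun h => hx.2 (hχ h), zero_mul]
  set G : ℝ → ℝ := fun t => ∫ s in a..t, g s with hG
  have hGac : AbsolutelyContinuousOnInterval G a b :=
    hgi.absolutelyContinuousOnInterval_intervalIntegral (by simp)
  have hGder : ∀ᵐ t, t ∈ uIoc a b → deriv G t = g t := by
    filter_upwards [hgi.ae_hasDerivAt_integral] with t ht hm
    exact (ht (uIoc_subset_uIcc hm) a (by simp)).deriv
  have hvan : ∀ χ : ℝ → ℝ, tsupport χ ⊆ Ioo a b → χ a = 0 ∧ χ b = 0 := fun χ hχ =>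
    ⟨image_eq_zero_of_notMem_tsupport fun h => (hχ h).1.false,
      image_eq_zero_of_notMem_tsupport fun h => (hχ h).2.false⟩
  have hac : ∀ χ : ℝ → ℝ, ContDiff ℝ ∞ χ → AbsolutelyContinuousOnInterval χ a b := fun χ hχ =>
    ((hχ.of_le (by simp)).contDiffOn : ContDiffOn ℝ 1 χ _).absolutelyContinuousOnInterval
  -- integration by parts against an absolutely continuous function
  have hparts : ∀ χ : ℝ → ℝ, ContDiff ℝ ∞ χ → tsupport χ ⊆ Ioo a b → ∀ H H' : ℝ → ℝ,
      AbsolutelyContinuousOnInterval H a b → (∀ᵐ t, t ∈ uIoc a b → deriv H t = H' t) →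
      ∫ t in a..b, deriv χ t * H t = - ∫ t in a..b, χ t * H' t := by
    intro χ h1 h2 H H' h3 h4
    have := (hac χ h1).integral_mul_deriv_eq_deriv_mul h3
    rw [(hvan χ h2).1, (hvan χ h2).2] at this
    have e : ∫ t in a..b, χ t * H' t = ∫ t in a..b, χ t * deriv H t := by
      apply intervalIntegral.integral_congr_ae
      filter_upwards [h4] with t ht hm
      rw [ht hm]
    rw [e, this]; ring
  have hfI : IntegrableOn f (Ioo a b) := by
    apply Measure.integrableOn_of_bounded (M := C) (by simp) hfm.aestronglyMeasurable
    exact ae_restrict_of_ae_restrict_of_subset hsub hfb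
  have hGI : IntegrableOn G (Ioo a b) := by
    have := hGac.continuousOn.integrableOn_compact isCompact_uIcc (μ := volume)
    rw [uIcc_of_le hab.le] at this
    exact this.mono_set Ioo_subset_Icc_self
  obtain ⟨c, hc⟩ := ae_eq_const_of_integral_deriv_mul_eq_zero hab (f := fun t => f t + G t)
    (hfI.add hGI) (by
      intro χ h1 h2 h3
      have h3' : tsupport (deriv χ) ⊆ Ioo a b := tsupport_deriv_subset.trans h3
      have hcd : Continuous (deriv χ) := h1.continuous_deriv (by simp)
      obtain ⟨D, hD⟩ := hcd.bounded_above_of_compact_support h2.deriv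
      simp_rw [mul_add]
      rw [integral_add
        (hfI.bdd_mul hcd.aestronglyMeasurable (Eventually.of_forall hD))
        (hGI.bdd_mul hcd.aestronglyMeasurable (Eventually.of_forall hD))]
      have e1 := h χ h1 h2 (h3.trans hsub)
      rw [hloc _ h3', hloc _ h3] at e1
      rw [← integral_Ioc_eq_integral_Ioo, ← integral_Ioc_eq_integral_Ioo,
        ← intervalIntegral.integral_of_le hab.le, ← intervalIntegral.integral_of_le hab.le,
        e1, hparts χ h1 h3 G g hGac hGder]
      ring)
  have hfc : ∀ᵐ t, t ∈ uIoc a b → f t = c - G t := by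
    rw [uIoc_of_le hab.le, ← ae_restrict_iff' measurableSet_Ioc,
      ← restrict_Ioo_eq_restrict_Ioc]
    filter_upwards [hc] with t ht
    linarith
  have hcG : AbsolutelyContinuousOnInterval (fun t => (c - G t) * (c - G t)) a b := by
    have : AbsolutelyContinuousOnInterval (fun t => c - G t) a b :=
      AbsolutelyContinuousOnInterval.sub (hac (fun _ => c) contDiff_const) hGac
    exact this.fun_mul this
  have hcG' : ∀ᵐ t, t ∈ uIoc a b →
      deriv (fun t => (c - G t) * (c - G t)) t = -(2 * (f t * g t)) := by
    filter_upwards [hgi.ae_hasDerivAt_integral, hfc] with t ht hf hm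
    have h1 := ht (uIoc_subset_uIcc hm) a (by simp)
    have h2 := (h1.const_sub c).mul (h1.const_sub c)
    rw [hf hm]
    refine h2.deriv.trans ?_
    ring
  have h3' : tsupport (deriv ψ) ⊆ Ioo a b := tsupport_deriv_subset.trans hsab
  rw [hloc _ h3', hloc _ hsab]
  have e : ∫ t in a..b, deriv ψ t * f t ^ 2
      = ∫ t in a..b, deriv ψ t * ((c - G t) * (c - G t)) := by
    apply intervalIntegral.integral_congr_ae
    filter_upwards [hfc] with t ht hm
    rw [ht hm]; ring
  rw [e, hparts ψ hψ hsab _ _ hcG hcG', ← intervalIntegral.integral_neg,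
    ← intervalIntegral.integral_const_mul]
  congr 1
  ext t; ring

/-! ### Mollifiers and the kernels of the smoothed energy -/

/-- `η` is a mollifier at scale `ε`: smooth, nonnegative, of integral one, vanishing outside the
ball of radius `ε`, with `η ≤ A` and `|∇η| ≤ A'`. -/
structure IsMollifier (η : E3 → ℝ) (ε A A' : ℝ) : Prop where
  contDiff : ContDiff ℝ ∞ η
  nonneg : ∀ x, 0 ≤ η x
  eq_zero : ∀ x, ε ≤ ‖x‖ → η x = 0
  integral_eq_one : ∫ x, η x = 1
  le : ∀ x, η x ≤ A
  fderiv_le : ∀ x, ‖fderiv ℝ η x‖ ≤ A'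

/-- `φ` is a Lipschitz cutoff: Lipschitz with compact support and values in `[-1,1]`. -/
structure IsLipCutoff (φ : E3 → ℝ) (L : NNReal) : Prop where
  lipschitz : LipschitzWith L φ
  compact : HasCompactSupport φ
  abs_le : ∀ x, |φ x| ≤ 1

/-- Integration by parts against a Lipschitz function with compact support. -/
theorem IsLipCutoff.integral_smul_fderiv {φ g : E3 → ℝ} {L : NNReal} (hφ : IsLipCutoff φ L)
    (hg : ContDiff ℝ ∞ g) (hgc : HasCompactSupport g) :
    ∫ x, φ x • fderiv ℝ g x = - ∫ x, g x • fderiv ℝ φ x := by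
  have hφm : AEStronglyMeasurable (fderiv ℝ φ) volume :=
    (measurable_fderiv ℝ φ).stronglyMeasurable.aestronglyMeasurable
  have hcg : Continuous (fderiv ℝ g) := hg.continuous_fderiv (by simp)
  have i1 : Integrable (fun x => φ x • fderiv ℝ g x) :=
    (hφ.lipschitz.continuous.smul hcg).integrable_of_hasCompactSupport hφ.compact.smul_right
  have i2 : Integrable (fun x => g x • fderiv ℝ φ x) := by
    have : Integrable g := hg.continuous.integrable_of_hasCompactSupport hgc
    exact this.smul_bdd (L : ℝ) hφm (Eventually.of_forall fun x =>
      norm_fderiv_le_of_lipschitz ℝ hφ.lipschitz)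
  obtain ⟨D, hD⟩ := ContDiff.lipschitzWith_of_hasCompactSupport hgc hg (by simp)
  ext w
  rw [neg_apply, ContinuousLinearMap.integral_apply i1,
    ContinuousLinearMap.integral_apply i2]
  have key := hφ.lipschitz.integral_lineDeriv_mul_eq (μ := volume) hD hgc w
  have e1 : ∫ x, lineDeriv ℝ φ x w * g x = ∫ x, (g x • fderiv ℝ φ x) w := by
    apply integral_congr_ae
    filter_upwards [hφ.lipschitz.ae_differentiableAt] with x hx
    rw [hx.lineDeriv_eq_fderiv]; simp [mul_comm]
  have e2 : ∫ x, lineDeriv ℝ g x (-w) * φ x = - ∫ x, (φ x • fderiv ℝ g x) w := by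
    rw [← integral_neg]
    congr 1; ext x
    rw [((hg.differentiable (by simp)) x).lineDeriv_eq_fderiv]; simp [mul_comm]
  rw [← e1, key, e2, neg_neg]

namespace IsMollifier

variable {η : E3 → ℝ} {ε A A' : ℝ}

theorem A_nonneg (hη : IsMollifier η ε A A') : 0 ≤ A := (hη.nonneg 0).trans (hη.le 0)

theorem A'_nonneg (hη : IsMollifier η ε A A') : 0 ≤ A' := (norm_nonneg _).trans (hη.fderiv_le 0)

theorem continuous (hη : IsMollifier η ε A A') : Continuous η := hη.contDiff.continuous

theorem continuous_fderiv (hη : IsMollifier η ε A A') : Continuous (fderiv ℝ η) :=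
  hη.contDiff.continuous_fderiv (by simp)

theorem fderiv_eq_zero (hη : IsMollifier η ε A A') {x : E3} (hx : ε ≤ ‖x‖) :
    fderiv ℝ η x = 0 :=
  IsLocalMin.fderiv_eq_zero (Eventually.of_forall fun y => by
    rw [hη.eq_zero x hx]; exact hη.nonneg y)

theorem tsupport_subset (hη : IsMollifier η ε A A') : tsupport η ⊆ Metric.closedBall 0 ε :=
  closure_minimal (fun x hx => by
    rw [mem_closedBall_zero_iff]
    by_contra h
    exact hx (hη.eq_zero x (not_le.1 h).le)) Metric.isClosed_closedBall

theorem hasCompactSupport (hη : IsMollifier η ε A A') : HasCompactSupport η :=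
  (isCompact_closedBall 0 ε).of_isClosed_subset (isClosed_tsupport _) hη.tsupport_subset

theorem norm_le (hη : IsMollifier η ε A A') (x : E3) : ‖η x‖ ≤ A := by
  rw [Real.norm_of_nonneg (hη.nonneg x)]; exact hη.le x

theorem integrable (hη : IsMollifier η ε A A') : Integrable η :=
  hη.continuous.integrable_of_hasCompactSupport hη.hasCompactSupport

theorem integrable_sub (hη : IsMollifier η ε A A') (y : E3) : Integrable (fun x => η (x - y)) :=
  hη.integrable.comp_sub_right y

theorem integral_sub (hη : IsMollifier η ε A A') (y : E3) : ∫ x, η (x - y) = 1 := by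
  rw [integral_sub_right_eq_self, hη.integral_eq_one]

theorem contDiff_sub (hη : IsMollifier η ε A A') (y : E3) : ContDiff ℝ ∞ (fun x => η (x - y)) :=
  hη.contDiff.comp (contDiff_id.sub contDiff_const)

theorem hasCompactSupport_sub (hη : IsMollifier η ε A A') (y : E3) :
    HasCompactSupport (fun x => η (x - y)) :=
  hη.hasCompactSupport.comp_homeomorph (Homeomorph.subRight y)

theorem fderiv_sub (η : E3 → ℝ) (x y : E3) :
    fderiv ℝ (fun x => η (x - y)) x = fderiv ℝ η (x - y) :=
  fderiv_comp_sub y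

end IsMollifier

section Kernels

variable (φ η : E3 → ℝ)

/-- `K(y,y') = ∫ φ(x) η(x-y) η(x-y') dx`. -/
noncomputable def pairKernel (y y' : E3) : ℝ := ∫ x, φ x * (η (x - y) * η (x - y'))

/-- `k(y,y') = ∫ φ(x) η(x-y') ∇η(x-y) dx`, as a linear form: minus the gradient of
`K` in `y`. -/
noncomputable def pairGrad (y y' : E3) : E3 →L[ℝ] ℝ :=
  ∫ x, φ x • (η (x - y') • fderiv ℝ η (x - y))

/-- `M(y,y') = ∫ η(x-y) η(x-y') ∇φ(x) dx`, as a linear form. -/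
noncomputable def pairCut (y y' : E3) : E3 →L[ℝ] ℝ :=
  ∫ x, (η (x - y) * η (x - y')) • fderiv ℝ φ x

/-- `φ^(y) = ∫ φ(x) η(x-y) dx`. -/
noncomputable def cutAvg (y : E3) : ℝ := ∫ x, φ x * η (x - y)

/-- `N(y) = ∫ η(x-y) ∇φ(x) dx`, as a linear form. -/
noncomputable def cutGradAvg (y : E3) : E3 →L[ℝ] ℝ := ∫ x, η (x - y) • fderiv ℝ φ x

variable {φ η} {L : NNReal} {ε A A' : ℝ}

/-- Integration by parts: `∇η(x-y) η(x-y') + η(x-y) ∇η(x-y')` is the gradient in `x` of the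
product of the two mollifiers, and moves to the cutoff. -/
theorem pairGrad_add_swap (hφ : IsLipCutoff φ L) (hη : IsMollifier η ε A A') (y y' : E3) :
    pairGrad φ η y y' + pairGrad φ η y' y = - pairCut φ η y y' := by
  have hI : ∀ y y' : E3, Integrable (fun x => φ x • (η (x - y') • fderiv ℝ η (x - y))) :=
    fun y y' => Continuous.integrable_of_hasCompactSupport
      (hφ.lipschitz.continuous.smul
        ((hη.continuous.comp (continuous_sub_right _)).smul
          (hη.continuous_fderiv.comp (continuous_sub_right _)))) hφ.compact.smul_right
  rw [pairCut, ← hφ.integral_smul_fderiv ((hη.contDiff_sub y).mul (hη.contDiff_sub y'))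
    (hη.hasCompactSupport_sub y).mul_right, pairGrad, pairGrad, ← integral_add (hI _ _) (hI _ _)]
  congr 1
  ext1 x
  rw [fderiv_fun_mul ((hη.contDiff_sub y).differentiable (by simp) x)
    ((hη.contDiff_sub y').differentiable (by simp) x), IsMollifier.fderiv_sub,
    IsMollifier.fderiv_sub, ← smul_add, add_comm]

theorem integral_smul_fderiv_sub (hφ : IsLipCutoff φ L) (hη : IsMollifier η ε A A') (y : E3) :
    ∫ x, φ x • fderiv ℝ η (x - y) = - cutGradAvg φ η y := by
  rw [cutGradAvg, ← hφ.integral_smul_fderiv (hη.contDiff_sub y) (hη.hasCompactSupport_sub y)]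
  simp_rw [IsMollifier.fderiv_sub]

theorem norm_pairKernel_le (hφ : IsLipCutoff φ L) (hη : IsMollifier η ε A A') (y y' : E3) :
    ‖pairKernel φ η y y'‖ ≤ A := by
  refine (norm_integral_le_of_norm_le (g := fun x => A * η (x - y))
    ((hη.integrable_sub y).const_mul A) (Eventually.of_forall fun x => ?_)).trans ?_
  · rw [norm_mul, norm_mul, Real.norm_of_nonneg (hη.nonneg (x - y)), mul_comm A]
    have h1 : ‖φ x‖ ≤ 1 := hφ.abs_le x
    have h2 := hη.norm_le (x - y')
    have h3 := hη.nonneg (x - y)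
    calc ‖φ x‖ * (η (x - y) * ‖η (x - y')‖) ≤ 1 * (η (x - y) * A) := by gcongr
      _ = _ := one_mul _
  · rw [integral_const_mul, hη.integral_sub, mul_one]

theorem norm_pairGrad_le (hφ : IsLipCutoff φ L) (hη : IsMollifier η ε A A') (y y' : E3) :
    ‖pairGrad φ η y y'‖ ≤ A' := by
  refine (norm_integral_le_of_norm_le (g := fun x => A' * η (x - y'))
    ((hη.integrable_sub y').const_mul A') (Eventually.of_forall fun x => ?_)).trans ?_
  · rw [norm_smul, norm_smul, Real.norm_of_nonneg (hη.nonneg (x - y')), mul_comm A']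
    have h1 : ‖φ x‖ ≤ 1 := hφ.abs_le x
    have h2 := hη.fderiv_le (x - y)
    have h3 := hη.nonneg (x - y')
    calc ‖φ x‖ * (η (x - y') * ‖fderiv ℝ η (x - y)‖) ≤ 1 * (η (x - y') * A') := by gcongr
      _ = _ := one_mul _
  · rw [integral_const_mul, hη.integral_sub, mul_one]

theorem norm_pairCut_le (hφ : IsLipCutoff φ L) (hη : IsMollifier η ε A A') (y y' : E3) :
    ‖pairCut φ η y y'‖ ≤ A * L := by
  refine (norm_integral_le_of_norm_le (g := fun x => A * L * η (x - y))
    ((hη.integrable_sub y).const_mul (A * L)) (Eventually.of_forall fun x => ?_)).trans ?_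
  · rw [norm_smul, norm_mul, Real.norm_of_nonneg (hη.nonneg (x - y)), mul_comm (A * (L : ℝ))]
    have h1 : ‖fderiv ℝ φ x‖ ≤ L := norm_fderiv_le_of_lipschitz ℝ hφ.lipschitz
    have h2 := hη.norm_le (x - y')
    have h3 := hη.nonneg (x - y)
    have h4 := hη.A_nonneg
    calc η (x - y) * ‖η (x - y')‖ * ‖fderiv ℝ φ x‖ ≤ η (x - y) * A * L := by gcongr
      _ = _ := mul_assoc _ _ _
  · rw [integral_const_mul, hη.integral_sub, mul_one]

theorem norm_cutGradAvg_le (hφ : IsLipCutoff φ L) (hη : IsMollifier η ε A A') (y : E3) :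
    ‖cutGradAvg φ η y‖ ≤ L := by
  refine (norm_integral_le_of_norm_le (g := fun x => L * η (x - y))
    ((hη.integrable_sub y).const_mul L) (Eventually.of_forall fun x => ?_)).trans ?_
  · rw [norm_smul, Real.norm_of_nonneg (hη.nonneg (x - y)), mul_comm (L : ℝ)]
    have h1 : ‖fderiv ℝ φ x‖ ≤ L := norm_fderiv_le_of_lipschitz ℝ hφ.lipschitz
    have h3 := hη.nonneg (x - y)
    gcongr
  · rw [integral_const_mul, hη.integral_sub, mul_one]

theorem norm_cutAvg_le (hφ : IsLipCutoff φ L) (hη : IsMollifier η ε A A') (y : E3) :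
    ‖cutAvg φ η y‖ ≤ 1 := by
  refine (norm_integral_le_of_norm_le (g := fun x => η (x - y))
    (hη.integrable_sub y) (Eventually.of_forall fun x => ?_)).trans ?_
  · rw [norm_mul, Real.norm_of_nonneg (hη.nonneg (x - y))]
    exact mul_le_of_le_one_left (hη.nonneg _) (hφ.abs_le x)
  · rw [hη.integral_sub]

/-- The two arguments of the kernels interact only at distance less than `2ε`. -/
theorem le_norm_sub_or {y y' : E3} (h : 2 * ε ≤ ‖y - y'‖)
    (x : E3) : ε ≤ ‖x - y‖ ∨ ε ≤ ‖x - y'‖ := by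
  by_contra! hc
  have : ‖y - y'‖ ≤ ‖x - y'‖ + ‖x - y‖ := by
    have := norm_sub_le (x - y') (x - y)
    simpa using this
  linarith

theorem pairKernel_eq_zero (hη : IsMollifier η ε A A') {y y' : E3} (h : 2 * ε ≤ ‖y - y'‖) :
    pairKernel φ η y y' = 0 := by
  refine integral_eq_zero_of_ae (Eventually.of_forall fun x => ?_)
  rcases le_norm_sub_or h x with h | h <;> simp [hη.eq_zero _ h]

theorem pairGrad_eq_zero (hη : IsMollifier η ε A A') {y y' : E3} (h : 2 * ε ≤ ‖y - y'‖) :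
    pairGrad φ η y y' = 0 := by
  refine integral_eq_zero_of_ae (Eventually.of_forall fun x => ?_)
  rcases le_norm_sub_or h x with h | h <;> simp [hη.eq_zero _ h, hη.fderiv_eq_zero h]

theorem pairCut_eq_zero (hη : IsMollifier η ε A A') {y y' : E3} (h : 2 * ε ≤ ‖y - y'‖) :
    pairCut φ η y y' = 0 := by
  refine integral_eq_zero_of_ae (Eventually.of_forall fun x => ?_)
  rcases le_norm_sub_or h x with h | h <;> simp [hη.eq_zero _ h]

/-- The kernel `M` only sees points at distance less than `ε` from the support of `∇φ`. -/
theorem pairCut_eq_zero_of_cut (hη : IsMollifier η ε A A') {y : E3}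
    (h : ∀ x, ‖x - y‖ < ε → fderiv ℝ φ x = 0) (y' : E3) : pairCut φ η y y' = 0 := by
  refine integral_eq_zero_of_ae (Eventually.of_forall fun x => ?_)
  rcases lt_or_ge ‖x - y‖ ε with h' | h'
  · simp [h x h']
  · simp [hη.eq_zero _ h']

theorem stronglyMeasurable_pairKernel (hφ : IsLipCutoff φ L) (hη : IsMollifier η ε A A') :
    StronglyMeasurable (fun p : E3 × E3 => pairKernel φ η p.1 p.2) := by
  have h1 := hφ.lipschitz.continuous
  have h2 := hη.continuous
  exact StronglyMeasurable.integral_prod_right (ν := volume)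
    (f := fun (p : E3 × E3) (x : E3) => φ x * (η (x - p.1) * η (x - p.2)))
    (Continuous.stronglyMeasurable (by fun_prop))

theorem stronglyMeasurable_pairGrad (hφ : IsLipCutoff φ L) (hη : IsMollifier η ε A A') :
    StronglyMeasurable (fun p : E3 × E3 => pairGrad φ η p.1 p.2) := by
  have h1 := hφ.lipschitz.continuous
  have h2 := hη.continuous
  have h3 := hη.continuous_fderiv
  exact StronglyMeasurable.integral_prod_right (ν := volume)
    (f := fun (p : E3 × E3) (x : E3) => φ x • (η (x - p.2) • fderiv ℝ η (x - p.1)))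
    (Continuous.stronglyMeasurable (by fun_prop))

theorem stronglyMeasurable_pairCut (hη : IsMollifier η ε A A') :
    StronglyMeasurable (fun p : E3 × E3 => pairCut φ η p.1 p.2) := by
  have h2 := hη.continuous
  exact StronglyMeasurable.integral_prod_right (ν := volume)
    (f := fun (p : E3 × E3) (x : E3) => (η (x - p.1) * η (x - p.2)) • fderiv ℝ φ x)
    (StronglyMeasurable.smul (f := fun q : (E3 × E3) × E3 => η (q.2 - q.1.1) * η (q.2 - q.1.2))
      (Continuous.stronglyMeasurable (by fun_prop))
      ((measurable_fderiv ℝ φ).stronglyMeasurable.comp_measurable measurable_snd))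

theorem stronglyMeasurable_cutGradAvg (hη : IsMollifier η ε A A') :
    StronglyMeasurable (cutGradAvg φ η) := by
  have h2 := hη.continuous
  exact StronglyMeasurable.integral_prod_right (ν := volume)
    (f := fun (y x : E3) => η (x - y) • fderiv ℝ φ x)
    (StronglyMeasurable.smul (f := fun q : E3 × E3 => η (q.2 - q.1))
      (Continuous.stronglyMeasurable (by fun_prop))
      ((measurable_fderiv ℝ φ).stronglyMeasurable.comp_measurable measurable_snd))

theorem stronglyMeasurable_cutAvg (hφ : IsLipCutoff φ L) (hη : IsMollifier η ε A A') :
    StronglyMeasurable (cutAvg φ η) := by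
  have h1 := hφ.lipschitz.continuous
  have h2 := hη.continuous
  exact StronglyMeasurable.integral_prod_right (ν := volume)
    (f := fun (y x : E3) => φ x * η (x - y))
    (Continuous.stronglyMeasurable (by fun_prop))

end Kernels

/-! ### Integrals of the kernels -/

section KernelIntegrals

variable {φ η : E3 → ℝ} {L : NNReal} {ε A A' : ℝ} {μ : Measure E3} [IsFiniteMeasure μ]

/-- Fubini in the smoothing variable. The measure `μ` is that of a set containing the balls of radius
`ε` around `tsupport φ`, so that `η(x - ·)` has integral one there. -/
theorem integral_integral_mollifier_smul {G : Type*} [NormedAddCommGroup G] [NormedSpace ℝ G]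
    [CompleteSpace G] [SecondCountableTopology G]
    (hη : IsMollifier η ε A A') (hμ : ∀ x ∈ tsupport φ, ∫ y, η (x - y) ∂μ = 1)
    {F : E3 → G} (hF : Integrable F) (hF0 : ∀ x, x ∉ tsupport φ → F x = 0) :
    ∫ y, (∫ x, η (x - y) • F x) ∂μ = ∫ x, F x := by
  have hc := hη.continuous
  rw [integral_integral_swap]
  · congr 1; ext1 x
    rw [integral_smul_const]
    by_cases hx : x ∈ tsupport φ
    · rw [hμ x hx, one_smul]
    · rw [hF0 x hx, smul_zero]
  · have h1 : Integrable (fun z : E3 × E3 => F z.2) (μ.prod volume) := hF.comp_snd μ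
    exact h1.bdd_smul (φ := fun z : E3 × E3 => η (z.2 - z.1)) A
      (Continuous.aestronglyMeasurable (by fun_prop))
      (Eventually.of_forall fun z => hη.norm_le _)

theorem integral_pairKernel (hφ : IsLipCutoff φ L) (hη : IsMollifier η ε A A')
    (hμ : ∀ x ∈ tsupport φ, ∫ y, η (x - y) ∂μ = 1) (y : E3) :
    ∫ y', pairKernel φ η y y' ∂μ = cutAvg φ η y := by
  have hc := hη.continuous
  have hc' := hφ.lipschitz.continuous
  have := integral_integral_mollifier_smul hη hμ (F := fun x => φ x * η (x - y))
    (Continuous.integrable_of_hasCompactSupport (by fun_prop) hφ.compact.mul_right)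
    (fun x hx => by rw [image_eq_zero_of_notMem_tsupport hx, zero_mul])
  rw [cutAvg, ← this]
  congr 1; ext1 y'
  rw [pairKernel]
  congr 1; ext1 x
  simp only [smul_eq_mul]; ring

theorem integrable_smul_fderiv (hφ : IsLipCutoff φ L) (hη : IsMollifier η ε A A') (y : E3) :
    Integrable (fun x => η (x - y) • fderiv ℝ φ x) := by
  exact (hη.integrable_sub y).smul_bdd (L : ℝ)
    (measurable_fderiv ℝ φ).stronglyMeasurable.aestronglyMeasurable
    (Eventually.of_forall fun x => norm_fderiv_le_of_lipschitz ℝ hφ.lipschitz)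

theorem integral_pairCut (hφ : IsLipCutoff φ L) (hη : IsMollifier η ε A A')
    (hμ : ∀ x ∈ tsupport φ, ∫ y, η (x - y) ∂μ = 1) (y : E3) :
    ∫ y', pairCut φ η y y' ∂μ = cutGradAvg φ η y := by
  have := integral_integral_mollifier_smul hη hμ (F := fun x => η (x - y) • fderiv ℝ φ x)
    (integrable_smul_fderiv hφ hη y)
    (fun x hx => by rw [fderiv_of_notMem_tsupport ℝ hx, smul_zero])
  rw [cutGradAvg, ← this]
  congr 1; ext1 y'
  rw [pairCut]
  congr 1; ext1 x
  rw [smul_smul, mul_comm]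

theorem integral_pairGrad (hφ : IsLipCutoff φ L) (hη : IsMollifier η ε A A')
    (hμ : ∀ x ∈ tsupport φ, ∫ y, η (x - y) ∂μ = 1) (y : E3) :
    ∫ y', pairGrad φ η y y' ∂μ = - cutGradAvg φ η y := by
  have hc := hη.continuous_fderiv
  have hc' := hφ.lipschitz.continuous
  have := integral_integral_mollifier_smul hη hμ (F := fun x => φ x • fderiv ℝ η (x - y))
    (Continuous.integrable_of_hasCompactSupport (by fun_prop) hφ.compact.smul_right)
    (fun x hx => by rw [image_eq_zero_of_notMem_tsupport hx, zero_smul])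
  rw [← integral_smul_fderiv_sub hφ hη, ← this]
  congr 1; ext1 y'
  rw [pairGrad]
  congr 1; ext1 x
  rw [smul_comm]

theorem pairGrad_apply (hφ : IsLipCutoff φ L) (hη : IsMollifier η ε A A') (y y' w : E3) :
    pairGrad φ η y y' w = ∫ x, φ x * (η (x - y') * fderiv ℝ η (x - y) w) := by
  have h1 := hφ.lipschitz.continuous
  have h2 := hη.continuous
  have h3 := hη.continuous_fderiv
  rw [pairGrad, ContinuousLinearMap.integral_apply]
  · rfl
  · exact Continuous.integrable_of_hasCompactSupport (by fun_prop) hφ.compact.smul_right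

/-- A field orthogonal to the gradients of all shifted mollifiers is orthogonal to the
gradients of the kernel. -/
theorem integral_pairGrad_apply_eq_zero (hφ : IsLipCutoff φ L) (hη : IsMollifier η ε A A')
    {V : E3 → E3} (hV : Integrable V μ)
    (hdiv : ∀ᵐ x, x ∈ tsupport φ → ∫ y, fderiv ℝ η (x - y) (V y) ∂μ = 0) (y' : E3) :
    ∫ y, pairGrad φ η y y' (V y) ∂μ = 0 := by
  have h1 := hφ.lipschitz.continuous
  have h2 := hη.continuous
  have h3 := hη.continuous_fderiv
  simp_rw [pairGrad_apply hφ hη]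
  rw [integral_integral_swap]
  · apply integral_eq_zero_of_ae
    filter_upwards [hdiv] with x hx
    rw [integral_const_mul, integral_const_mul]
    by_cases hxs : x ∈ tsupport φ
    · simp [hx hxs]
    · simp [image_eq_zero_of_notMem_tsupport hxs]
  · have hφi : Integrable φ := h1.integrable_of_hasCompactSupport hφ.compact
    have hp := (hV.norm.mul_prod hφi.norm)
    refine (hp.const_mul (A * A')).mono' ?_ (Eventually.of_forall fun z => ?_)
    · apply AEStronglyMeasurable.mul (h1.comp continuous_snd).aestronglyMeasurable
      apply AEStronglyMeasurable.mul (Continuous.aestronglyMeasurable (by fun_prop))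
      have hm1 : AEStronglyMeasurable (fun z : E3 × E3 => fderiv ℝ η (z.2 - z.1))
        (μ.prod volume) := Continuous.aestronglyMeasurable (by fun_prop)
      exact isBoundedBilinearMap_apply.continuous.comp_aestronglyMeasurable
        (hm1.prodMk hV.aestronglyMeasurable.comp_fst)
    · have a1 := hη.norm_le (z.2 - y')
      have a2 := (fderiv ℝ η (z.2 - z.1)).le_of_opNorm_le (hη.fderiv_le _) (V z.1)
      have a3 := hη.A_nonneg
      simp only [Function.uncurry, norm_mul]
      calc ‖φ z.2‖ * (‖η (z.2 - y')‖ * ‖fderiv ℝ η (z.2 - z.1) (V z.1)‖)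
          ≤ ‖φ z.2‖ * (A * (A' * ‖V z.1‖)) := by gcongr
        _ = _ := by ring

end KernelIntegrals

/-! ### The energy and the flux at a fixed time -/

section Powers

variable {α : Type*} [MeasurableSpace α] {ν : Measure α} {Z V : α → E3}

theorem integrable_norm_sq_of_cube [IsFiniteMeasure ν] (hZm : AEStronglyMeasurable Z ν)
    (hZ : Integrable (fun y => ‖Z y‖ ^ 3) ν) : Integrable (fun y => ‖Z y‖ ^ 2) ν := by
  refine ((integrable_const (1 : ℝ)).add hZ).mono' (hZm.norm.pow 2)
    (Eventually.of_forall fun y => ?_)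
  simp only [Pi.add_apply, norm_pow, norm_norm]
  have := norm_nonneg (Z y)
  rcases le_total ‖Z y‖ 1 with h | h <;> nlinarith [pow_nonneg this 3, pow_nonneg this 2]

theorem integrable_norm_of_sq [IsFiniteMeasure ν] (hZm : AEStronglyMeasurable Z ν)
    (hZ : Integrable (fun y => ‖Z y‖ ^ 2) ν) : Integrable (fun y => ‖Z y‖) ν := by
  refine ((integrable_const (1 : ℝ)).add hZ).mono' hZm.norm (Eventually.of_forall fun y => ?_)
  simp only [Pi.add_apply, norm_norm]
  nlinarith [sq_nonneg (‖Z y‖ - 1), norm_nonneg (Z y)]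

theorem integrable_norm_mul_sq_of_cube (hVm : AEStronglyMeasurable V ν)
    (hZm : AEStronglyMeasurable Z ν) (hV : Integrable (fun y => ‖V y‖ ^ 3) ν)
    (hZ : Integrable (fun y => ‖Z y‖ ^ 3) ν) :
    Integrable (fun y => ‖V y‖ * ‖Z y‖ ^ 2) ν := by
  refine (hV.add hZ).mono' (hVm.norm.mul (hZm.norm.pow 2)) (Eventually.of_forall fun y => ?_)
  simp only [Pi.add_apply, norm_mul, norm_pow, norm_norm]
  have h1 := norm_nonneg (Z y)
  have h2 := norm_nonneg (V y)
  rcases le_total ‖V y‖ ‖Z y‖ with h | h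
  · nlinarith [pow_nonneg h2 3, mul_nonneg (sub_nonneg.2 h) (pow_nonneg h1 2)]
  · nlinarith [pow_nonneg h1 3, mul_nonneg h2 (mul_nonneg (sub_nonneg.2 h) (add_nonneg h1 h2))]

end Powers

section FixedTime

variable {φ η : E3 → ℝ} {L : NNReal} {ε A A' : ℝ} {μ : Measure E3} [IsFiniteMeasure μ]

theorem integrable_clm_apply_mul {α : Type*} [MeasurableSpace α] {ν : Measure α}
    {κ : α → E3 →L[ℝ] ℝ} {C : ℝ} (hκ : StronglyMeasurable κ) (hC : ∀ p, ‖κ p‖ ≤ C)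
    {a : α → E3} {s : α → ℝ} (ha : AEStronglyMeasurable a ν) (hs : AEStronglyMeasurable s ν)
    (h : Integrable (fun p => ‖a p‖ * ‖s p‖) ν) :
    Integrable (fun p => κ p (a p) * s p) ν := by
  refine (h.const_mul C).mono' ?_ (Eventually.of_forall fun p => ?_)
  · exact (isBoundedBilinearMap_apply.continuous.comp_aestronglyMeasurable
      (hκ.aestronglyMeasurable.prodMk ha)).mul hs
  · rw [norm_mul, ← mul_assoc]
    gcongr
    exact (κ p).le_of_opNorm_le (hC p) _

set_option maxHeartbeats 1000000 in
/-- The power of the smoothed field differs from the flux through the support of `∇φ` by smoothing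
errors: a term quadratic in the increments of `Z` and linear in those of `V` (the commutator of
Constantin, E and Titi), and two terms with the gradient of `φ`. Since `div Z = 0`, the pressure
only enters through `M` and `N`, that is within distance `ε` of the support of `∇φ`, where it may be
replaced by `Q`. -/
theorem enorm_flux_add_le (hφ : IsLipCutoff φ L) (hη : IsMollifier η ε A A')
    (hμ : ∀ x ∈ tsupport φ, ∫ y, η (x - y) ∂μ = 1)
    {Z V : E3 → E3} {P Q : E3 → ℝ} (hZm : StronglyMeasurable Z) (hVm : StronglyMeasurable V)
    (hQm : StronglyMeasurable Q)
    (hZ : Integrable (fun y => ‖Z y‖ ^ 3) μ) (hV : Integrable (fun y => ‖V y‖ ^ 3) μ)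
    (hP : Integrable P μ)
    (hQP : ∀ y, (∀ x, ‖x - y‖ < ε → fderiv ℝ φ x = 0) ∨ Q y = P y)
    (hQZ : Integrable (fun y => ‖Z y‖ * ‖Q y‖) μ)
    (hdivZ : ∀ᵐ x, x ∈ tsupport φ → ∫ y, fderiv ℝ η (x - y) (Z y) ∂μ = 0)
    (hdivV : ∀ᵐ x, x ∈ tsupport φ → ∫ y, fderiv ℝ η (x - y) (V y) ∂μ = 0) :
    ‖2 * (∫ p, pairGrad φ η p.1 p.2 (V p.1) * inner ℝ (Z p.1) (Z p.2)
        + P p.1 * pairGrad φ η p.1 p.2 (Z p.2) ∂(μ.prod μ))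
      + ∫ y, cutGradAvg φ η y (V y) * ‖Z y‖ ^ 2 ∂μ
      + 2 * ∫ y, cutGradAvg φ η y (Z y) * Q y ∂μ‖ₑ
    ≤ ∫⁻ p, ENNReal.ofReal (‖pairGrad φ η p.1 p.2‖ * ‖V p.1 - V p.2‖ * ‖Z p.1 - Z p.2‖ ^ 2
        + ‖pairCut φ η p.1 p.2‖ * ‖V p.2‖ * ‖Z p.1 - Z p.2‖ ^ 2
        + 2 * (‖pairCut φ η p.1 p.2‖ * ‖Z p.1 - Z p.2‖ * ‖Q p.1‖)) ∂(μ.prod μ) := by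
  set ν := μ.prod μ with hν
  set k : E3 → E3 → E3 →L[ℝ] ℝ := pairGrad φ η with hk
  set M : E3 → E3 → E3 →L[ℝ] ℝ := pairCut φ η with hM
  set N : E3 → E3 →L[ℝ] ℝ := cutGradAvg φ η with hN
  -- measurability
  have kM : StronglyMeasurable (fun p : E3 × E3 => k p.1 p.2) := stronglyMeasurable_pairGrad hφ hη
  have kM' : StronglyMeasurable (fun p : E3 × E3 => k p.2 p.1) :=
    kM.comp_measurable measurable_swap
  have MM : StronglyMeasurable (fun p : E3 × E3 => M p.1 p.2) := stronglyMeasurable_pairCut hη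
  have NM : StronglyMeasurable N := stronglyMeasurable_cutGradAvg hη
  have kC : ∀ p : E3 × E3, ‖k p.1 p.2‖ ≤ A' := fun p => norm_pairGrad_le hφ hη _ _
  have kC' : ∀ p : E3 × E3, ‖k p.2 p.1‖ ≤ A' := fun p => norm_pairGrad_le hφ hη _ _
  have MC : ∀ p : E3 × E3, ‖M p.1 p.2‖ ≤ A * L := fun p => norm_pairCut_le hφ hη _ _
  have NC : ∀ y : E3, ‖N y‖ ≤ L := fun y => norm_cutGradAvg_le hφ hη _
  have Z1 : StronglyMeasurable (fun p : E3 × E3 => Z p.1) := hZm.comp_measurable measurable_fst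
  have Z2 : StronglyMeasurable (fun p : E3 × E3 => Z p.2) := hZm.comp_measurable measurable_snd
  have V1 : StronglyMeasurable (fun p : E3 × E3 => V p.1) := hVm.comp_measurable measurable_fst
  have V2 : StronglyMeasurable (fun p : E3 × E3 => V p.2) := hVm.comp_measurable measurable_snd
  have Q1 : StronglyMeasurable (fun p : E3 × E3 => Q p.1) := hQm.comp_measurable measurable_fst
  have P1 : AEStronglyMeasurable (fun p : E3 × E3 => P p.1) ν := hP.aestronglyMeasurable.comp_fst
  -- integrability of the powers
  have iZ2 : Integrable (fun y => ‖Z y‖ ^ 2) μ :=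
    integrable_norm_sq_of_cube hZm.aestronglyMeasurable hZ
  have iZ : Integrable (fun y => ‖Z y‖) μ := integrable_norm_of_sq hZm.aestronglyMeasurable iZ2
  have iV : Integrable (fun y => ‖V y‖) μ := integrable_norm_of_sq hVm.aestronglyMeasurable
    (integrable_norm_sq_of_cube hVm.aestronglyMeasurable hV)
  have iZv : Integrable Z μ := (integrable_norm_iff hZm.aestronglyMeasurable).1 iZ
  have iVv : Integrable V μ := (integrable_norm_iff hVm.aestronglyMeasurable).1 iV
  have iVZ2 : Integrable (fun y => ‖V y‖ * ‖Z y‖ ^ 2) μ :=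
    integrable_norm_mul_sq_of_cube hVm.aestronglyMeasurable hZm.aestronglyMeasurable hV hZ
  have iVZ : Integrable (fun y => ‖V y‖ * ‖Z y‖) μ := by
    refine (iV.add iVZ2).mono' (hVm.norm.mul hZm.norm).aestronglyMeasurable
      (Eventually.of_forall fun y => ?_)
    simp only [Pi.add_apply, norm_mul, norm_norm]
    have h2 := norm_nonneg (V y)
    nlinarith [mul_nonneg h2 (sq_nonneg (‖Z y‖ - 1)), mul_nonneg h2 (norm_nonneg (Z y))]
  -- integrability of the products
  have jVZZ : Integrable (fun p : E3 × E3 => ‖V p.1‖ * ‖(inner ℝ (Z p.1) (Z p.2) : ℝ)‖) ν := by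
    refine (iVZ.mul_prod iZ).mono' (V1.norm.mul (Z1.inner Z2).norm).aestronglyMeasurable
      (Eventually.of_forall fun p => ?_)
    rw [norm_mul, norm_norm, norm_norm, mul_assoc]
    gcongr
    exact norm_inner_le_norm _ _
  have jV1Z1 : Integrable (fun p : E3 × E3 => ‖V p.1‖ * ‖‖Z p.1‖ ^ 2‖) ν := by
    simpa using iVZ2.comp_fst μ
  have jV1Z2 : Integrable (fun p : E3 × E3 => ‖V p.1‖ * ‖‖Z p.2‖ ^ 2‖) ν := by
    simpa using iV.mul_prod iZ2
  have D : StronglyMeasurable (fun p : E3 × E3 => ‖Z p.1 - Z p.2‖ ^ 2) :=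
    ((Z1.sub Z2).norm).pow 2
  have jV1D : Integrable (fun p : E3 × E3 => ‖V p.1‖ * ‖‖Z p.1 - Z p.2‖ ^ 2‖) ν := by
    refine ((jV1Z1.add jV1Z2).const_mul 2).mono' (V1.norm.mul D.norm).aestronglyMeasurable
      (Eventually.of_forall fun p => ?_)
    simp only [Pi.add_apply, norm_mul, norm_pow, norm_norm]
    have h1 := norm_sub_le (Z p.1) (Z p.2)
    have h2 : ‖Z p.1 - Z p.2‖ ^ 2 ≤ 2 * (‖Z p.1‖ ^ 2 + ‖Z p.2‖ ^ 2) := by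
      nlinarith [sq_nonneg (‖Z p.1‖ - ‖Z p.2‖), norm_nonneg (Z p.1 - Z p.2)]
    nlinarith [mul_le_mul_of_nonneg_left h2 (norm_nonneg (V p.1))]
  have jV2D : Integrable (fun p : E3 × E3 => ‖V p.2‖ * ‖‖Z p.1 - Z p.2‖ ^ 2‖) ν := by
    have := jV1D.swap
    refine this.congr (Eventually.of_forall fun p => ?_)
    simp [norm_sub_rev]
  have jPZ : Integrable (fun p : E3 × E3 => ‖Z p.2‖ * ‖P p.1‖) ν := by
    refine (hP.norm.mul_prod iZ).congr (Eventually.of_forall fun p => ?_)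
    simp [mul_comm]
  have jQZ1 : Integrable (fun p : E3 × E3 => ‖Z p.1‖ * ‖Q p.1‖) ν := hQZ.comp_fst μ
  -- `M` and `P` only meet where `Q = P`
  have hPQ : ∀ y y' w, M y y' w * P y = M y y' w * Q y := fun y y' w => by
    rcases hQP y with h | h
    · rw [hM, pairCut_eq_zero_of_cut hη h]; simp
    · rw [h]
  have hMP : Integrable (fun p : E3 × E3 => M p.1 p.2 (Z p.2) * P p.1) ν :=
    integrable_clm_apply_mul MM MC Z2.aestronglyMeasurable P1 jPZ
  have hMQ : Integrable (fun p : E3 × E3 => M p.1 p.2 (Z p.1) * Q p.1) ν :=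
    integrable_clm_apply_mul MM MC Z1.aestronglyMeasurable Q1.aestronglyMeasurable jQZ1
  have hkP : Integrable (fun p : E3 × E3 => k p.1 p.2 (Z p.2) * P p.1) ν :=
    integrable_clm_apply_mul kM kC Z2.aestronglyMeasurable P1 jPZ
  have hkP' : Integrable (fun p : E3 × E3 => k p.2 p.1 (Z p.2) * P p.1) ν :=
    integrable_clm_apply_mul kM' kC' Z2.aestronglyMeasurable P1 jPZ
  have hk0 : Integrable (fun p : E3 × E3 => k p.1 p.2 (V p.1) * inner ℝ (Z p.1) (Z p.2)) ν :=
    integrable_clm_apply_mul kM kC V1.aestronglyMeasurable (Z1.inner Z2).aestronglyMeasurable jVZZ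
  have hk1 : Integrable (fun p : E3 × E3 => k p.1 p.2 (V p.1) * ‖Z p.1‖ ^ 2) ν :=
    integrable_clm_apply_mul kM kC V1.aestronglyMeasurable
      (Z1.norm.pow 2).aestronglyMeasurable jV1Z1
  have hk2 : Integrable (fun p : E3 × E3 => k p.1 p.2 (V p.1) * ‖Z p.2‖ ^ 2) ν :=
    integrable_clm_apply_mul kM kC V1.aestronglyMeasurable
      (Z2.norm.pow 2).aestronglyMeasurable jV1Z2
  have hk3 : Integrable (fun p : E3 × E3 => k p.1 p.2 (V p.1) * ‖Z p.1 - Z p.2‖ ^ 2) ν :=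
    integrable_clm_apply_mul kM kC V1.aestronglyMeasurable D.aestronglyMeasurable jV1D
  have hk4 : Integrable (fun p : E3 × E3 => k p.2 p.1 (V p.2) * ‖Z p.1 - Z p.2‖ ^ 2) ν :=
    integrable_clm_apply_mul kM' kC' V2.aestronglyMeasurable D.aestronglyMeasurable jV2D
  -- the three pieces of `2 ⟨Z, Z'⟩ = |Z|² + |Z'|² - |Z - Z'|²`
  have e1 : ∫ p, k p.1 p.2 (V p.1) * ‖Z p.1‖ ^ 2 ∂ν = - ∫ y, N y (V y) * ‖Z y‖ ^ 2 ∂μ := by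
    rw [hν, integral_prod _ hk1, ← integral_neg]
    congr 1; ext1 y
    simp only
    have hki : Integrable (fun y' => k y y') μ := by
      refine (integrable_const A').mono' ?_ (Eventually.of_forall fun y' => kC (y, y'))
      exact (kM.comp_measurable measurable_prodMk_left).aestronglyMeasurable
    rw [integral_mul_const, ← ContinuousLinearMap.integral_apply hki, hk,
      integral_pairGrad hφ hη hμ]
    simp [hN]
  have e2 : ∫ p, k p.1 p.2 (V p.1) * ‖Z p.2‖ ^ 2 ∂ν = 0 := by
    rw [hν, integral_prod_symm _ hk2]
    simp_rw [integral_mul_const, hk, integral_pairGrad_apply_eq_zero hφ hη iVv hdivV]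
    simp
  have e3 : ∫ p, k p.1 p.2 (V p.1) * ‖Z p.1 - Z p.2‖ ^ 2 ∂ν
      = ∫ p, k p.2 p.1 (V p.2) * ‖Z p.1 - Z p.2‖ ^ 2 ∂ν := by
    rw [hν, ← integral_prod_swap (μ := μ) (ν := μ)]
    congr 1; ext1 p
    simp [norm_sub_rev]
  have e4 : 2 * ∫ p, k p.1 p.2 (V p.1) * inner ℝ (Z p.1) (Z p.2) ∂ν
      = - (∫ y, N y (V y) * ‖Z y‖ ^ 2 ∂μ)
        - ∫ p, k p.1 p.2 (V p.1) * ‖Z p.1 - Z p.2‖ ^ 2 ∂ν := by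
    have : 2 * ∫ p, k p.1 p.2 (V p.1) * inner ℝ (Z p.1) (Z p.2) ∂ν
        = (∫ p, k p.1 p.2 (V p.1) * ‖Z p.1‖ ^ 2 ∂ν + ∫ p, k p.1 p.2 (V p.1) * ‖Z p.2‖ ^ 2 ∂ν)
        - ∫ p, k p.1 p.2 (V p.1) * ‖Z p.1 - Z p.2‖ ^ 2 ∂ν := by
      rw [← integral_add hk1 hk2, ← integral_sub (hk1.fun_add hk2) hk3, ← integral_const_mul]
      congr 1; ext1 p
      rw [norm_sub_sq_real]; ring
    rw [this, e1, e2]; ring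
  have e5 : ∫ p, P p.1 * k p.1 p.2 (Z p.2) ∂ν
      = - (∫ y, N y (Z y) * Q y ∂μ) + ∫ p, M p.1 p.2 (Z p.1 - Z p.2) * Q p.1 ∂ν := by
    have f1 : ∫ p, k p.2 p.1 (Z p.2) * P p.1 ∂ν = 0 := by
      rw [hν, integral_prod _ hkP']
      simp_rw [integral_mul_const, hk, integral_pairGrad_apply_eq_zero hφ hη iZv hdivZ]
      simp
    have f2 : ∫ p, M p.1 p.2 (Z p.1) * Q p.1 ∂ν = ∫ y, N y (Z y) * Q y ∂μ := by
      rw [hν, integral_prod _ hMQ]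
      congr 1; ext1 y
      simp only
      have hMi : Integrable (fun y' => M y y') μ := by
        refine (integrable_const (A * L)).mono' ?_ (Eventually.of_forall fun y' => MC (y, y'))
        exact (MM.comp_measurable measurable_prodMk_left).aestronglyMeasurable
      rw [integral_mul_const, ← ContinuousLinearMap.integral_apply hMi, hM,
        integral_pairCut hφ hη hμ]
    rw [← f2]
    have f3 : ∫ p, P p.1 * k p.1 p.2 (Z p.2) ∂ν
        = - (∫ p, M p.1 p.2 (Z p.2) * P p.1 ∂ν) - ∫ p, k p.2 p.1 (Z p.2) * P p.1 ∂ν := by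
      rw [← integral_neg, ← integral_sub hMP.fun_neg hkP']
      congr 1; ext1 p
      have := DFunLike.congr_fun (pairGrad_add_swap hφ hη p.1 p.2) (Z p.2)
      simp only [add_apply, neg_apply] at this
      have h : k p.1 p.2 (Z p.2) = - M p.1 p.2 (Z p.2) - k p.2 p.1 (Z p.2) := by
        rw [hk, hM]; linarith
      rw [h]; ring
    rw [f3, f1, sub_zero]
    simp_rw [hPQ] at hMP ⊢
    have f4 : Integrable (fun p : E3 × E3 => M p.1 p.2 (Z p.1 - Z p.2) * Q p.1) ν :=
      (hMQ.sub hMP).congr (Eventually.of_forall fun p => by simp [sub_mul])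
    rw [← integral_neg, ← integral_neg, ← integral_add hMQ.fun_neg f4]
    congr 1; ext1 p
    simp only [map_sub]; ring
  -- symmetrizing in `(y,y')` with `k(y',y) = -M(y,y') - k(y,y')` produces the increment of `V`
  have e6 : 2 * (∫ p, pairGrad φ η p.1 p.2 (V p.1) * inner ℝ (Z p.1) (Z p.2)
        + P p.1 * pairGrad φ η p.1 p.2 (Z p.2) ∂ν)
      + ∫ y, cutGradAvg φ η y (V y) * ‖Z y‖ ^ 2 ∂μ
      + 2 * ∫ y, cutGradAvg φ η y (Z y) * Q y ∂μ
      = ∫ p, (- (1 / 2) * (k p.1 p.2 (V p.1 - V p.2) * ‖Z p.1 - Z p.2‖ ^ 2)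
        + 1 / 2 * (M p.1 p.2 (V p.2) * ‖Z p.1 - Z p.2‖ ^ 2)
        + 2 * (M p.1 p.2 (Z p.1 - Z p.2) * Q p.1)) ∂ν := by
    have g0 : Integrable (fun p : E3 × E3 => P p.1 * k p.1 p.2 (Z p.2)) ν :=
      hkP.congr (Eventually.of_forall fun p => mul_comm _ _)
    have g1 : Integrable (fun p : E3 × E3 => M p.1 p.2 (Z p.1 - Z p.2) * Q p.1) ν := by
      have h := hMP
      simp_rw [hPQ] at h
      exact (hMQ.sub h).congr (Eventually.of_forall fun p => by simp [sub_mul])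
    rw [integral_add hk0 g0, mul_add, e4, e5, integral_add _ (g1.const_mul 2),
      integral_const_mul]
    · have e7 : ∫ p, (- (1 / 2) * (k p.1 p.2 (V p.1 - V p.2) * ‖Z p.1 - Z p.2‖ ^ 2)
          + 1 / 2 * (M p.1 p.2 (V p.2) * ‖Z p.1 - Z p.2‖ ^ 2)) ∂ν
          = - (1 / 2) * (∫ p, k p.1 p.2 (V p.1) * ‖Z p.1 - Z p.2‖ ^ 2 ∂ν
            + ∫ p, k p.2 p.1 (V p.2) * ‖Z p.1 - Z p.2‖ ^ 2 ∂ν) := by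
        rw [← integral_add hk3 hk4, ← integral_const_mul]
        congr 1; ext1 p
        have := DFunLike.congr_fun (pairGrad_add_swap hφ hη p.1 p.2) (V p.2)
        simp only [add_apply, neg_apply] at this
        have h : k p.2 p.1 (V p.2) = - M p.1 p.2 (V p.2) - k p.1 p.2 (V p.2) := by
          rw [hk, hM]; linarith
        rw [h, map_sub]; ring
      rw [e7, ← e3]; ring
    · refine ((hk3.add hk4).const_mul (-(1 / 2))).congr (Eventually.of_forall fun p => ?_)
      have := DFunLike.congr_fun (pairGrad_add_swap hφ hη p.1 p.2) (V p.2)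
      simp only [add_apply, neg_apply] at this
      have h : k p.2 p.1 (V p.2) = - M p.1 p.2 (V p.2) - k p.1 p.2 (V p.2) := by
        rw [hk, hM]; linarith
      simp only [Pi.add_apply]
      rw [h, map_sub]; ring
  rw [e6]
  refine (enorm_integral_le_lintegral_enorm _).trans (lintegral_mono fun p => ?_)
  rw [← ofReal_norm]
  apply ENNReal.ofReal_le_ofReal
  have b1 := (k p.1 p.2).le_opNorm (V p.1 - V p.2)
  have b2 := (M p.1 p.2).le_opNorm (V p.2)
  have b3 := (M p.1 p.2).le_opNorm (Z p.1 - Z p.2)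
  have b4 : 0 ≤ ‖Z p.1 - Z p.2‖ ^ 2 := by positivity
  refine (norm_add₃_le).trans ?_
  have n1 : ‖(1 / 2 : ℝ)‖ = 1 / 2 := by norm_num
  have n2 : ‖(2 : ℝ)‖ = 2 := by norm_num
  simp only [norm_mul, norm_neg, norm_pow, norm_norm, n1, n2]
  have c1 := mul_le_mul_of_nonneg_right b1 b4
  have c2 := mul_le_mul_of_nonneg_right b2 b4
  have c3 := mul_le_mul_of_nonneg_right b3 (norm_nonneg (Q p.1))
  have c4 : 0 ≤ ‖k p.1 p.2 (V p.1 - V p.2)‖ * ‖Z p.1 - Z p.2‖ ^ 2 := by positivity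
  have c5 : 0 ≤ ‖M p.1 p.2 (V p.2)‖ * ‖Z p.1 - Z p.2‖ ^ 2 := by positivity
  linarith

/-- The smoothed energy differs from the energy by a term quadratic in the increments. -/
theorem enorm_energy_sub_le (hφ : IsLipCutoff φ L) (hη : IsMollifier η ε A A')
    (hμ : ∀ x ∈ tsupport φ, ∫ y, η (x - y) ∂μ = 1)
    {Z : E3 → E3} (hZm : StronglyMeasurable Z) (hZ : Integrable (fun y => ‖Z y‖ ^ 2) μ) :
    ‖(∫ y, cutAvg φ η y * ‖Z y‖ ^ 2 ∂μ)
      - ∫ p, pairKernel φ η p.1 p.2 * inner ℝ (Z p.1) (Z p.2) ∂(μ.prod μ)‖ₑ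
    ≤ ∫⁻ p, ENNReal.ofReal (‖pairKernel φ η p.1 p.2‖ * ‖Z p.1 - Z p.2‖ ^ 2) ∂(μ.prod μ) := by
  set ν := μ.prod μ with hν
  set K : E3 → E3 → ℝ := pairKernel φ η with hK
  have KM : StronglyMeasurable (fun p : E3 × E3 => K p.1 p.2) :=
    stronglyMeasurable_pairKernel hφ hη
  have KC : ∀ p : E3 × E3, ‖K p.1 p.2‖ ≤ A := fun p => norm_pairKernel_le hφ hη _ _
  have Z1 : StronglyMeasurable (fun p : E3 × E3 => Z p.1) := hZm.comp_measurable measurable_fst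
  have Z2 : StronglyMeasurable (fun p : E3 × E3 => Z p.2) := hZm.comp_measurable measurable_snd
  have i1 : Integrable (fun p : E3 × E3 => ‖Z p.1‖ ^ 2) ν := hZ.comp_fst μ
  have i2 : Integrable (fun p : E3 × E3 => ‖Z p.2‖ ^ 2) ν := hZ.comp_snd μ
  have i3 : Integrable (fun p : E3 × E3 => (inner ℝ (Z p.1) (Z p.2) : ℝ)) ν := by
    refine (i1.add i2).mono' (Z1.inner Z2).aestronglyMeasurable
      (Eventually.of_forall fun p => (norm_inner_le_norm _ _).trans ?_)
    simp only [Pi.add_apply]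
    nlinarith [sq_nonneg (‖Z p.1‖ - ‖Z p.2‖), sq_nonneg (‖Z p.1‖), sq_nonneg ‖Z p.2‖]
  have k1 := i1.bdd_mul KM.aestronglyMeasurable (Eventually.of_forall KC)
  have k2 := i2.bdd_mul KM.aestronglyMeasurable (Eventually.of_forall KC)
  have k3 := i3.bdd_mul KM.aestronglyMeasurable (Eventually.of_forall KC)
  have f1 : ∫ p, K p.1 p.2 * ‖Z p.1‖ ^ 2 ∂ν = ∫ y, cutAvg φ η y * ‖Z y‖ ^ 2 ∂μ := by
    rw [hν, integral_prod _ k1]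
    congr 1; ext1 y
    simp only
    rw [integral_mul_const, hK, integral_pairKernel hφ hη hμ]
  have f2 : ∫ p, K p.1 p.2 * ‖Z p.2‖ ^ 2 ∂ν = ∫ p, K p.1 p.2 * ‖Z p.1‖ ^ 2 ∂ν := by
    rw [hν, ← integral_prod_swap (μ := μ) (ν := μ)]
    congr 1; ext1 p
    have : K p.2 p.1 = K p.1 p.2 := by
      simp only [hK, pairKernel, mul_comm (η (_ - p.2))]
    simp [this]
  have e : (∫ y, cutAvg φ η y * ‖Z y‖ ^ 2 ∂μ) - ∫ p, K p.1 p.2 * inner ℝ (Z p.1) (Z p.2) ∂ν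
      = ∫ p, 1 / 2 * (K p.1 p.2 * ‖Z p.1 - Z p.2‖ ^ 2) ∂ν := by
    have : (∫ y, cutAvg φ η y * ‖Z y‖ ^ 2 ∂μ)
        = 1 / 2 * (∫ p, K p.1 p.2 * ‖Z p.1‖ ^ 2 ∂ν + ∫ p, K p.1 p.2 * ‖Z p.2‖ ^ 2 ∂ν) := by
      rw [f2, f1]; ring
    rw [this, ← integral_add k1 k2, ← integral_const_mul,
      ← integral_sub ((k1.fun_add k2).const_mul _) k3]
    congr 1; ext1 p
    rw [norm_sub_sq_real]; ring
  rw [e]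
  refine (enorm_integral_le_lintegral_enorm _).trans (lintegral_mono fun p => ?_)
  rw [← ofReal_norm]
  apply ENNReal.ofReal_le_ofReal
  have n1 : ‖(1 / 2 : ℝ)‖ = 1 / 2 := by norm_num
  simp only [norm_mul, norm_pow, norm_norm, n1]
  have : 0 ≤ ‖K p.1 p.2‖ * ‖Z p.1 - Z p.2‖ ^ 2 := by positivity
  linarith

end FixedTime

/-! ### Energy and power of the mollified field in terms of the kernels -/

section Mollified

variable {φ η : E3 → ℝ} {L : NNReal} {ε A A' : ℝ} {μ : Measure E3} [IsFiniteMeasure μ]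

/-- The `i`-th component of the mollification of `Z`, with integration with respect to `μ`. -/
noncomputable def mollComp (η : E3 → ℝ) (μ : Measure E3) (Z : E3 → E3) (i : Fin 3) (x : E3) : ℝ :=
  ∫ y, η (x - y) * Z y i ∂μ

/-- The `i`-th component of the mollification of `div (Z ⊗ V) + ∇P`, with all derivatives on the
mollifier. -/
noncomputable def mollForce (η : E3 → ℝ) (μ : Measure E3) (Z V : E3 → E3) (P : E3 → ℝ) (i : Fin 3)
    (x : E3) : ℝ :=
  ∫ y, (fderiv ℝ η (x - y) (V y) * Z y i
    + P y * fderiv ℝ η (x - y) (EuclideanSpace.single i 1)) ∂μ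

theorem abs_coord_le (z : E3) (i : Fin 3) : ‖z i‖ ≤ ‖z‖ := PiLp.norm_apply_le z i

theorem stronglyMeasurable_coord {α : Type*} [MeasurableSpace α] {f : α → E3}
    (hf : StronglyMeasurable f) (i : Fin 3) : StronglyMeasurable (fun a => f a i) :=
  (EuclideanSpace.proj (𝕜 := ℝ) i).continuous.comp_stronglyMeasurable hf

theorem clm_eq_sum (l : E3 →L[ℝ] ℝ) (z : E3) :
    l z = ∑ i, z i * l (EuclideanSpace.single i 1) := by
  have : z = ∑ i, z i • EuclideanSpace.single i (1 : ℝ) := by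
    ext j
    simp [Finset.sum_apply, Pi.single_apply]
  conv_lhs => rw [this]
  simp

theorem stronglyMeasurable_fderiv_apply {α : Type*} [MeasurableSpace α] {F : α → E3 →L[ℝ] ℝ}
    {V : α → E3} (hF : StronglyMeasurable F) (hV : StronglyMeasurable V) :
    StronglyMeasurable (fun a => F a (V a)) :=
  isBoundedBilinearMap_apply.continuous.comp_stronglyMeasurable (hF.prodMk hV)

/-- A product of two integrals depending on a parameter, integrated over the parameter. -/
theorem integral_mul_integral_mul_integral {φ : E3 → ℝ} (hφ : Integrable φ)
    {a b : E3 → E3 → ℝ} (ha : StronglyMeasurable (fun q : E3 × E3 => a q.1 q.2))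
    (hb : StronglyMeasurable (fun q : E3 × E3 => b q.1 q.2)) {α β : E3 → ℝ}
    (hα : Integrable α μ) (hβ : Integrable β μ) (haα : ∀ x y, ‖a x y‖ ≤ α y)
    (hbβ : ∀ x y, ‖b x y‖ ≤ β y) :
    ∫ x, φ x * ((∫ y, a x y ∂μ) * ∫ y, b x y ∂μ)
        = ∫ p, (∫ x, φ x * (a x p.1 * b x p.2)) ∂(μ.prod μ) ∧
      Integrable (fun p : E3 × E3 => ∫ x, φ x * (a x p.1 * b x p.2)) (μ.prod μ) := by
  have hI : Integrable (Function.uncurry fun (x : E3) (p : E3 × E3) =>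
      φ x * (a x p.1 * b x p.2)) (volume.prod (μ.prod μ)) := by
    refine (hφ.norm.mul_prod (hα.mul_prod hβ)).mono' ?_ (Eventually.of_forall fun z => ?_)
    · have h1 : StronglyMeasurable (fun z : E3 × E3 × E3 => a z.1 z.2.1) :=
        ha.comp_measurable (measurable_fst.prodMk (measurable_fst.comp measurable_snd))
      have h2 : StronglyMeasurable (fun z : E3 × E3 × E3 => b z.1 z.2.2) :=
        hb.comp_measurable (measurable_fst.prodMk (measurable_snd.comp measurable_snd))
      exact hφ.aestronglyMeasurable.comp_fst.mul (h1.mul h2).aestronglyMeasurable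
    · simp only [Function.uncurry, norm_mul]
      have h1 := haα z.1 z.2.1
      have h2 := hbβ z.1 z.2.2
      have h3 : 0 ≤ α z.2.1 := (norm_nonneg _).trans h1
      gcongr
  refine ⟨?_, hI.integral_prod_right⟩
  rw [← integral_integral_swap hI]
  congr 1; ext1 x
  rw [integral_const_mul, integral_prod_mul]

theorem integral_mollComp_sq (hφ : IsLipCutoff φ L) (hη : IsMollifier η ε A A')
    {Z : E3 → E3} (hZm : StronglyMeasurable Z) (hZ : Integrable (fun y => ‖Z y‖) μ) :
    ∑ i, ∫ x, φ x * mollComp η μ Z i x ^ 2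
      = ∫ p, pairKernel φ η p.1 p.2 * inner ℝ (Z p.1) (Z p.2) ∂(μ.prod μ) := by
  have hφi : Integrable φ := hφ.lipschitz.continuous.integrable_of_hasCompactSupport hφ.compact
  have hc := hη.continuous
  have key := fun i => integral_mul_integral_mul_integral (μ := μ) hφi
    (a := fun x y => η (x - y) * Z y i) (b := fun x y => η (x - y) * Z y i)
    ((Continuous.stronglyMeasurable (by fun_prop)).mul
      ((stronglyMeasurable_coord hZm i).comp_measurable measurable_snd))
    ((Continuous.stronglyMeasurable (by fun_prop)).mul
      ((stronglyMeasurable_coord hZm i).comp_measurable measurable_snd))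
    (hZ.const_mul A) (hZ.const_mul A)
    (fun x y => by
      rw [norm_mul]
      exact mul_le_mul (hη.norm_le _) (abs_coord_le _ _) (norm_nonneg _) hη.A_nonneg)
    (fun x y => by
      rw [norm_mul]
      exact mul_le_mul (hη.norm_le _) (abs_coord_le _ _) (norm_nonneg _) hη.A_nonneg)
  simp_rw [mollComp, sq, fun i => (key i).1]
  rw [← integral_finsetSum _ (fun i _ => (key i).2)]
  congr 1; ext1 p
  rw [pairKernel, PiLp.inner_apply, Finset.mul_sum]
  refine Finset.sum_congr rfl fun i _ => ?_
  rw [← integral_mul_const]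
  congr 1; ext1 x
  simp only [RCLike.inner_apply, conj_trivial]; ring

theorem integral_mollComp_mul_mollForce (hφ : IsLipCutoff φ L) (hη : IsMollifier η ε A A')
    {Z V : E3 → E3} {P : E3 → ℝ} (hZm : StronglyMeasurable Z) (hVm : StronglyMeasurable V)
    (hPm : StronglyMeasurable P) (hZ : Integrable (fun y => ‖Z y‖) μ)
    (hVZ : Integrable (fun y => ‖V y‖ * ‖Z y‖) μ) (hP : Integrable P μ) :
    ∑ i, ∫ x, φ x * (mollComp η μ Z i x * mollForce η μ Z V P i x)
      = ∫ p, pairGrad φ η p.1 p.2 (V p.1) * inner ℝ (Z p.1) (Z p.2)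
        + P p.1 * pairGrad φ η p.1 p.2 (Z p.2) ∂(μ.prod μ) := by
  have hφi : Integrable φ := hφ.lipschitz.continuous.integrable_of_hasCompactSupport hφ.compact
  have hc := hη.continuous
  have hc' := hη.continuous_fderiv
  have hF : StronglyMeasurable (fun q : E3 × E3 => fderiv ℝ η (q.1 - q.2)) :=
    Continuous.stronglyMeasurable (by fun_prop)
  have key := fun i => integral_mul_integral_mul_integral (μ := μ) hφi
    (a := fun x y => fderiv ℝ η (x - y) (V y) * Z y i
      + P y * fderiv ℝ η (x - y) (EuclideanSpace.single i 1))
    (b := fun x y => η (x - y) * Z y i)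
    (((stronglyMeasurable_fderiv_apply hF (hVm.comp_measurable measurable_snd)).mul
      ((stronglyMeasurable_coord hZm i).comp_measurable measurable_snd)).add
      ((hPm.comp_measurable measurable_snd).mul
        (stronglyMeasurable_fderiv_apply hF stronglyMeasurable_const)))
    ((Continuous.stronglyMeasurable (by fun_prop)).mul
      ((stronglyMeasurable_coord hZm i).comp_measurable measurable_snd))
    ((hVZ.add hP.norm).const_mul A') (hZ.const_mul A)
    (fun x y => by
      refine (norm_add_le _ _).trans ?_
      rw [norm_mul, norm_mul, Pi.add_apply, mul_add]
      have h1 := (fderiv ℝ η (x - y)).le_of_opNorm_le (hη.fderiv_le _) (V y)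
      have h2 := (fderiv ℝ η (x - y)).le_of_opNorm_le (hη.fderiv_le _)
        (EuclideanSpace.single i 1)
      have h3 := abs_coord_le (Z y) i
      have h4 := hη.A'_nonneg
      rw [show ‖EuclideanSpace.single i (1 : ℝ)‖ = 1 by simp, mul_one] at h2
      apply add_le_add
      · rw [← mul_assoc]; gcongr
      · rw [mul_comm]; gcongr)
    (fun x y => by
      rw [norm_mul]
      exact mul_le_mul (hη.norm_le _) (abs_coord_le _ _) (norm_nonneg _) hη.A_nonneg)
  have e : ∀ i, ∫ x, φ x * (mollComp η μ Z i x * mollForce η μ Z V P i x)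
      = ∫ x, φ x * (mollForce η μ Z V P i x * mollComp η μ Z i x) := fun i => by
    simp_rw [mul_comm (mollComp η μ Z i _)]
  simp_rw [e, mollComp, mollForce, fun i => (key i).1]
  rw [← integral_finsetSum _ (fun i _ => (key i).2)]
  congr 1; ext1 p
  have hI : ∀ w, Integrable (fun x => φ x * (η (x - p.2) * fderiv ℝ η (x - p.1) w)) := fun w => by
    have := hφ.lipschitz.continuous
    exact Continuous.integrable_of_hasCompactSupport (by fun_prop) hφ.compact.mul_right
  have e2 : ∀ i, ∫ x, φ x * ((fderiv ℝ η (x - p.1) (V p.1) * Z p.1 i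
      + P p.1 * fderiv ℝ η (x - p.1) (EuclideanSpace.single i 1)) * (η (x - p.2) * Z p.2 i))
      = pairGrad φ η p.1 p.2 (V p.1) * (Z p.1 i * Z p.2 i)
        + P p.1 * (Z p.2 i * pairGrad φ η p.1 p.2 (EuclideanSpace.single i 1)) := fun i => by
    rw [pairGrad_apply hφ hη, pairGrad_apply hφ hη, ← integral_mul_const, ← integral_const_mul,
      ← integral_const_mul, ← integral_add ((hI _).mul_const _)
        (((hI _).const_mul _).const_mul _)]
    congr 1; ext1 x; ring
  simp_rw [e2]
  rw [Finset.sum_add_distrib, ← Finset.mul_sum, ← Finset.mul_sum, ← clm_eq_sum, PiLp.inner_apply]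
  simp [mul_comm]

end Mollified

/-! ### Weak transport equations and the balance of the smoothed energy -/

/-- `∂ₜ Z + div (Z ⊗ V) + ∇P = 0` with `div Z = div V = 0`, weakly in `(0,T) × Ω`, for
`Z, V ∈ L^∞(0,T; L²(Ω))` and a locally integrable `P`. Test functions are products `ψ(t) ζ(x) eᵢ`,
with the bracket `(Z ⊗ V) : ∇Φ = ψ (∇ζ · V) Zᵢ`, and the functions are measurable everywhere, not
only almost everywhere, so that they can be evaluated at a fixed time. -/
structure IsWeakTransport (Ω : Set E3) (T : ℝ) (Z V : ℝ → E3 → E3) (P : ℝ → E3 → ℝ) : Prop where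
  measZ : StronglyMeasurable (fun z : ℝ × E3 => Z z.1 z.2)
  measV : StronglyMeasurable (fun z : ℝ × E3 => V z.1 z.2)
  measP : StronglyMeasurable (fun z : ℝ × E3 => P z.1 z.2)
  boundZ : ∃ C : ℝ, ∀ᵐ t ∂(volume.restrict (Ioo 0 T)),
    ∫⁻ x in Ω, ‖Z t x‖ₑ ^ 2 ≤ ENNReal.ofReal C
  boundV : ∃ C : ℝ, ∀ᵐ t ∂(volume.restrict (Ioo 0 T)),
    ∫⁻ x in Ω, ‖V t x‖ₑ ^ 2 ≤ ENNReal.ofReal C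
  intP : ∀ K, IsCompact K → K ⊆ Ω → ∀ a b, 0 < a → b < T →
    IntegrableOn (fun z : ℝ × E3 => P z.1 z.2) (Icc a b ×ˢ K)
  eq : ∀ ψ : ℝ → ℝ, ContDiff ℝ ∞ ψ → HasCompactSupport ψ → tsupport ψ ⊆ Ioo 0 T →
    ∀ ζ : E3 → ℝ, ContDiff ℝ ∞ ζ → HasCompactSupport ζ → tsupport ζ ⊆ Ω → ∀ i : Fin 3,
    ∫ t in Ioo 0 T, deriv ψ t * ∫ x in Ω, ζ x * Z t x i
      = - ∫ t in Ioo 0 T, ψ t * ∫ x in Ω, (fderiv ℝ ζ x (V t x) * Z t x i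
          + P t x * fderiv ℝ ζ x (EuclideanSpace.single i 1))
  divZ : ∀ ζ : E3 → ℝ, ContDiff ℝ ∞ ζ → HasCompactSupport ζ → tsupport ζ ⊆ Ω →
    ∀ᵐ t ∂(volume.restrict (Ioo 0 T)), ∫ x in Ω, fderiv ℝ ζ x (Z t x) = 0
  divV : ∀ ζ : E3 → ℝ, ContDiff ℝ ∞ ζ → HasCompactSupport ζ → tsupport ζ ⊆ Ω →
    ∀ᵐ t ∂(volume.restrict (Ioo 0 T)), ∫ x in Ω, fderiv ℝ ζ x (V t x) = 0

theorem integrable_sq_of_lintegral_le {Ω Γ : Set E3} (hΓ : Γ ⊆ Ω) {Z : E3 → E3}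
    (hZm : StronglyMeasurable Z) {C : ℝ} (h : ∫⁻ x in Ω, ‖Z x‖ₑ ^ 2 ≤ ENNReal.ofReal C) :
    IntegrableOn (fun y => ‖Z y‖ ^ 2) Γ ∧ ∫ y in Γ, ‖Z y‖ ^ 2 ≤ max C 0 := by
  have hle : ∫⁻ x in Γ, ‖Z x‖ₑ ^ 2 ≤ ENNReal.ofReal C :=
    (lintegral_mono_set hΓ).trans h
  have he : ∀ x, ‖‖Z x‖ ^ 2‖ₑ = ‖Z x‖ₑ ^ 2 := fun x => by
    rw [enorm_pow, enorm_norm]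
  have h1 : IntegrableOn (fun y => ‖Z y‖ ^ 2) Γ := by
    refine ⟨(hZm.norm.pow 2).aestronglyMeasurable, ?_⟩
    rw [hasFiniteIntegral_iff_enorm]
    simp_rw [he]
    exact hle.trans_lt ENNReal.ofReal_lt_top
  refine ⟨h1, ?_⟩
  rw [← ENNReal.ofReal_le_ofReal_iff (le_max_right _ _),
    ofReal_integral_eq_lintegral_ofReal h1 (Eventually.of_forall fun x => by positivity)]
  refine le_trans (le_of_eq ?_) (hle.trans (ENNReal.ofReal_le_ofReal (le_max_left _ _)))
  refine lintegral_congr fun x => ?_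
  rw [← he, ← ofReal_norm, norm_pow, norm_norm]

/-- The shifted mollifier as a test function of `y`. -/
theorem mollifier_flip_test {η : E3 → ℝ} {ε A A' : ℝ} (hη : IsMollifier η ε A A') (x : E3) :
    ContDiff ℝ ∞ (fun y => η (x - y)) ∧ HasCompactSupport (fun y => η (x - y)) ∧
      tsupport (fun y => η (x - y)) ⊆ Metric.closedBall x ε ∧
      ∀ y w, fderiv ℝ (fun y => η (x - y)) y w = - fderiv ℝ η (x - y) w := by
  have h3 : tsupport (fun y => η (x - y)) ⊆ Metric.closedBall x ε := by
    refine closure_minimal (fun y hy => ?_) Metric.isClosed_closedBall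
    rw [Metric.mem_closedBall, dist_comm, dist_eq_norm]
    by_contra h
    exact hy (hη.eq_zero _ (not_le.1 h).le)
  refine ⟨hη.contDiff.comp (contDiff_const.sub contDiff_id),
    (isCompact_closedBall x ε).of_isClosed_subset (isClosed_tsupport _) h3, h3, fun y w => ?_⟩
  have h1 : HasFDerivAt (fun y => x - y) (-(ContinuousLinearMap.id ℝ E3)) y :=
    (hasFDerivAt_id y).const_sub x
  have h2 := ((hη.contDiff.differentiable (by simp)) (x - y)).hasFDerivAt.comp y h1
  have h4 : (fun y => η (x - y)) = η ∘ (fun y => x - y) := rfl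
  rw [h4, h2.fderiv]
  simp

theorem IsMollifier.integral_restrict {η : E3 → ℝ} {ε A A' : ℝ} (hη : IsMollifier η ε A A')
    {Γ : Set E3} {x : E3} (h : Metric.closedBall x ε ⊆ Γ) : ∫ y in Γ, η (x - y) = 1 := by
  rw [setIntegral_eq_integral_of_forall_compl_eq_zero, integral_sub_left_eq_self,
    hη.integral_eq_one]
  intro y hy
  apply hη.eq_zero
  by_contra hc
  apply hy (h _)
  rw [Metric.mem_closedBall, dist_comm, dist_eq_norm]
  exact (not_le.1 hc).le

theorem setIntegral_eq_of_test {Ω Γ K : Set E3} (hΓ : MeasurableSet Ω) (hKΓ : K ⊆ Γ)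
    (hΓΩ : Γ ⊆ Ω) {F : E3 → ℝ} (hF : ∀ y, y ∉ K → F y = 0) :
    ∫ y in Ω, F y = ∫ y in Γ, F y :=
  setIntegral_eq_of_subset_of_forall_sdiff_eq_zero hΓ hΓΩ fun _ hy => hF _ fun h => hy.2 (hKΓ h)

namespace IsWeakTransport

variable {Ω Γ : Set E3} {T : ℝ} {Z V : ℝ → E3 → E3} {P : ℝ → E3 → ℝ}

theorem measZ_apply (h : IsWeakTransport Ω T Z V P) (t : ℝ) : StronglyMeasurable (Z t) :=
  h.measZ.comp_measurable measurable_prodMk_left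

theorem measV_apply (h : IsWeakTransport Ω T Z V P) (t : ℝ) : StronglyMeasurable (V t) :=
  h.measV.comp_measurable measurable_prodMk_left

theorem measP_apply (h : IsWeakTransport Ω T Z V P) (t : ℝ) : StronglyMeasurable (P t) :=
  h.measP.comp_measurable measurable_prodMk_left

theorem exists_bound (h : IsWeakTransport Ω T Z V P) (hΓ : Γ ⊆ Ω) :
    ∃ C : ℝ, 0 ≤ C ∧ ∀ᵐ t ∂(volume.restrict (Ioo 0 T)),
      IntegrableOn (fun y => ‖Z t y‖ ^ 2) Γ ∧ IntegrableOn (fun y => ‖V t y‖ ^ 2) Γ ∧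
      ∫ y in Γ, ‖Z t y‖ ^ 2 ≤ C ∧ ∫ y in Γ, ‖V t y‖ ^ 2 ≤ C := by
  obtain ⟨C1, h1⟩ := h.boundZ
  obtain ⟨C2, h2⟩ := h.boundV
  refine ⟨max (max C1 0) (max C2 0), le_max_of_le_left (le_max_right _ _), ?_⟩
  filter_upwards [h1, h2] with t h1 h2
  have a1 := integrable_sq_of_lintegral_le hΓ (h.measZ_apply t) h1
  have a2 := integrable_sq_of_lintegral_le hΓ (h.measV_apply t) h2
  exact ⟨a1.1, a2.1, a1.2.trans (le_max_left _ _), a2.2.trans (le_max_right _ _)⟩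

theorem integrable_of_sq {μ : Measure E3} [IsFiniteMeasure μ] {Z V : E3 → E3}
    (hZm : StronglyMeasurable Z) (hVm : StronglyMeasurable V)
    (hZ : Integrable (fun y => ‖Z y‖ ^ 2) μ) (hV : Integrable (fun y => ‖V y‖ ^ 2) μ) :
    Integrable (fun y => ‖Z y‖) μ ∧ Integrable (fun y => ‖V y‖ * ‖Z y‖) μ ∧
      ∫ y, ‖Z y‖ ∂μ ≤ μ.real univ + ∫ y, ‖Z y‖ ^ 2 ∂μ ∧
      ∫ y, ‖V y‖ * ‖Z y‖ ∂μ ≤ ∫ y, ‖V y‖ ^ 2 ∂μ + ∫ y, ‖Z y‖ ^ 2 ∂μ := by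
  have b1 : ∀ y, ‖Z y‖ ≤ 1 + ‖Z y‖ ^ 2 := fun y => by
    nlinarith [sq_nonneg (‖Z y‖ - 1), norm_nonneg (Z y)]
  have b2 : ∀ y, ‖V y‖ * ‖Z y‖ ≤ ‖V y‖ ^ 2 + ‖Z y‖ ^ 2 := fun y => by
    nlinarith [sq_nonneg (‖V y‖ - ‖Z y‖), sq_nonneg ‖V y‖, sq_nonneg ‖Z y‖]
  have i1 : Integrable (fun y => ‖Z y‖) μ :=
    ((integrable_const (1 : ℝ)).add hZ).mono' hZm.norm.aestronglyMeasurable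
      (Eventually.of_forall fun y => by simpa using b1 y)
  have i2 : Integrable (fun y => ‖V y‖ * ‖Z y‖) μ :=
    (hV.add hZ).mono' (hVm.norm.mul hZm.norm).aestronglyMeasurable
      (Eventually.of_forall fun y => by simpa [abs_of_nonneg] using b2 y)
  refine ⟨i1, i2, ?_, ?_⟩
  · refine (integral_mono i1 ((integrable_const (1 : ℝ)).fun_add hZ) b1).trans (le_of_eq ?_)
    rw [integral_add (integrable_const _) hZ]; simp
  · refine (integral_mono i2 (hV.fun_add hZ) b2).trans (le_of_eq ?_)
    rw [integral_add hV hZ]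

variable {φ η : E3 → ℝ} {L : NNReal} {ε A A' : ℝ}

theorem integrable_prod_P (h : IsWeakTransport Ω T Z V P)
    (hΓc : IsCompact (closure Γ)) (hΓΩ : closure Γ ⊆ Ω) {a b : ℝ} (ha : 0 < a) (hb : b < T) :
    Integrable (fun z : ℝ × E3 => P z.1 z.2)
      ((volume.restrict (Icc a b)).prod (volume.restrict Γ)) := by
  rw [Measure.prod_restrict]
  exact (h.intP _ hΓc hΓΩ a b ha hb).mono_set (prod_mono_right subset_closure)

theorem mollForce_bound (hη : IsMollifier η ε A A') {μ : Measure E3} [IsFiniteMeasure μ]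
    {Z V : E3 → E3} {P : E3 → ℝ}
    (hVZ : Integrable (fun y => ‖V y‖ * ‖Z y‖) μ) (hP : Integrable P μ) (i : Fin 3) (x : E3) :
    ‖mollForce η μ Z V P i x‖ ≤ A' * (∫ y, ‖V y‖ * ‖Z y‖ ∂μ + ∫ y, ‖P y‖ ∂μ) := by
  rw [← integral_add hVZ hP.norm, ← integral_const_mul]
  refine norm_integral_le_of_norm_le ((hVZ.fun_add hP.norm).const_mul A')
    (Eventually.of_forall fun y => ?_)
  refine (norm_add_le _ _).trans ?_
  rw [norm_mul, norm_mul, mul_add]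
  have h1 := (fderiv ℝ η (x - y)).le_of_opNorm_le (hη.fderiv_le _) (V y)
  have h2 := (fderiv ℝ η (x - y)).le_of_opNorm_le (hη.fderiv_le _) (EuclideanSpace.single i 1)
  have h3 := abs_coord_le (Z y) i
  have h4 := hη.A'_nonneg
  rw [show ‖EuclideanSpace.single i (1 : ℝ)‖ = 1 by simp, mul_one] at h2
  apply add_le_add
  · rw [← mul_assoc]; gcongr
  · rw [mul_comm]; gcongr

theorem mollComp_bound (hη : IsMollifier η ε A A') {μ : Measure E3} [IsFiniteMeasure μ]
    {Z : E3 → E3} (hZ : Integrable (fun y => ‖Z y‖) μ) (i : Fin 3) (x : E3) :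
    ‖mollComp η μ Z i x‖ ≤ A * ∫ y, ‖Z y‖ ∂μ := by
  rw [← integral_const_mul]
  refine norm_integral_le_of_norm_le (hZ.const_mul A) (Eventually.of_forall fun y => ?_)
  rw [norm_mul]
  exact mul_le_mul (hη.norm_le _) (abs_coord_le _ _) (norm_nonneg _) hη.A_nonneg

theorem measurable_mollComp (h : IsWeakTransport Ω T Z V P) (hη : IsMollifier η ε A A')
    (μ : Measure E3) [SFinite μ] (i : Fin 3) :
    StronglyMeasurable (fun q : ℝ × E3 => mollComp η μ (Z q.1) i q.2) := by
  have hc := hη.continuous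
  refine StronglyMeasurable.integral_prod_right (ν := μ)
    (f := fun (q : ℝ × E3) (y : E3) => η (q.2 - y) * Z q.1 y i) ?_
  refine StronglyMeasurable.mul (f := fun p : (ℝ × E3) × E3 => η (p.1.2 - p.2))
    (Continuous.stronglyMeasurable (by fun_prop)) ?_
  exact (stronglyMeasurable_coord h.measZ i).comp_measurable
    ((measurable_fst.comp measurable_fst).prodMk measurable_snd)

theorem measurable_mollForce (h : IsWeakTransport Ω T Z V P) (hη : IsMollifier η ε A A')
    (μ : Measure E3) [SFinite μ] (i : Fin 3) :
    StronglyMeasurable (fun q : ℝ × E3 => mollForce η μ (Z q.1) (V q.1) (P q.1) i q.2) := by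
  have hc := hη.continuous_fderiv
  have hF : StronglyMeasurable (fun p : (ℝ × E3) × E3 => fderiv ℝ η (p.1.2 - p.2)) :=
    Continuous.stronglyMeasurable (by fun_prop)
  have hm : Measurable (fun p : (ℝ × E3) × E3 => (p.1.1, p.2)) :=
    (measurable_fst.comp measurable_fst).prodMk measurable_snd
  refine StronglyMeasurable.integral_prod_right (ν := μ)
    (f := fun (q : ℝ × E3) (y : E3) => fderiv ℝ η (q.2 - y) (V q.1 y) * Z q.1 y i
      + P q.1 y * fderiv ℝ η (q.2 - y) (EuclideanSpace.single i 1)) ?_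
  exact ((stronglyMeasurable_fderiv_apply hF (h.measV.comp_measurable hm)).mul
    ((stronglyMeasurable_coord h.measZ i).comp_measurable hm)).add
    ((h.measP.comp_measurable hm).mul (stronglyMeasurable_fderiv_apply hF stronglyMeasurable_const))

/-- The balance of the smoothed energy. At a fixed point `x`, the equation tested with `η(x - ·)` says
that `mollComp` has the integrable distributional time derivative `-mollForce`, so its square obeys
the chain rule `integral_deriv_mul_sq`. -/
theorem integral_deriv_mul_mollComp_sq (h : IsWeakTransport Ω T Z V P) (hT : 0 < T)
    (hφ : IsLipCutoff φ L) (hη : IsMollifier η ε A A') (hΩm : MeasurableSet Ω)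
    (hΓc : IsCompact (closure Γ)) (hΓΩ : closure Γ ⊆ Ω)
    (hs : ∀ x ∈ tsupport φ, Metric.closedBall x ε ⊆ Γ)
    {ψ : ℝ → ℝ} (hψ : ContDiff ℝ ∞ ψ) (hψc : HasCompactSupport ψ) {a b : ℝ} (ha : 0 < a)
    (hb : b < T) (hψs : tsupport ψ ⊆ Icc a b) (i : Fin 3) :
    Integrable (fun t => deriv ψ t * ∫ x, φ x * mollComp η (volume.restrict Γ) (Z t) i x ^ 2)
        (volume.restrict (Icc a b)) ∧
      Integrable (fun t => ψ t * ∫ x, φ x * (mollComp η (volume.restrict Γ) (Z t) i x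
        * mollForce η (volume.restrict Γ) (Z t) (V t) (P t) i x)) (volume.restrict (Icc a b)) ∧
      ∫ t in Icc a b, deriv ψ t * ∫ x, φ x * mollComp η (volume.restrict Γ) (Z t) i x ^ 2
        = 2 * ∫ t in Icc a b, ψ t * ∫ x, φ x * (mollComp η (volume.restrict Γ) (Z t) i x
          * mollForce η (volume.restrict Γ) (Z t) (V t) (P t) i x) := by
  have hsub : Icc a b ⊆ Ioo 0 T := fun t ht => ⟨ha.trans_le ht.1, ht.2.trans_lt hb⟩
  have hΓf : volume Γ < (⊤ : ℝ≥0∞) := (measure_mono subset_closure).trans_lt hΓc.measure_lt_top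
  have : IsFiniteMeasure (volume.restrict Γ) := ⟨by simpa using hΓf⟩
  set μ : Measure E3 := volume.restrict Γ with hμ
  set f : ℝ → E3 → ℝ := fun t x => mollComp η μ (Z t) i x with hf
  set g : ℝ → E3 → ℝ := fun t x => mollForce η μ (Z t) (V t) (P t) i x with hg
  obtain ⟨C, hC0, hC⟩ := h.exists_bound (subset_closure.trans hΓΩ)
  have hφi : Integrable φ := hφ.lipschitz.continuous.integrable_of_hasCompactSupport hφ.compact
  have mf : StronglyMeasurable (fun q : ℝ × E3 => f q.1 q.2) := h.measurable_mollComp hη μ i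
  have mg : StronglyMeasurable (fun q : ℝ × E3 => g q.1 q.2) := h.measurable_mollForce hη μ i
  set Cf : ℝ := A * (μ.real univ + C) with hCf
  have hA := hη.A_nonneg
  have hA' := hη.A'_nonneg
  have bf : ∀ᵐ t ∂(volume.restrict (Ioo 0 T)), ∀ x, ‖f t x‖ ≤ Cf := by
    filter_upwards [hC] with t ht x
    have := integrable_of_sq (h.measZ_apply t) (h.measV_apply t) ht.1 ht.2.1
    refine (mollComp_bound hη this.1 i x).trans ?_
    rw [hCf]
    gcongr
    exact this.2.2.1.trans (by gcongr; exact ht.2.2.1)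
  have hPp : ∀ a b, 0 < a → b < T → Integrable (fun z : ℝ × E3 => P z.1 z.2)
      ((volume.restrict (Icc a b)).prod μ) := fun a b ha hb =>
    h.integrable_prod_P hΓc hΓΩ ha hb
  have bg : ∀ a b, 0 < a → b < T → ∀ᵐ t ∂(volume.restrict (Icc a b)), ∀ x,
      ‖g t x‖ ≤ A' * (2 * C + ∫ y, ‖P t y‖ ∂μ) := by
    intro a b ha hb
    have hsub : Icc a b ⊆ Ioo 0 T := fun t ht => ⟨ha.trans_le ht.1, ht.2.trans_lt hb⟩
    filter_upwards [ae_restrict_of_ae_restrict_of_subset hsub hC,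
      (hPp a b ha hb).prod_right_ae] with t ht hPt x
    have := integrable_of_sq (h.measZ_apply t) (h.measV_apply t) ht.1 ht.2.1
    refine (mollForce_bound hη this.2.1 hPt i x).trans ?_
    gcongr
    linarith [this.2.2.2, ht.2.2.1, ht.2.2.2]
  have pI : ∀ a b, 0 < a → b < T → Integrable (fun t => A' * (2 * C + ∫ y, ‖P t y‖ ∂μ))
      (volume.restrict (Icc a b)) := fun a b ha hb =>
    ((integrable_const _).add (hPp a b ha hb).integral_norm_prod_left).const_mul A'
  have hψ0 : ∀ t, t ∉ Icc a b → ψ t = 0 := fun t ht =>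
    image_eq_zero_of_notMem_tsupport fun h => ht (hψs h)
  have hψ0' : ∀ t, t ∉ Icc a b → deriv ψ t = 0 := fun t ht =>
    image_eq_zero_of_notMem_tsupport fun h => ht (hψs (tsupport_deriv_subset h))
  obtain ⟨D0, hD0⟩ := hψ.continuous.bounded_above_of_compact_support hψc
  obtain ⟨D1, hD1⟩ := (hψ.continuous_deriv (by simp)).bounded_above_of_compact_support hψc.deriv
  -- the identity at a fixed point `x`
  have hx : ∀ x ∈ tsupport φ, ∫ t in Icc a b, deriv ψ t * f t x ^ 2
      = 2 * ∫ t in Icc a b, ψ t * (f t x * g t x) := by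
    intro x hx
    obtain ⟨k1, k2, k3, k4⟩ := mollifier_flip_test hη x
    have e1 := integral_deriv_mul_sq hT (f := fun t => f t x) (g := fun t => g t x) (C := Cf)
      (mf.comp_measurable measurable_prodMk_right).measurable
      (by filter_upwards [bf] with t ht using ht x)
      (by
        intro a' b' ha' hb'
        refine (pI a' b' ha' hb').mono'
          (mg.comp_measurable measurable_prodMk_right).aestronglyMeasurable ?_
        filter_upwards [bg a' b' ha' hb'] with t ht using ht x)
      (by
        intro χ c1 c2 c3
        have := h.eq χ c1 c2 c3 _ k1 k2 (k3.trans ((hs x hx).trans (subset_closure.trans hΓΩ))) i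
        have r1 : ∀ t, ∫ y in Ω, η (x - y) * Z t y i = f t x := fun t =>
          setIntegral_eq_of_test hΩm (k3.trans (hs x hx)) (subset_closure.trans hΓΩ)
            fun y hy => by
              rw [image_eq_zero_of_notMem_tsupport (f := fun y => η (x - y)) hy, zero_mul]
        have r2 : ∀ t, ∫ y in Ω, (fderiv ℝ (fun y => η (x - y)) y (V t y) * Z t y i
            + P t y * fderiv ℝ (fun y => η (x - y)) y (EuclideanSpace.single i 1)) = - g t x := by
          intro t
          rw [setIntegral_eq_of_test hΩm (k3.trans (hs x hx)) (subset_closure.trans hΓΩ)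
            (fun y hy => by rw [fderiv_of_notMem_tsupport ℝ hy]; simp)]
          simp_rw [k4, hg, mollForce]
          rw [← integral_neg]
          congr 1; ext1 y; ring
        simp_rw [r1, r2] at this
        rw [this, ← integral_neg]
        congr 1; ext1 t; ring)
      hψ hψc (hψs.trans hsub)
    rw [setIntegral_eq_of_subset_of_forall_sdiff_eq_zero measurableSet_Ioo hsub
      (fun t ht => by rw [hψ0' t ht.2, zero_mul]),
      setIntegral_eq_of_subset_of_forall_sdiff_eq_zero measurableSet_Ioo hsub
      (fun t ht => by rw [hψ0 t ht.2, zero_mul])] at e1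
    exact e1
  -- integrability in `(t,x)`
  have I1 : Integrable (fun q : ℝ × E3 => deriv ψ q.1 * (φ q.2 * f q.1 q.2 ^ 2))
      ((volume.restrict (Icc a b)).prod volume) := by
    refine ((integrable_const (D1 * Cf ^ 2)).mul_prod hφi.norm).mono' ?_ ?_
    · exact ((hψ.continuous_deriv (by simp)).comp continuous_fst).aestronglyMeasurable.mul
        ((hφ.lipschitz.continuous.comp continuous_snd).aestronglyMeasurable.mul
          (mf.pow 2).aestronglyMeasurable)
    · filter_upwards [Measure.quasiMeasurePreserving_fst.ae
        (ae_restrict_of_ae_restrict_of_subset hsub bf)] with q hq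
      have h1 := hq q.2
      have h2 := hD1 q.1
      have h3 : 0 ≤ D1 := (norm_nonneg _).trans h2
      rw [norm_mul, norm_mul, norm_pow]
      calc ‖deriv ψ q.1‖ * (‖φ q.2‖ * ‖f q.1 q.2‖ ^ 2) ≤ D1 * (‖φ q.2‖ * Cf ^ 2) := by gcongr
        _ = _ := by ring
  have I2 : Integrable (fun q : ℝ × E3 => ψ q.1 * (φ q.2 * (f q.1 q.2 * g q.1 q.2)))
      ((volume.restrict (Icc a b)).prod volume) := by
    refine (((pI a b ha hb).const_mul (D0 * Cf)).mul_prod hφi.norm).mono' ?_ ?_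
    · exact (hψ.continuous.comp continuous_fst).aestronglyMeasurable.mul
        ((hφ.lipschitz.continuous.comp continuous_snd).aestronglyMeasurable.mul
          (mf.mul mg).aestronglyMeasurable)
    · filter_upwards [Measure.quasiMeasurePreserving_fst.ae
        (ae_restrict_of_ae_restrict_of_subset hsub bf),
        Measure.quasiMeasurePreserving_fst.ae (bg a b ha hb)] with q hq hq'
      have h1 := hq q.2
      have h1' := hq' q.2
      have h2 := hD0 q.1
      have h3 : 0 ≤ D0 := (norm_nonneg _).trans h2
      have h4 : 0 ≤ Cf := (norm_nonneg _).trans h1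
      rw [norm_mul, norm_mul, norm_mul]
      calc ‖ψ q.1‖ * (‖φ q.2‖ * (‖f q.1 q.2‖ * ‖g q.1 q.2‖))
          ≤ D0 * (‖φ q.2‖ * (Cf * (A' * (2 * C + ∫ y, ‖P q.1 y‖ ∂μ)))) := by gcongr
        _ = _ := by ring
  have e1 : ∀ t, deriv ψ t * ∫ x, φ x * f t x ^ 2 = ∫ x, deriv ψ t * (φ x * f t x ^ 2) :=
    fun t => (integral_const_mul _ _).symm
  have e2 : ∀ t, ψ t * ∫ x, φ x * (f t x * g t x) = ∫ x, ψ t * (φ x * (f t x * g t x)) :=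
    fun t => (integral_const_mul _ _).symm
  change Integrable (fun t => deriv ψ t * ∫ x, φ x * f t x ^ 2) _ ∧
    Integrable (fun t => ψ t * ∫ x, φ x * (f t x * g t x)) _ ∧
    ∫ t in Icc a b, deriv ψ t * ∫ x, φ x * f t x ^ 2
      = 2 * ∫ t in Icc a b, ψ t * ∫ x, φ x * (f t x * g t x)
  simp_rw [e1, e2]
  refine ⟨I1.integral_prod_left, I2.integral_prod_left, ?_⟩
  rw [integral_integral_swap I1, integral_integral_swap (f := fun t x => ψ t * (φ x * (f t x * g t x))) I2, ← integral_const_mul]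
  congr 1; ext1 x
  by_cases hxs : x ∈ tsupport φ
  · have := hx x hxs
    have s1 : ∀ t, deriv ψ t * (φ x * f t x ^ 2) = φ x * (deriv ψ t * f t x ^ 2) :=
      fun t => by ring
    have s2 : ∀ t, ψ t * (φ x * (f t x * g t x)) = φ x * (ψ t * (f t x * g t x)) :=
      fun t => by ring
    simp_rw [s1, s2]
    rw [integral_const_mul, integral_const_mul, this]; ring
  · simp [image_eq_zero_of_notMem_tsupport hxs]

end IsWeakTransport

/-! ### The smoothing errors -/

/-- The increments of `Z` over `w`, `‖w‖ < 1`, satisfy `‖Z - Z(· - w)‖³ ≤ B ‖w‖^(3a)` in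
`L³(0,T; L³)`, where the norm is over the points `x` with `x` and `x - w` both in `Γ`. -/
def IncrementBound (T : ℝ) (Γ : Set E3) (a : ℝ) (B : ℝ≥0∞) (Z : ℝ → E3 → E3) : Prop :=
  ∀ w : E3, ‖w‖ < 1 → ∫⁻ t in Ioo 0 T, ∫⁻ x in Γ ∩ {x | x - w ∈ Γ}, ‖Z t x - Z t (x - w)‖ₑ ^ 3
    ≤ ENNReal.ofReal (‖w‖ ^ (3 * a)) * B

theorem lintegral_near_diagonal {Γ : Set E3} (hΓ : MeasurableSet Γ) {r : ℝ}
    (F : E3 → E3 → ℝ≥0∞) (y : E3) :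
    ∫⁻ y' in Γ, (Metric.ball y r).indicator (F y) y'
      = ∫⁻ w in Metric.ball 0 r, {w | y - w ∈ Γ}.indicator (fun w => F y (y - w)) w := by
  rw [← lintegral_indicator hΓ, ← lintegral_indicator measurableSet_ball,
    ← lintegral_sub_left_eq_self _ y]
  refine lintegral_congr fun w => ?_
  have h1 : y - w ∈ Metric.ball y r ↔ w ∈ Metric.ball (0 : E3) r := by
    simp [Metric.mem_ball, dist_eq_norm]
  by_cases hw : w ∈ Metric.ball (0 : E3) r <;> by_cases hg : y - w ∈ Γ <;>
    simp [indicator, h1, hw, hg]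

/-- Increments averaged over a strip around the diagonal, by Fubini in `w = y - y'`. -/
theorem IncrementBound.lintegral_le {T : ℝ} {Γ : Set E3} (hΓ : MeasurableSet Γ) {a : ℝ}
    (ha : 0 ≤ a) {B : ℝ≥0∞} {Z : ℝ → E3 → E3}
    (hZ : StronglyMeasurable (fun z : ℝ × E3 => Z z.1 z.2))
    (h : IncrementBound T Γ a B Z) {r : ℝ} (hr : r ≤ 1) {I : Set ℝ} (hI : I ⊆ Ioo 0 T) :
    ∫⁻ t in I, ∫⁻ y in Γ, ∫⁻ y' in Γ,
        (Metric.ball y r).indicator (fun y' => ‖Z t y - Z t y'‖ₑ ^ 3) y'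
      ≤ volume (Metric.ball (0 : E3) r) * (ENNReal.ofReal (r ^ (3 * a)) * B) := by
  have hm : Measurable (fun q : ℝ × E3 × E3 => ‖Z q.1 q.2.1 - Z q.1 q.2.2‖ₑ ^ 3) := by
    have h1 : StronglyMeasurable (fun q : ℝ × E3 × E3 => Z q.1 q.2.1) :=
      hZ.comp_measurable (measurable_fst.prodMk (measurable_fst.comp measurable_snd))
    have h2 : StronglyMeasurable (fun q : ℝ × E3 × E3 => Z q.1 q.2.2) :=
      hZ.comp_measurable (measurable_fst.prodMk (measurable_snd.comp measurable_snd))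
    exact (h1.sub h2).enorm.pow_const 3
  have hsh : Measurable (fun q : ℝ × E3 × E3 => ‖Z q.1 q.2.1 - Z q.1 (q.2.1 - q.2.2)‖ₑ ^ 3) :=
    hm.comp (f := fun q : ℝ × E3 × E3 => (q.1, q.2.1, q.2.1 - q.2.2)) (by fun_prop)
  have hset : MeasurableSet {q : ℝ × E3 × E3 | q.2.1 - q.2.2 ∈ Γ} :=
    hΓ.preimage (f := fun q : ℝ × E3 × E3 => q.2.1 - q.2.2) (by fun_prop)
  have hG : Measurable (fun q : ℝ × E3 × E3 => {w | q.2.1 - w ∈ Γ}.indicator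
      (fun w => ‖Z q.1 q.2.1 - Z q.1 (q.2.1 - w)‖ₑ ^ 3) q.2.2) := by
    convert! hsh.indicator hset using 1
  have e1 : ∀ t y, ∫⁻ y' in Γ, (Metric.ball y r).indicator (fun y' => ‖Z t y - Z t y'‖ₑ ^ 3) y'
      = ∫⁻ w in Metric.ball 0 r, {w | y - w ∈ Γ}.indicator
        (fun w => ‖Z t y - Z t (y - w)‖ₑ ^ 3) w := fun t y =>
    lintegral_near_diagonal hΓ (fun y y' => ‖Z t y - Z t y'‖ₑ ^ 3) y
  simp_rw [e1]
  have e2 : ∀ t, ∫⁻ y in Γ, ∫⁻ w in Metric.ball 0 r, {w | y - w ∈ Γ}.indicator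
        (fun w => ‖Z t y - Z t (y - w)‖ₑ ^ 3) w
      = ∫⁻ w in Metric.ball 0 r, ∫⁻ y in Γ ∩ {y | y - w ∈ Γ}, ‖Z t y - Z t (y - w)‖ₑ ^ 3 := by
    intro t
    rw [lintegral_lintegral_swap]
    · refine lintegral_congr fun w => ?_
      have hw : MeasurableSet {y : E3 | y - w ∈ Γ} :=
        hΓ.preimage (f := fun y : E3 => y - w) (by fun_prop)
      rw [inter_comm, ← Measure.restrict_restrict hw, ← lintegral_indicator hw]
      rfl
    · exact (hG.comp (measurable_prodMk_left (x := t))).aemeasurable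
  simp_rw [e2]
  rw [lintegral_lintegral_swap]
  · calc ∫⁻ w in Metric.ball 0 r, ∫⁻ t in I, ∫⁻ y in Γ ∩ {y | y - w ∈ Γ},
          ‖Z t y - Z t (y - w)‖ₑ ^ 3
        ≤ ∫⁻ _ in Metric.ball (0 : E3) r, ENNReal.ofReal (r ^ (3 * a)) * B := by
          refine setLIntegral_mono measurable_const fun w hw => ?_
          rw [mem_ball_zero_iff] at hw
          refine (lintegral_mono_set hI).trans ((h w (hw.trans_le hr)).trans ?_)
          gcongr
      _ = _ := by rw [setLIntegral_const, mul_comm]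
  · have hG' : Measurable (fun q : (ℝ × E3) × E3 => {y | y - q.1.2 ∈ Γ}.indicator
        (fun y => ‖Z q.1.1 y - Z q.1.1 (y - q.1.2)‖ₑ ^ 3) q.2) :=
      hG.comp (f := fun q : (ℝ × E3) × E3 => (q.1.1, q.2, q.1.2)) (by fun_prop)
    have heq : (fun q : ℝ × E3 => ∫⁻ y in Γ ∩ {y | y - q.2 ∈ Γ}, ‖Z q.1 y - Z q.1 (y - q.2)‖ₑ ^ 3)
        = fun q : ℝ × E3 => ∫⁻ y in Γ, {y | y - q.2 ∈ Γ}.indicator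
          (fun y => ‖Z q.1 y - Z q.1 (y - q.2)‖ₑ ^ 3) y := by
      ext q
      have hw : MeasurableSet {y : E3 | y - q.2 ∈ Γ} :=
        hΓ.preimage (f := fun y : E3 => y - q.2) (by fun_prop)
      rw [inter_comm, ← Measure.restrict_restrict hw, ← lintegral_indicator hw]
    have hmeas : Measurable (fun q : ℝ × E3 =>
        ∫⁻ y in Γ ∩ {y | y - q.2 ∈ Γ}, ‖Z q.1 y - Z q.1 (y - q.2)‖ₑ ^ 3) := by
      rw [heq]
      exact hG'.lintegral_prod_right' (ν := volume.restrict Γ)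
    exact hmeas.aemeasurable

theorem sq_le_young {ε d : ℝ} (hε : 0 < ε) (hε1 : ε ≤ 1) (hd : 0 ≤ d) :
    d ^ 2 ≤ ε ^ (1 / 2 : ℝ) + ε⁻¹ * d ^ 3 := by
  have h1 : ε ≤ ε ^ (1 / 2 : ℝ) := Real.self_le_rpow_of_le_one hε.le hε1 (by norm_num)
  have h3 : 0 ≤ ε⁻¹ * d ^ 3 := by positivity
  rcases le_total d ε with h | h
  · nlinarith [mul_nonneg hd (sub_nonneg.2 h), mul_nonneg hε.le (sub_nonneg.2 hε1)]
  · have : d ^ 2 ≤ ε⁻¹ * d ^ 3 := by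
      have : 1 ≤ ε⁻¹ * d := by rw [inv_mul_eq_div, one_le_div hε]; exact h
      nlinarith [sq_nonneg d]
    linarith [Real.rpow_nonneg hε.le (1 / 2 : ℝ)]

theorem mul_sq_le_young {l d v : ℝ} (hl : 0 < l) (hl1 : l ≤ 1) (hd : 0 ≤ d) (hv : 0 ≤ v) :
    v * d ^ 2 ≤ l * v ^ 3 + (l ^ 2)⁻¹ * d ^ 3 := by
  have h3 : 0 ≤ (l ^ 2)⁻¹ * d ^ 3 := by positivity
  have h4 : 0 ≤ l * v ^ 3 := by positivity
  rcases le_total d (l * v) with h | h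
  · have h5 : d ^ 2 ≤ (l * v) ^ 2 := by gcongr
    have h6 : v * d ^ 2 ≤ v * (l * v) ^ 2 := by gcongr
    have h7 : v * (l * v) ^ 2 = l * (l * v ^ 3) := by ring
    nlinarith
  · have h5 : v ≤ (l ^ 2)⁻¹ * d := by
      rw [inv_mul_eq_div, le_div_iff₀ (by positivity)]
      nlinarith [mul_nonneg hl.le hv]
    have : v * d ^ 2 ≤ (l ^ 2)⁻¹ * d * d ^ 2 := by gcongr
    nlinarith

theorem mul_le_young {l d q : ℝ} (hl : 0 < l) (hd : 0 ≤ d) (hq : 0 ≤ q) :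
    d * q ≤ l * q ^ (3 / 2 : ℝ) + (l ^ 2)⁻¹ * d ^ 3 := by
  have hs : 0 ≤ Real.sqrt q := Real.sqrt_nonneg q
  have e1 : q = Real.sqrt q ^ 2 := (Real.sq_sqrt hq).symm
  have e2 : q ^ (3 / 2 : ℝ) = Real.sqrt q ^ 3 := by
    rw [Real.sqrt_eq_rpow, ← Real.rpow_natCast, ← Real.rpow_mul hq]; norm_num
  rw [e2]
  set s := Real.sqrt q
  rw [e1]
  have h3 : 0 ≤ (l ^ 2)⁻¹ * d ^ 3 := by positivity
  have h4 : 0 ≤ l * s ^ 3 := by positivity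
  rcases le_total d (l * s) with h | h
  · have : d * s ^ 2 ≤ l * s * s ^ 2 := by gcongr
    nlinarith
  · have h5 : s ^ 2 ≤ (l ^ 2)⁻¹ * d ^ 2 := by
      rw [inv_mul_eq_div, le_div_iff₀ (by positivity)]
      nlinarith [mul_nonneg hl.le hs]
    have : d * s ^ 2 ≤ d * ((l ^ 2)⁻¹ * d ^ 2) := by gcongr
    nlinarith

theorem mul_sq_le_cube_add {u d : ℝ} (hu : 0 ≤ u) (hd : 0 ≤ d) : u * d ^ 2 ≤ d ^ 3 + u ^ 3 := by
  have := mul_sq_le_young one_pos le_rfl hd hu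
  simp only [one_mul, one_pow, inv_one] at this
  linarith

/-- All smoothing errors at a pair of points, by Young's inequality: either cubes of increments with
the factor `ε⁻⁴`, or integrable quantities with the factor `ε^(1/2 - 3)`. The kernels vanish unless
the points are at distance less than `2ε`. -/
theorem pointwise_error_le {φ η : E3 → ℝ} {L : NNReal} {ε c : ℝ} (hε : 0 < ε) (hε1 : ε ≤ 1)
    (hφ : IsLipCutoff φ L) (hη : IsMollifier η ε (c / ε ^ 3) (c / ε ^ 4)) (y y' : E3)
    (z z' v v' : E3) (q : ℝ) :
    ‖pairKernel φ η y y'‖ * ‖z - z'‖ ^ 2 + (‖pairGrad φ η y y'‖ * ‖v - v'‖ * ‖z - z'‖ ^ 2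
        + ‖pairCut φ η y y'‖ * ‖v'‖ * ‖z - z'‖ ^ 2 + 2 * (‖pairCut φ η y y'‖ * ‖z - z'‖ * ‖q‖))
      ≤ (Metric.ball y (2 * ε)).indicator (fun _ => c * (2 + 3 * L) / ε ^ 4 *
          (‖z - z'‖ ^ 3 + ‖v - v'‖ ^ 3)) y'
        + (Metric.ball y (2 * ε)).indicator (fun _ => c * (2 + 3 * L) / ε ^ 3 * ε ^ (1 / 2 : ℝ) *
          (1 + ‖v'‖ ^ 3 + ‖q‖ ^ (3 / 2 : ℝ))) y' := by
  by_cases hy : y' ∈ Metric.ball y (2 * ε)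
  · rw [indicator_of_mem hy, indicator_of_mem hy]
    have b1 := norm_pairKernel_le hφ hη y y'
    have b2 := norm_pairGrad_le hφ hη y y'
    have b3 := norm_pairCut_le hφ hη y y'
    have hA := hη.A_nonneg
    have hc : 0 ≤ c := by
      have := mul_nonneg hA (pow_nonneg hε.le 3)
      rwa [div_mul_cancel₀ _ (by positivity)] at this
    set d := ‖z - z'‖
    set u := ‖v - v'‖
    have hd : 0 ≤ d := norm_nonneg _
    have hu : 0 ≤ u := norm_nonneg _
    have hL : (0 : ℝ) ≤ L := L.2
    set s : ℝ := ε ^ (1 / 2 : ℝ) with hs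
    have hs0 : 0 < s := Real.rpow_pos_of_pos hε _
    have hs1 : s ≤ 1 := Real.rpow_le_one hε.le hε1 (by norm_num)
    have hs2 : s ^ 2 = ε := by
      rw [hs, ← Real.rpow_natCast, ← Real.rpow_mul hε.le]; norm_num
    have y1 := sq_le_young hε hε1 hd
    have y2 := mul_sq_le_cube_add hu hd
    have y3 := mul_sq_le_young hs0 hs1 hd (norm_nonneg v')
    have y4 := mul_le_young hs0 hd (norm_nonneg q)
    rw [hs2] at y3 y4
    have hq : 0 ≤ ‖q‖ ^ (3 / 2 : ℝ) := Real.rpow_nonneg (norm_nonneg _) _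
    have hv3 : 0 ≤ ‖v'‖ ^ 3 := by positivity
    have hd3 : 0 ≤ d ^ 3 := by positivity
    have hu3 : 0 ≤ u ^ 3 := by positivity
    have hA' : c / ε ^ 4 = c / ε ^ 3 * ε⁻¹ := by field_simp
    rw [hA'] at b2
    have g1 : ‖pairKernel φ η y y'‖ * d ^ 2 ≤ c / ε ^ 3 * (s + ε⁻¹ * d ^ 3) := by gcongr
    have g2 : ‖pairGrad φ η y y'‖ * u * d ^ 2 ≤ c / ε ^ 3 * ε⁻¹ * (d ^ 3 + u ^ 3) := by
      rw [mul_assoc]; gcongr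
    have g3 : ‖pairCut φ η y y'‖ * ‖v'‖ * d ^ 2
        ≤ c / ε ^ 3 * L * (s * ‖v'‖ ^ 3 + ε⁻¹ * d ^ 3) := by
      rw [mul_assoc]; gcongr
    have g4 : ‖pairCut φ η y y'‖ * d * ‖q‖
        ≤ c / ε ^ 3 * L * (s * ‖q‖ ^ (3 / 2 : ℝ) + ε⁻¹ * d ^ 3) := by
      rw [mul_assoc]; gcongr
    have e1 : c * (2 + 3 * L) / ε ^ 4 = c / ε ^ 3 * ε⁻¹ * (2 + 3 * L) := by field_simp
    have e2 : c * (2 + 3 * L) / ε ^ 3 = c / ε ^ 3 * (2 + 3 * L) := by field_simp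
    rw [e1, e2]
    have p1 : 0 ≤ c / ε ^ 3 * ε⁻¹ * u ^ 3 := by positivity
    have p2 : 0 ≤ c / ε ^ 3 * ε⁻¹ * L * u ^ 3 := by positivity
    have p3 : 0 ≤ c / ε ^ 3 * s * L := by positivity
    have p4 : 0 ≤ c / ε ^ 3 * s := by positivity
    have p5 : 0 ≤ c / ε ^ 3 * s * ‖v'‖ ^ 3 := by positivity
    have p6 : 0 ≤ c / ε ^ 3 * s * L * ‖v'‖ ^ 3 := by positivity
    have p7 : 0 ≤ c / ε ^ 3 * s * ‖q‖ ^ (3 / 2 : ℝ) := by positivity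
    have p8 : 0 ≤ c / ε ^ 3 * s * L * ‖q‖ ^ (3 / 2 : ℝ) := by positivity
    calc _ ≤ c / ε ^ 3 * (s + ε⁻¹ * d ^ 3) + (c / ε ^ 3 * ε⁻¹ * (d ^ 3 + u ^ 3)
        + c / ε ^ 3 * L * (s * ‖v'‖ ^ 3 + ε⁻¹ * d ^ 3)
        + 2 * (c / ε ^ 3 * L * (s * ‖q‖ ^ (3 / 2 : ℝ) + ε⁻¹ * d ^ 3))) := by gcongr
      _ ≤ _ := by
        linear_combination p1 + 3 * p2 + 3 * p3 + p4 + 2 * p5 + 2 * p6 + 2 * p7 + p8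
  · rw [indicator_of_notMem hy, indicator_of_notMem hy]
    have h : 2 * ε ≤ ‖y - y'‖ := by
      rw [Metric.mem_ball, dist_comm, dist_eq_norm, not_lt] at hy; exact hy
    rw [pairKernel_eq_zero hη h, pairGrad_eq_zero hη h, pairCut_eq_zero hη h]
    simp

theorem ofReal_norm_pow {F : Type*} [NormedAddCommGroup F] (x : F) (n : ℕ) :
    ENNReal.ofReal (‖x‖ ^ n) = ‖x‖ₑ ^ n := by
  rw [ENNReal.ofReal_pow (norm_nonneg _), ofReal_norm]

theorem ofReal_norm_rpow {F : Type*} [NormedAddCommGroup F] (x : F) {s : ℝ} (hs : 0 ≤ s) :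
    ENNReal.ofReal (‖x‖ ^ s) = ‖x‖ₑ ^ s := by
  rw [← ENNReal.ofReal_rpow_of_nonneg (norm_nonneg _) hs, ofReal_norm]

/-- `F(t,y,y')` restricted to the strip `|y - y'| < r` around the diagonal. -/
noncomputable def diagInd (r : ℝ) (F : ℝ × E3 × E3 → ℝ≥0∞) : ℝ × E3 × E3 → ℝ≥0∞ :=
  {q : ℝ × E3 × E3 | q.2.2 ∈ Metric.ball q.2.1 r}.indicator F

theorem measurable_diagInd {r : ℝ} {F : ℝ × E3 × E3 → ℝ≥0∞} (hF : Measurable F) :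
    Measurable (diagInd r F) := by
  refine hF.indicator ?_
  have : Measurable (fun q : ℝ × E3 × E3 => dist q.2.2 q.2.1) := by fun_prop
  exact measurableSet_lt this measurable_const

theorem lintegral_diagInd {r : ℝ} {F : ℝ × E3 × E3 → ℝ≥0∞} (hF : Measurable F)
    {τ : Measure ℝ} [SFinite τ] {μ : Measure E3} [SFinite μ] :
    ∫⁻ q, diagInd r F q ∂(τ.prod (μ.prod μ))
      = ∫⁻ t, ∫⁻ y, ∫⁻ y', (Metric.ball y r).indicator (fun y' => F (t, y, y')) y' ∂μ ∂μ ∂τ := by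
  have hm := measurable_diagInd (r := r) hF
  rw [lintegral_prod _ hm.aemeasurable]
  refine lintegral_congr fun t => ?_
  have hmt : Measurable (fun p : E3 × E3 => diagInd r F (t, p)) := hm.comp measurable_prodMk_left
  rw [lintegral_prod _ hmt.aemeasurable]
  rfl

theorem lintegral_diagInd_fst {r : ℝ} {F : ℝ × E3 → ℝ≥0∞} (hF : Measurable F)
    {τ : Measure ℝ} [SFinite τ] (Γ : Set E3) :
    ∫⁻ q, diagInd r (fun q => F (q.1, q.2.1)) q
        ∂(τ.prod ((volume.restrict Γ).prod (volume.restrict Γ)))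
      ≤ volume (Metric.ball (0 : E3) r) * ∫⁻ q, F q ∂(τ.prod (volume.restrict Γ)) := by
  rw [lintegral_diagInd (F := fun q => F (q.1, q.2.1)) (hF.comp (by fun_prop)),
    lintegral_prod _ hF.aemeasurable,
    ← lintegral_const_mul _ hF.lintegral_prod_right']
  refine lintegral_mono fun t => ?_
  have hFt : Measurable (fun y => F (t, y)) := hF.comp measurable_prodMk_left
  rw [← lintegral_const_mul _ hFt]
  refine lintegral_mono fun y => ?_
  rw [lintegral_indicator measurableSet_ball]
  simp only [lintegral_const]
  rw [mul_comm]
  have hb : ((volume.restrict Γ).restrict (Metric.ball y r)) univ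
      ≤ volume (Metric.ball (0 : E3) r) := by
    rw [Measure.restrict_apply_univ, ← Measure.addHaar_ball_center volume y r]
    exact Measure.restrict_apply_le _ _
  exact mul_le_mul' hb le_rfl

theorem lintegral_diagInd_snd {r : ℝ} {F : ℝ × E3 → ℝ≥0∞} (hF : Measurable F)
    {τ : Measure ℝ} [SFinite τ] (Γ : Set E3) :
    ∫⁻ q, diagInd r (fun q => F (q.1, q.2.2)) q
        ∂(τ.prod ((volume.restrict Γ).prod (volume.restrict Γ)))
      ≤ volume (Metric.ball (0 : E3) r) * ∫⁻ q, F q ∂(τ.prod (volume.restrict Γ)) := by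
  refine le_trans (le_of_eq ?_) (lintegral_diagInd_fst hF Γ)
  have h1 : Measurable (fun q : ℝ × E3 × E3 => F (q.1, q.2.1)) := hF.comp (by fun_prop)
  have h2 : Measurable (fun q : ℝ × E3 × E3 => F (q.1, q.2.2)) := hF.comp (by fun_prop)
  rw [lintegral_prod _ (measurable_diagInd h1).aemeasurable,
    lintegral_prod _ (measurable_diagInd h2).aemeasurable]
  refine lintegral_congr fun t => ?_
  rw [← lintegral_prod_swap]
  refine lintegral_congr fun p => ?_
  simp [diagInd, indicator, dist_comm]

/-- The integrand of the total smoothing error: the bound of `enorm_energy_sub_le` plus the bound of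
`enorm_flux_add_le`. -/
noncomputable def smoothingError (φ η : E3 → ℝ) (z v : E3 → E3) (q : E3 → ℝ) (p : E3 × E3) : ℝ :=
  ‖pairKernel φ η p.1 p.2‖ * ‖z p.1 - z p.2‖ ^ 2
    + (‖pairGrad φ η p.1 p.2‖ * ‖v p.1 - v p.2‖ * ‖z p.1 - z p.2‖ ^ 2
    + ‖pairCut φ η p.1 p.2‖ * ‖v p.2‖ * ‖z p.1 - z p.2‖ ^ 2
    + 2 * (‖pairCut φ η p.1 p.2‖ * ‖z p.1 - z p.2‖ * ‖q p.1‖))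

/-- The total smoothing error at scale `ε`. As the ball has volume `O(ε³)`, the bound is
`O(ε^(3a-1)) + O(ε^(1/2))`. -/
theorem lintegral_smoothingError_le {φ η : E3 → ℝ} {L : NNReal} {ε c : ℝ} (hε : 0 < ε)
    (hε1 : 2 * ε ≤ 1) (hφ : IsLipCutoff φ L) (hη : IsMollifier η ε (c / ε ^ 3) (c / ε ^ 4))
    (hc : 0 ≤ c) {T : ℝ} {Γ : Set E3} (hΓ : MeasurableSet Γ) {a : ℝ} (ha : 0 ≤ a) {B : ℝ≥0∞}
    {Z V : ℝ → E3 → E3} {Q : ℝ → E3 → ℝ}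
    (hZ : StronglyMeasurable (fun z : ℝ × E3 => Z z.1 z.2))
    (hV : StronglyMeasurable (fun z : ℝ × E3 => V z.1 z.2))
    (hQ : StronglyMeasurable (fun z : ℝ × E3 => Q z.1 z.2))
    (hBZ : IncrementBound T Γ a B Z) (hBV : IncrementBound T Γ a B V)
    {I : Set ℝ} (hI : I ⊆ Ioo 0 T) :
    ∫⁻ t in I, ∫⁻ p, ENNReal.ofReal (smoothingError φ η (Z t) (V t) (Q t) p)
        ∂((volume.restrict Γ).prod (volume.restrict Γ))
      ≤ volume (Metric.ball (0 : E3) (2 * ε)) *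
        (ENNReal.ofReal (c * (2 + 3 * L) / ε ^ 4) * (2 * (ENNReal.ofReal ((2 * ε) ^ (3 * a)) * B))
        + ENNReal.ofReal (c * (2 + 3 * L) / ε ^ 3 * ε ^ (1 / 2 : ℝ)) *
          (∫⁻ q, (1 + ‖V q.1 q.2‖ₑ ^ 3 + ‖Q q.1 q.2‖ₑ ^ (3 / 2 : ℝ))
            ∂((volume.restrict I).prod (volume.restrict Γ)))) := by
  set μ : Measure E3 := volume.restrict Γ with hμ
  set τ : Measure ℝ := volume.restrict I with hτ
  set k1 := ENNReal.ofReal (c * (2 + 3 * L) / ε ^ 4) with hk1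
  set k2 := ENNReal.ofReal (c * (2 + 3 * L) / ε ^ 3 * ε ^ (1 / 2 : ℝ)) with hk2
  have mZ : Measurable (fun q : ℝ × E3 × E3 => ‖Z q.1 q.2.1 - Z q.1 q.2.2‖ₑ ^ 3) := by
    have h1 : StronglyMeasurable (fun q : ℝ × E3 × E3 => Z q.1 q.2.1) :=
      hZ.comp_measurable (measurable_fst.prodMk (measurable_fst.comp measurable_snd))
    have h2 : StronglyMeasurable (fun q : ℝ × E3 × E3 => Z q.1 q.2.2) :=
      hZ.comp_measurable (measurable_fst.prodMk (measurable_snd.comp measurable_snd))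
    exact (h1.sub h2).enorm.pow_const 3
  have mV : Measurable (fun q : ℝ × E3 × E3 => ‖V q.1 q.2.1 - V q.1 q.2.2‖ₑ ^ 3) := by
    have h1 : StronglyMeasurable (fun q : ℝ × E3 × E3 => V q.1 q.2.1) :=
      hV.comp_measurable (measurable_fst.prodMk (measurable_fst.comp measurable_snd))
    have h2 : StronglyMeasurable (fun q : ℝ × E3 × E3 => V q.1 q.2.2) :=
      hV.comp_measurable (measurable_fst.prodMk (measurable_snd.comp measurable_snd))
    exact (h1.sub h2).enorm.pow_const 3
  have mv : Measurable (fun q : ℝ × E3 => 1 + ‖V q.1 q.2‖ₑ ^ 3) :=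
    measurable_const.add (hV.enorm.pow_const 3)
  have mq : Measurable (fun q : ℝ × E3 => ‖Q q.1 q.2‖ₑ ^ (3 / 2 : ℝ)) :=
    hQ.enorm.pow_const _
  have mv' : Measurable (fun q : ℝ × E3 × E3 => 1 + ‖V q.1 q.2.2‖ₑ ^ 3) :=
    mv.comp (f := fun q : ℝ × E3 × E3 => (q.1, q.2.2)) (by fun_prop)
  have mq' : Measurable (fun q : ℝ × E3 × E3 => ‖Q q.1 q.2.1‖ₑ ^ (3 / 2 : ℝ)) :=
    mq.comp (f := fun q : ℝ × E3 × E3 => (q.1, q.2.1)) (by fun_prop)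
  set G1 := diagInd (2 * ε) (fun q : ℝ × E3 × E3 => ‖Z q.1 q.2.1 - Z q.1 q.2.2‖ₑ ^ 3) with hG1
  set G2 := diagInd (2 * ε) (fun q : ℝ × E3 × E3 => ‖V q.1 q.2.1 - V q.1 q.2.2‖ₑ ^ 3) with hG2
  set G3 := diagInd (2 * ε) (fun q : ℝ × E3 × E3 => 1 + ‖V q.1 q.2.2‖ₑ ^ 3) with hG3
  set G4 := diagInd (2 * ε) (fun q : ℝ × E3 × E3 => ‖Q q.1 q.2.1‖ₑ ^ (3 / 2 : ℝ)) with hG4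
  have m1 : Measurable G1 := measurable_diagInd mZ
  have m2 : Measurable G2 := measurable_diagInd mV
  have m3 : Measurable G3 := measurable_diagInd mv'
  have m4 : Measurable G4 := measurable_diagInd mq'
  have hpt : ∀ q : ℝ × E3 × E3,
      ENNReal.ofReal (smoothingError φ η (Z q.1) (V q.1) (Q q.1) q.2)
        ≤ k1 * (G1 q + G2 q) + k2 * (G3 q + G4 q) := by
    intro q
    refine (ENNReal.ofReal_le_ofReal (pointwise_error_le hε (by linarith) hφ hη q.2.1 q.2.2
      (Z q.1 q.2.1) (Z q.1 q.2.2) (V q.1 q.2.1) (V q.1 q.2.2) (Q q.1 q.2.1))).trans ?_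
    by_cases hq : q.2.2 ∈ Metric.ball q.2.1 (2 * ε)
    · have hq' : q ∈ {q : ℝ × E3 × E3 | q.2.2 ∈ Metric.ball q.2.1 (2 * ε)} := hq
      rw [indicator_of_mem hq, indicator_of_mem hq, hG1, hG2, hG3, hG4]
      simp only [diagInd]
      rw [indicator_of_mem hq', indicator_of_mem hq', indicator_of_mem hq', indicator_of_mem hq',
        ENNReal.ofReal_add (by positivity) (by positivity), ENNReal.ofReal_mul (by positivity),
        ENNReal.ofReal_mul (by positivity),
        ENNReal.ofReal_add (by positivity) (by positivity),
        ENNReal.ofReal_add (by positivity) (by positivity),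
        ENNReal.ofReal_add (by positivity) (by positivity), ofReal_norm_pow, ofReal_norm_pow,
        ofReal_norm_pow, ofReal_norm_rpow _ (by norm_num), ENNReal.ofReal_one]
    · rw [indicator_of_notMem hq, indicator_of_notMem hq]; simp
  have mG : Measurable (fun q => k1 * (G1 q + G2 q) + k2 * (G3 q + G4 q)) :=
    ((m1.add m2).const_mul k1).add ((m3.add m4).const_mul k2)
  calc ∫⁻ t in I, ∫⁻ p, ENNReal.ofReal (smoothingError φ η (Z t) (V t) (Q t) p) ∂(μ.prod μ)
      ≤ ∫⁻ t in I, ∫⁻ p, (k1 * (G1 (t, p) + G2 (t, p)) + k2 * (G3 (t, p) + G4 (t, p)))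
          ∂(μ.prod μ) := lintegral_mono fun t => lintegral_mono fun p => hpt (t, p)
    _ = ∫⁻ q, (k1 * (G1 q + G2 q) + k2 * (G3 q + G4 q)) ∂(τ.prod (μ.prod μ)) := by
        rw [lintegral_prod _ mG.aemeasurable]
    _ = k1 * (∫⁻ q, G1 q ∂(τ.prod (μ.prod μ)) + ∫⁻ q, G2 q ∂(τ.prod (μ.prod μ)))
        + k2 * (∫⁻ q, G3 q ∂(τ.prod (μ.prod μ)) + ∫⁻ q, G4 q ∂(τ.prod (μ.prod μ))) := by
        rw [lintegral_add_left ((m1.fun_add m2).const_mul k1), lintegral_const_mul _ (m1.fun_add m2),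
          lintegral_const_mul _ (m3.fun_add m4), lintegral_add_left m1, lintegral_add_left m3]
    _ ≤ k1 * (volume (Metric.ball (0 : E3) (2 * ε)) * (ENNReal.ofReal ((2 * ε) ^ (3 * a)) * B)
          + volume (Metric.ball (0 : E3) (2 * ε)) * (ENNReal.ofReal ((2 * ε) ^ (3 * a)) * B))
        + k2 * (volume (Metric.ball (0 : E3) (2 * ε)) *
            ∫⁻ q, (1 + ‖V q.1 q.2‖ₑ ^ 3) ∂(τ.prod μ)
          + volume (Metric.ball (0 : E3) (2 * ε)) *
            ∫⁻ q, ‖Q q.1 q.2‖ₑ ^ (3 / 2 : ℝ) ∂(τ.prod μ)) := by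
        gcongr
        · rw [hG1, lintegral_diagInd mZ]
          exact hBZ.lintegral_le hΓ ha hZ hε1 hI
        · rw [hG2, lintegral_diagInd mV]
          exact hBV.lintegral_le hΓ ha hV hε1 hI
        · exact lintegral_diagInd_snd (F := fun q : ℝ × E3 => 1 + ‖V q.1 q.2‖ₑ ^ 3) mv Γ
        · exact lintegral_diagInd_fst (F := fun q : ℝ × E3 => ‖Q q.1 q.2‖ₑ ^ (3 / 2 : ℝ)) mq Γ
    _ = _ := by
        rw [lintegral_add_left mv]
        ring

/-! ### The local energy balance -/

/-- Mollified fields of vanishing divergence have no divergence. The exceptional set of times in the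
weak formulation depends on the test function, here on the shift `x`; Fubini exchanges the
quantifiers. -/
theorem ae_integral_fderiv_mollifier_eq_zero {Ω Γ : Set E3} {T : ℝ} {W : ℝ → E3 → E3}
    {φ η : E3 → ℝ} {ε A A' : ℝ}
    (hW : StronglyMeasurable (fun z : ℝ × E3 => W z.1 z.2))
    (hdiv : ∀ ζ : E3 → ℝ, ContDiff ℝ ∞ ζ → HasCompactSupport ζ → tsupport ζ ⊆ Ω →
      ∀ᵐ t ∂(volume.restrict (Ioo 0 T)), ∫ x in Ω, fderiv ℝ ζ x (W t x) = 0)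
    (hη : IsMollifier η ε A A') (hΩm : MeasurableSet Ω) (hΓΩ : Γ ⊆ Ω)
    (hs : ∀ x ∈ tsupport φ, Metric.closedBall x ε ⊆ Γ) :
    ∀ᵐ t ∂(volume.restrict (Ioo 0 T)), ∀ᵐ x, x ∈ tsupport φ →
      ∫ y in Γ, fderiv ℝ η (x - y) (W t y) = 0 := by
  have hc := hη.continuous_fderiv
  have hm : StronglyMeasurable (fun q : ℝ × E3 => ∫ y in Γ, fderiv ℝ η (q.2 - y) (W q.1 y)) := by
    refine StronglyMeasurable.integral_prod_right (ν := volume.restrict Γ)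
      (f := fun (q : ℝ × E3) (y : E3) => fderiv ℝ η (q.2 - y) (W q.1 y)) ?_
    exact stronglyMeasurable_fderiv_apply
      (F := fun p : (ℝ × E3) × E3 => fderiv ℝ η (p.1.2 - p.2))
      (Continuous.stronglyMeasurable (by fun_prop))
      (hW.comp_measurable ((measurable_fst.comp measurable_fst).prodMk measurable_snd))
  refine (Measure.ae_ae_comm (p := fun (t : ℝ) (x : E3) => x ∈ tsupport φ →
      ∫ y in Γ, fderiv ℝ η (x - y) (W t y) = 0) ?_).2 ?_
  · have h1 : MeasurableSet {q : ℝ × E3 | q.2 ∈ tsupport φ} :=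
      (isClosed_tsupport φ).measurableSet.preimage measurable_snd
    have h2 : MeasurableSet {q : ℝ × E3 | ∫ y in Γ, fderiv ℝ η (q.2 - y) (W q.1 y) = 0} :=
      hm.measurable (measurableSet_singleton 0)
    have : {q : ℝ × E3 | q.2 ∈ tsupport φ → ∫ y in Γ, fderiv ℝ η (q.2 - y) (W q.1 y) = 0}
        = {q : ℝ × E3 | q.2 ∈ tsupport φ}ᶜ
          ∪ {q : ℝ × E3 | ∫ y in Γ, fderiv ℝ η (q.2 - y) (W q.1 y) = 0} := by
      ext q; simp [imp_iff_not_or]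
    rw [this]
    exact h1.compl.union h2
  · refine Eventually.of_forall fun x => ?_
    by_cases hx : x ∈ tsupport φ
    · obtain ⟨k1, k2, k3, k4⟩ := mollifier_flip_test hη x
      filter_upwards [hdiv _ k1 k2 (k3.trans ((hs x hx).trans hΓΩ))] with t ht _
      rw [setIntegral_eq_of_test hΩm (k3.trans (hs x hx)) hΓΩ
        (fun y hy => by rw [fderiv_of_notMem_tsupport ℝ hy]; simp)] at ht
      simp_rw [k4, integral_neg, neg_eq_zero] at ht
      exact ht
    · exact Eventually.of_forall fun t h => absurd h hx

theorem integrable_mul_of_young {α : Type*} [MeasurableSpace α] {ν : Measure α} {Z : α → E3}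
    {Q : α → ℝ} (hZm : AEStronglyMeasurable Z ν) (hQm : AEStronglyMeasurable Q ν)
    (hZ : Integrable (fun y => ‖Z y‖ ^ 3) ν) (hQ : Integrable (fun y => ‖Q y‖ ^ (3 / 2 : ℝ)) ν) :
    Integrable (fun y => ‖Z y‖ * ‖Q y‖) ν := by
  refine (hQ.add hZ).mono' (hZm.norm.mul hQm.norm) (Eventually.of_forall fun y => ?_)
  have := mul_le_young one_pos (norm_nonneg (Z y)) (norm_nonneg (Q y))
  simpa using this

/-- The weak form of the energy balance for the smoothed cutoff, up to the smoothing errors. -/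
theorem IsWeakTransport.enorm_smoothed_balance_le {Ω Γ S : Set E3} {T : ℝ} {Z V : ℝ → E3 → E3}
    {P : ℝ → E3 → ℝ} {φ η : E3 → ℝ} {L : NNReal} {ε A A' : ℝ}
    (h : IsWeakTransport Ω T Z V P) (hT : 0 < T)
    (hφ : IsLipCutoff φ L) (hη : IsMollifier η ε A A') (hΩm : MeasurableSet Ω)
    (hΓc : IsCompact (closure Γ)) (hΓΩ : closure Γ ⊆ Ω)
    (hs : ∀ x ∈ tsupport φ, Metric.closedBall x ε ⊆ Γ)
    {ψ : ℝ → ℝ} (hψ : ContDiff ℝ ∞ ψ) (hψc : HasCompactSupport ψ) {a b : ℝ} (ha : 0 < a)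
    (hb : b < T) (hψs : tsupport ψ ⊆ Icc a b) {D : ℝ} (hD : ∀ t, ‖ψ t‖ ≤ D)
    (hD' : ∀ t, ‖deriv ψ t‖ ≤ D) (hS : MeasurableSet S)
    (hSφ : ∀ y, y ∉ S → ∀ x, ‖x - y‖ < ε → fderiv ℝ φ x = 0)
    (hZ3 : Integrable (fun q : ℝ × E3 => ‖Z q.1 q.2‖ ^ 3)
      ((volume.restrict (Icc a b)).prod (volume.restrict Γ)))
    (hV3 : Integrable (fun q : ℝ × E3 => ‖V q.1 q.2‖ ^ 3)
      ((volume.restrict (Icc a b)).prod (volume.restrict Γ)))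
    (hQ3 : Integrable (fun q : ℝ × E3 => ‖S.indicator (P q.1) q.2‖ ^ (3 / 2 : ℝ))
      ((volume.restrict (Icc a b)).prod (volume.restrict Γ))) :
    ‖∫ q, (deriv ψ q.1 * (cutAvg φ η q.2 * ‖Z q.1 q.2‖ ^ 2)
        + ψ q.1 * (cutGradAvg φ η q.2 (V q.1 q.2) * ‖Z q.1 q.2‖ ^ 2
          + 2 * (cutGradAvg φ η q.2 (Z q.1 q.2) * S.indicator (P q.1) q.2)))
        ∂((volume.restrict (Icc a b)).prod (volume.restrict Γ))‖ₑ
      ≤ ENNReal.ofReal D * ∫⁻ t in Icc a b, ∫⁻ p,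
        ENNReal.ofReal (smoothingError φ η (Z t) (V t) (S.indicator (P t)) p)
          ∂((volume.restrict Γ).prod (volume.restrict Γ)) := by
  have hsub : Icc a b ⊆ Ioo 0 T := fun t ht => ⟨ha.trans_le ht.1, ht.2.trans_lt hb⟩
  have hΓf : volume Γ < (⊤ : ℝ≥0∞) := (measure_mono subset_closure).trans_lt hΓc.measure_lt_top
  have : IsFiniteMeasure (volume.restrict Γ) := ⟨by simpa using hΓf⟩
  set μ : Measure E3 := volume.restrict Γ with hμ
  set τ : Measure ℝ := volume.restrict (Icc a b) with hτ
  set Q : ℝ → E3 → ℝ := fun t => S.indicator (P t) with hQdef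
  have hμ1 : ∀ x ∈ tsupport φ, ∫ y, η (x - y) ∂μ = 1 := fun x hx => hη.integral_restrict (hs x hx)
  have hQm : StronglyMeasurable (fun q : ℝ × E3 => Q q.1 q.2) := by
    have : (fun q : ℝ × E3 => Q q.1 q.2)
        = (Prod.snd ⁻¹' S).indicator (fun q : ℝ × E3 => P q.1 q.2) := rfl
    rw [this]
    exact h.measP.indicator (hS.preimage measurable_snd)
  have hQmt : ∀ t, StronglyMeasurable (Q t) := fun t => hQm.comp_measurable measurable_prodMk_left
  -- integrability on space-time
  have iZ2 : Integrable (fun q : ℝ × E3 => ‖Z q.1 q.2‖ ^ 2) (τ.prod μ) :=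
    integrable_norm_sq_of_cube h.measZ.aestronglyMeasurable hZ3
  have iVZ2 : Integrable (fun q : ℝ × E3 => ‖V q.1 q.2‖ * ‖‖Z q.1 q.2‖ ^ 2‖) (τ.prod μ) := by
    simpa using integrable_norm_mul_sq_of_cube h.measV.aestronglyMeasurable
      h.measZ.aestronglyMeasurable hV3 hZ3
  have iZQ : Integrable (fun q : ℝ × E3 => ‖Z q.1 q.2‖ * ‖Q q.1 q.2‖) (τ.prod μ) :=
    integrable_mul_of_young h.measZ.aestronglyMeasurable hQm.aestronglyMeasurable hZ3 hQ3
  have iP : Integrable (fun q : ℝ × E3 => P q.1 q.2) (τ.prod μ) :=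
    h.integrable_prod_P hΓc hΓΩ ha hb
  have mN : StronglyMeasurable (fun q : ℝ × E3 => cutGradAvg φ η q.2) :=
    (stronglyMeasurable_cutGradAvg hη).comp_measurable measurable_snd
  have bN : ∀ q : ℝ × E3, ‖cutGradAvg φ η q.2‖ ≤ L := fun q => norm_cutGradAvg_le hφ hη _
  have j0 : Integrable (fun q : ℝ × E3 => deriv ψ q.1 * (cutAvg φ η q.2 * ‖Z q.1 q.2‖ ^ 2))
      (τ.prod μ) := by
    refine (iZ2.bdd_mul ((stronglyMeasurable_cutAvg hφ hη).comp_measurable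
      measurable_snd).aestronglyMeasurable
      (Eventually.of_forall fun q => norm_cutAvg_le hφ hη _)).bdd_mul
      ((hψ.continuous_deriv (by simp)).comp continuous_fst).aestronglyMeasurable
      (Eventually.of_forall fun q => hD' _)
  have j1 : Integrable (fun q : ℝ × E3 =>
      cutGradAvg φ η q.2 (V q.1 q.2) * ‖Z q.1 q.2‖ ^ 2) (τ.prod μ) :=
    integrable_clm_apply_mul mN bN h.measV.aestronglyMeasurable
      (h.measZ.norm.pow 2).aestronglyMeasurable iVZ2
  have j2 : Integrable (fun q : ℝ × E3 =>
      cutGradAvg φ η q.2 (Z q.1 q.2) * Q q.1 q.2) (τ.prod μ) :=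
    integrable_clm_apply_mul mN bN h.measZ.aestronglyMeasurable hQm.aestronglyMeasurable iZQ
  have j3 : Integrable (fun q : ℝ × E3 =>
      ψ q.1 * (cutGradAvg φ η q.2 (V q.1 q.2) * ‖Z q.1 q.2‖ ^ 2
          + 2 * (cutGradAvg φ η q.2 (Z q.1 q.2) * Q q.1 q.2))) (τ.prod μ) :=
    (j1.add (j2.const_mul 2)).bdd_mul (hψ.continuous.comp continuous_fst).aestronglyMeasurable
      (Eventually.of_forall fun q => hD _)
  -- the exact balance
  set A1 : ℝ → Fin 3 → ℝ := fun t i => ∫ x, φ x * mollComp η μ (Z t) i x ^ 2 with hA1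
  set J1 : ℝ → Fin 3 → ℝ := fun t i => ∫ x, φ x * (mollComp η μ (Z t) i x
    * mollForce η μ (Z t) (V t) (P t) i x) with hJ1
  have hbal := fun i => h.integral_deriv_mul_mollComp_sq hT hφ hη hΩm hΓc hΓΩ hs hψ hψc ha hb hψs i
  have kA : ∀ i, Integrable (fun t => deriv ψ t * A1 t i) τ := fun i => (hbal i).1
  have kJ : ∀ i, Integrable (fun t => ψ t * J1 t i) τ := fun i => (hbal i).2.1
  have kJA : ∀ i, Integrable (fun t => 2 * (ψ t * J1 t i) - deriv ψ t * A1 t i) τ :=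
    fun i => ((kJ i).const_mul 2).sub (kA i)
  have hzero : ∫ t, ∑ i, (2 * (ψ t * J1 t i) - deriv ψ t * A1 t i) ∂τ = 0 := by
    rw [integral_finsetSum _ fun i _ => kJA i]
    refine Finset.sum_eq_zero fun i _ => ?_
    rw [integral_sub ((kJ i).const_mul 2) (kA i), integral_const_mul]
    have := (hbal i).2.2
    change ∫ t, deriv ψ t * A1 t i ∂τ = 2 * ∫ t, ψ t * J1 t i ∂τ at this
    linarith
  have hX : ∫ q, (deriv ψ q.1 * (cutAvg φ η q.2 * ‖Z q.1 q.2‖ ^ 2)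
        + ψ q.1 * (cutGradAvg φ η q.2 (V q.1 q.2) * ‖Z q.1 q.2‖ ^ 2
          + 2 * (cutGradAvg φ η q.2 (Z q.1 q.2) * Q q.1 q.2))) ∂(τ.prod μ)
      = ∫ t, ((∫ y, (deriv ψ t * (cutAvg φ η y * ‖Z t y‖ ^ 2)
        + ψ t * (cutGradAvg φ η y (V t y) * ‖Z t y‖ ^ 2
          + 2 * (cutGradAvg φ η y (Z t y) * Q t y))) ∂μ)
        + ∑ i, (2 * (ψ t * J1 t i) - deriv ψ t * A1 t i)) ∂τ := by
    have j := j0.fun_add j3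
    rw [integral_add j.integral_prod_left (integrable_finsetSum _ fun i _ => kJA i), hzero,
      add_zero, integral_prod _ j]
  rw [hX]
  refine (enorm_integral_le_lintegral_enorm _).trans ?_
  rw [← lintegral_const_mul' _ _ ENNReal.ofReal_ne_top]
  refine lintegral_mono_ae ?_
  filter_upwards [hZ3.prod_right_ae, hV3.prod_right_ae, iP.prod_right_ae, iZQ.prod_right_ae,
    iVZ2.prod_right_ae,
    ae_restrict_of_ae_restrict_of_subset hsub (ae_integral_fderiv_mollifier_eq_zero h.measZ h.divZ
      hη hΩm (subset_closure.trans hΓΩ) hs),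
    ae_restrict_of_ae_restrict_of_subset hsub (ae_integral_fderiv_mollifier_eq_zero h.measV h.divV
      hη hΩm (subset_closure.trans hΓΩ) hs)] with t t1 t2 t3 t4 t5 t6 t7
  have mZ := h.measZ_apply t
  have mV := h.measV_apply t
  have q2 : Integrable (fun y => ‖Z t y‖ ^ 2) μ :=
    integrable_norm_sq_of_cube mZ.aestronglyMeasurable t1
  have q1 : Integrable (fun y => ‖Z t y‖) μ := integrable_norm_of_sq mZ.aestronglyMeasurable q2
  have qV2 : Integrable (fun y => ‖V t y‖ ^ 2) μ :=
    integrable_norm_sq_of_cube mV.aestronglyMeasurable t2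
  have qVZ : Integrable (fun y => ‖V t y‖ * ‖Z t y‖) μ :=
    (IsWeakTransport.integrable_of_sq mZ mV q2 qV2).2.1
  have f1 : ∑ i, A1 t i = ∫ p, pairKernel φ η p.1 p.2 * inner ℝ (Z t p.1) (Z t p.2) ∂(μ.prod μ) :=
    integral_mollComp_sq hφ hη mZ q1
  have f2 : ∑ i, J1 t i = ∫ p, pairGrad φ η p.1 p.2 (V t p.1) * inner ℝ (Z t p.1) (Z t p.2)
        + P t p.1 * pairGrad φ η p.1 p.2 (Z t p.2) ∂(μ.prod μ) :=
    integral_mollComp_mul_mollForce hφ hη mZ mV (h.measP_apply t) q1 qVZ t3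
  have g1 := enorm_energy_sub_le hφ hη hμ1 mZ q2
  have g2 := enorm_flux_add_le hφ hη hμ1 (P := P t) (Q := Q t) mZ mV (hQmt t) t1 t2 t3 (fun y => by
    by_cases hy : y ∈ S
    · right; simp [hQdef, hy]
    · left; exact hSφ y hy) t4 t6 t7
  rw [← f1] at g1
  rw [← f2] at g2
  have mNt := stronglyMeasurable_cutGradAvg (φ := φ) hη
  have bNt : ∀ y : E3, ‖cutGradAvg φ η y‖ ≤ L := fun q => norm_cutGradAvg_le hφ hη _
  have s0 : Integrable (fun y => cutAvg φ η y * ‖Z t y‖ ^ 2) μ :=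
    q2.bdd_mul (stronglyMeasurable_cutAvg hφ hη).aestronglyMeasurable
      (Eventually.of_forall fun y => norm_cutAvg_le hφ hη y)
  have s1 : Integrable (fun y => cutGradAvg φ η y (V t y) * ‖Z t y‖ ^ 2) μ :=
    integrable_clm_apply_mul mNt bNt mV.aestronglyMeasurable
      (mZ.norm.pow 2).aestronglyMeasurable t5
  have s2 : Integrable (fun y => cutGradAvg φ η y (Z t y) * Q t y) μ :=
    integrable_clm_apply_mul mNt bNt mZ.aestronglyMeasurable (hQmt t).aestronglyMeasurable t4
  have hsplit : (∫ y, (deriv ψ t * (cutAvg φ η y * ‖Z t y‖ ^ 2)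
        + ψ t * (cutGradAvg φ η y (V t y) * ‖Z t y‖ ^ 2
          + 2 * (cutGradAvg φ η y (Z t y) * Q t y))) ∂μ)
        + ∑ i, (2 * (ψ t * J1 t i) - deriv ψ t * A1 t i)
      = deriv ψ t * ((∫ y, cutAvg φ η y * ‖Z t y‖ ^ 2 ∂μ) - ∑ i, A1 t i)
        + ψ t * (2 * (∑ i, J1 t i) + ∫ y, cutGradAvg φ η y (V t y) * ‖Z t y‖ ^ 2 ∂μ
          + 2 * ∫ y, cutGradAvg φ η y (Z t y) * Q t y ∂μ) := by
    rw [integral_add (s0.const_mul _) ((s1.fun_add (s2.const_mul 2)).const_mul _),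
      integral_const_mul, integral_const_mul, integral_add s1 (s2.const_mul 2),
      integral_const_mul, Finset.sum_sub_distrib, ← Finset.mul_sum, ← Finset.mul_sum,
      ← Finset.mul_sum]
    ring
  rw [hsplit]
  refine (enorm_add_le _ _).trans ?_
  rw [enorm_mul, enorm_mul]
  have d1 : ‖ψ t‖ₑ ≤ ENNReal.ofReal D := by
    rw [← ofReal_norm]; exact ENNReal.ofReal_le_ofReal (hD t)
  have d2 : ‖deriv ψ t‖ₑ ≤ ENNReal.ofReal D := by
    rw [← ofReal_norm]; exact ENNReal.ofReal_le_ofReal (hD' t)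
  refine (add_le_add (mul_le_mul' d2 g1) (mul_le_mul' d1 g2)).trans ?_
  rw [← mul_add]
  gcongr
  rw [← lintegral_add_left]
  · refine lintegral_mono fun p => ?_
    rw [smoothingError, ← ENNReal.ofReal_add (by positivity) (by positivity)]
  · have z1 : StronglyMeasurable (fun p : E3 × E3 => Z t p.1) := mZ.comp_measurable measurable_fst
    have z2 : StronglyMeasurable (fun p : E3 × E3 => Z t p.2) := mZ.comp_measurable measurable_snd
    exact (((stronglyMeasurable_pairKernel hφ hη).norm.mul
      ((z1.sub z2).norm.pow 2)).measurable).ennreal_ofReal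

/-- The bump function with radii `1/(2(n+1))` and `1/(n+1)`. -/
noncomputable def shrinkingBump (n : ℕ) : ContDiffBump (0 : E3) where
  rIn := ((n : ℝ) + 1)⁻¹ / 2
  rOut := ((n : ℝ) + 1)⁻¹
  rIn_pos := by positivity
  rIn_lt_rOut := half_lt_self (by positivity)

/-- The standard mollifiers, supported in the balls of radius `1/(n+1)`. -/
noncomputable def stdMollifier (n : ℕ) : E3 → ℝ := (shrinkingBump n).normed volume

/-- The mollifiers are rescalings of a single one: the ratio of the two radii does not depend on `n`. -/
theorem stdMollifier_eq (n : ℕ) (x : E3) :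
    stdMollifier n x = (((n : ℝ) + 1)⁻¹ ^ 3)⁻¹ * stdMollifier 0 (((n : ℝ) + 1) • x) := by
  have hpos : (0 : ℝ) < (n : ℝ) + 1 := by positivity
  have h1 : ∀ x, shrinkingBump n x = shrinkingBump 0 (((n : ℝ) + 1) • x) := by
    intro x
    rw [ContDiffBump.apply, ContDiffBump.apply]
    have e1 : (shrinkingBump n).rOut / (shrinkingBump n).rIn
        = (shrinkingBump 0).rOut / (shrinkingBump 0).rIn := by
      simp only [shrinkingBump]; field_simp
    have e2 : (shrinkingBump n).rIn⁻¹ • (x - 0)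
        = (shrinkingBump 0).rIn⁻¹ • (((n : ℝ) + 1) • x - 0) := by
      simp only [shrinkingBump, sub_zero, smul_smul]
      congr 1; field_simp; norm_num
    rw [e1, e2]
  have h2 : ∫ x, shrinkingBump n x = ((n : ℝ) + 1)⁻¹ ^ 3 * ∫ x, shrinkingBump 0 x := by
    simp_rw [h1]
    rw [Measure.integral_comp_smul_of_nonneg volume _ _ (hR := hpos.le)]
    simp
  rw [stdMollifier, stdMollifier, ContDiffBump.normed, ContDiffBump.normed, h1, h2]
  rw [div_mul_eq_div_div_swap, div_eq_inv_mul (_ / _)]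

theorem exists_isMollifier_stdMollifier : ∃ c : ℝ, 0 ≤ c ∧ ∀ n : ℕ,
    IsMollifier (stdMollifier n) ((n : ℝ) + 1)⁻¹ (c / ((n : ℝ) + 1)⁻¹ ^ 3)
      (c / ((n : ℝ) + 1)⁻¹ ^ 4) := by
  have hsm : ∀ n, ContDiff ℝ ∞ (stdMollifier n) := fun n => (shrinkingBump n).contDiff_normed
  have hcs : HasCompactSupport (stdMollifier 0) := (shrinkingBump 0).hasCompactSupport_normed
  obtain ⟨c1, h1⟩ := (hsm 0).continuous.bounded_above_of_compact_support hcs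
  obtain ⟨c2, h2⟩ := ((hsm 0).continuous_fderiv (by simp)).bounded_above_of_compact_support
    (hcs.fderiv ℝ)
  have hc1 : 0 ≤ c1 := (norm_nonneg _).trans (h1 0)
  refine ⟨max c1 c2, hc1.trans (le_max_left _ _), fun n => ?_⟩
  have hpos : (0 : ℝ) < (n : ℝ) + 1 := by positivity
  refine ⟨hsm n, fun x => (shrinkingBump n).nonneg_normed x,
    fun x hx => ?_, (shrinkingBump n).integral_normed, fun x => ?_, fun x => ?_⟩
  · have : x ∉ Function.support (stdMollifier n) := by
      rw [stdMollifier, ContDiffBump.support_normed_eq, mem_ball_zero_iff, not_lt]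
      exact hx
    exact Function.notMem_support.1 this
  · rw [stdMollifier_eq, div_eq_inv_mul]
    gcongr
    exact (le_abs_self _).trans ((h1 _).trans (le_max_left _ _))
  · have e : stdMollifier n
        = fun x => (((n : ℝ) + 1)⁻¹ ^ 3)⁻¹ * stdMollifier 0 (((n : ℝ) + 1) • x) :=
      funext (stdMollifier_eq n)
    have hd : HasFDerivAt (stdMollifier n) ((((n : ℝ) + 1)⁻¹ ^ 3)⁻¹ •
        (fderiv ℝ (stdMollifier 0) (((n : ℝ) + 1) • x)).comp
          (((n : ℝ) + 1) • ContinuousLinearMap.id ℝ E3)) x := by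
      rw [e]
      exact (((hsm 0).differentiable (by simp) _).hasFDerivAt.comp x
        ((hasFDerivAt_id x).const_smul ((n : ℝ) + 1))).const_mul _
    rw [hd.fderiv, norm_smul, norm_inv, norm_pow, norm_inv, Real.norm_of_nonneg hpos.le]
    have h3 : ‖(fderiv ℝ (stdMollifier 0) (((n : ℝ) + 1) • x)).comp
        (((n : ℝ) + 1) • ContinuousLinearMap.id ℝ E3)‖ ≤ max c1 c2 * ((n : ℝ) + 1) := by
      rw [ContinuousLinearMap.comp_smul, ContinuousLinearMap.comp_id, norm_smul,
        Real.norm_of_nonneg hpos.le, mul_comm]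
      gcongr
      exact (h2 _).trans (le_max_right _ _)
    calc _ ≤ (((n : ℝ) + 1)⁻¹ ^ 3)⁻¹ * (max c1 c2 * ((n : ℝ) + 1)) := by gcongr
      _ = _ := by field_simp

/-- Smoothing by the standard mollifiers converges almost everywhere. -/
theorem ae_tendsto_stdMollifier {F : Type*} [NormedAddCommGroup F] [NormedSpace ℝ F]
    [CompleteSpace F] {g : E3 → F} (hg : LocallyIntegrable g) :
    ∀ᵐ y, Tendsto (fun n => ∫ x, stdMollifier n (x - y) • g x) atTop (nhds (g y)) := by
  have hε : Tendsto (fun n : ℕ => (shrinkingBump n).rOut) atTop (nhds 0) := by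
    have := tendsto_one_div_add_atTop_nhds_zero_nat (𝕜 := ℝ)
    simpa [shrinkingBump] using this
  filter_upwards [ContDiffBump.ae_convolution_tendsto_right_of_locallyIntegrable (K := 2) hε
    (Eventually.of_forall fun n => by simp only [shrinkingBump]; linarith) hg] with y hy
  refine hy.congr fun n => ?_
  rw [convolution_eq_swap]
  refine integral_congr_ae (Eventually.of_forall fun x => ?_)
  simp only [ContinuousLinearMap.lsmul_apply, stdMollifier]
  rw [← (shrinkingBump n).normed_neg, neg_sub]

theorem tendsto_ofReal_rpow_mul {C s : ℝ} (hs : 0 < s) {M : ℝ≥0∞} (hM : M ≠ (⊤ : ℝ≥0∞)) :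
    Tendsto (fun n : ℕ => ENNReal.ofReal (C * ((n : ℝ) + 1)⁻¹ ^ s) * M) atTop (nhds 0) := by
  have h0 : Tendsto (fun n : ℕ => ((n : ℝ) + 1)⁻¹) atTop (nhds 0) := by
    simpa using tendsto_one_div_add_atTop_nhds_zero_nat (𝕜 := ℝ)
  have h1 : Tendsto (fun n : ℕ => C * ((n : ℝ) + 1)⁻¹ ^ s) atTop (nhds 0) := by
    simpa [Real.zero_rpow hs.ne'] using (h0.rpow_const (Or.inr hs.le)).const_mul C
  have h2 := ENNReal.tendsto_ofReal h1
  rw [ENNReal.ofReal_zero] at h2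
  simpa using ENNReal.Tendsto.mul_const h2 (Or.inr hM)

/-- The bound of `lintegral_smoothingError_le` tends to zero: the volume is `O(ε³)`, and the
remaining powers are `ε^(3r-1)`, where `r > 1/3` is needed, and `ε^(1/2)`. -/
theorem tendsto_smoothing_bound {C r : ℝ} (hC : 0 ≤ C) (hr : 1 / 3 < r) {D B M : ℝ≥0∞}
    (hD : D ≠ (⊤ : ℝ≥0∞)) (hB : B ≠ (⊤ : ℝ≥0∞)) (hM : M ≠ (⊤ : ℝ≥0∞)) :
    Tendsto (fun n : ℕ => D * (volume (Metric.ball (0 : E3) (2 * ((n : ℝ) + 1)⁻¹)) *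
      (ENNReal.ofReal (C / ((n : ℝ) + 1)⁻¹ ^ 4) *
          (2 * (ENNReal.ofReal ((2 * ((n : ℝ) + 1)⁻¹) ^ (3 * r)) * B))
        + ENNReal.ofReal (C / ((n : ℝ) + 1)⁻¹ ^ 3 * ((n : ℝ) + 1)⁻¹ ^ (1 / 2 : ℝ)) * M)))
      atTop (nhds 0) := by
  set v := volume (Metric.ball (0 : E3) 1) with hv
  have hvt : v ≠ (⊤ : ℝ≥0∞) := measure_ball_lt_top.ne
  have h1 := tendsto_ofReal_rpow_mul (C := 8 * C * 2 ^ (3 * r)) (s := 3 * r - 1) (by linarith)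
    (M := D * v * 2 * B) (by finiteness)
  have h2 := tendsto_ofReal_rpow_mul (C := 8 * C) (s := 1 / 2) (by norm_num)
    (M := D * v * M) (by finiteness)
  have h3 := h1.add h2
  rw [add_zero] at h3
  refine h3.congr fun n => ?_
  set e : ℝ := ((n : ℝ) + 1)⁻¹ with he
  have hpos : 0 < e := by positivity
  have hvol : volume (Metric.ball (0 : E3) (2 * e)) = ENNReal.ofReal (8 * e ^ 3) * v := by
    rw [Measure.addHaar_ball _ _ (by positivity)]
    congr 2
    simp only [finrank_euclideanSpace, Fintype.card_fin]; ring
  have r1 : 8 * C * 2 ^ (3 * r) * e ^ (3 * r - 1)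
      = 8 * e ^ 3 * (C / e ^ 4) * (2 * e) ^ (3 * r) := by
    rw [Real.mul_rpow zero_le_two hpos.le, Real.rpow_sub hpos, Real.rpow_one]
    field_simp
  have r2 : 8 * C * e ^ (1 / 2 : ℝ) = 8 * e ^ 3 * (C / e ^ 3 * e ^ (1 / 2 : ℝ)) := by
    field_simp
  rw [r1, r2, hvol, ENNReal.ofReal_mul (by positivity), ENNReal.ofReal_mul (by positivity),
    ENNReal.ofReal_mul (p := 8 * e ^ 3) (by positivity)]
  ring

/-- **Local energy balance.** If the increments of `Z` and `V` in `L³` are of order `|w|^r` with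
`r > 1/3`, the weak equation may be tested with `φ Z`. The pressure is only needed in a
neighbourhood `S` of the support of `∇φ`, and only there has to lie in `L^(3/2)`. -/
theorem IsWeakTransport.local_balance {Ω Γ S : Set E3} {T : ℝ} {Z V : ℝ → E3 → E3}
    {P : ℝ → E3 → ℝ} {φ : E3 → ℝ} {L : NNReal} {ε₀ r : ℝ} {B : ℝ≥0∞}
    (h : IsWeakTransport Ω T Z V P) (hT : 0 < T)
    (hφ : IsLipCutoff φ L) (hΩm : MeasurableSet Ω) (hΓm : MeasurableSet Γ)
    (hΓc : IsCompact (closure Γ)) (hΓΩ : closure Γ ⊆ Ω) (hε₀ : 0 < ε₀)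
    (hs : ∀ x ∈ tsupport φ, Metric.closedBall x ε₀ ⊆ Γ)
    {ψ : ℝ → ℝ} (hψ : ContDiff ℝ ∞ ψ) (hψc : HasCompactSupport ψ) {a b : ℝ} (ha : 0 < a)
    (hb : b < T) (hψs : tsupport ψ ⊆ Icc a b) (hS : MeasurableSet S)
    (hSφ : ∀ y, y ∉ S → ∀ x, ‖x - y‖ < ε₀ → fderiv ℝ φ x = 0)
    (hr : 1 / 3 < r) (hB : B ≠ (⊤ : ℝ≥0∞))
    (hBZ : IncrementBound T Γ r B Z) (hBV : IncrementBound T Γ r B V)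
    (hZ3 : Integrable (fun q : ℝ × E3 => ‖Z q.1 q.2‖ ^ 3)
      ((volume.restrict (Icc a b)).prod (volume.restrict Γ)))
    (hV3 : Integrable (fun q : ℝ × E3 => ‖V q.1 q.2‖ ^ 3)
      ((volume.restrict (Icc a b)).prod (volume.restrict Γ)))
    (hQ3 : Integrable (fun q : ℝ × E3 => ‖S.indicator (P q.1) q.2‖ ^ (3 / 2 : ℝ))
      ((volume.restrict (Icc a b)).prod (volume.restrict Γ))) :
    ∫ q, (deriv ψ q.1 * (φ q.2 * ‖Z q.1 q.2‖ ^ 2)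
        + ψ q.1 * (fderiv ℝ φ q.2 (V q.1 q.2) * ‖Z q.1 q.2‖ ^ 2
          + 2 * (fderiv ℝ φ q.2 (Z q.1 q.2) * S.indicator (P q.1) q.2)))
        ∂((volume.restrict (Icc a b)).prod (volume.restrict Γ)) = 0 := by
  have hsub : Icc a b ⊆ Ioo 0 T := fun t ht => ⟨ha.trans_le ht.1, ht.2.trans_lt hb⟩
  have hΓf : volume Γ < (⊤ : ℝ≥0∞) := (measure_mono subset_closure).trans_lt hΓc.measure_lt_top
  have : IsFiniteMeasure (volume.restrict Γ) := ⟨by simpa using hΓf⟩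
  set μ : Measure E3 := volume.restrict Γ with hμ
  set τ : Measure ℝ := volume.restrict (Icc a b) with hτ
  set Q : ℝ → E3 → ℝ := fun t => S.indicator (P t) with hQdef
  have hQm : StronglyMeasurable (fun q : ℝ × E3 => Q q.1 q.2) := by
    have : (fun q : ℝ × E3 => Q q.1 q.2)
        = (Prod.snd ⁻¹' S).indicator (fun q : ℝ × E3 => P q.1 q.2) := rfl
    rw [this]
    exact h.measP.indicator (hS.preimage measurable_snd)
  have iZ2 : Integrable (fun q : ℝ × E3 => ‖Z q.1 q.2‖ ^ 2) (τ.prod μ) :=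
    integrable_norm_sq_of_cube h.measZ.aestronglyMeasurable hZ3
  have iVZ2 : Integrable (fun q : ℝ × E3 => ‖V q.1 q.2‖ * ‖Z q.1 q.2‖ ^ 2) (τ.prod μ) := by
    simpa using integrable_norm_mul_sq_of_cube h.measV.aestronglyMeasurable
      h.measZ.aestronglyMeasurable hV3 hZ3
  have iZQ : Integrable (fun q : ℝ × E3 => ‖Z q.1 q.2‖ * ‖Q q.1 q.2‖) (τ.prod μ) :=
    integrable_mul_of_young h.measZ.aestronglyMeasurable hQm.aestronglyMeasurable hZ3 hQ3
  obtain ⟨D1, hD1⟩ := hψ.continuous.bounded_above_of_compact_support hψc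
  obtain ⟨D2, hD2⟩ := (hψ.continuous_deriv (by simp)).bounded_above_of_compact_support hψc.deriv
  set D := max D1 D2 with hDdef
  have hD : ∀ t, ‖ψ t‖ ≤ D := fun t => (hD1 t).trans (le_max_left _ _)
  have hD' : ∀ t, ‖deriv ψ t‖ ≤ D := fun t => (hD2 t).trans (le_max_right _ _)
  have hD0 : 0 ≤ D := (norm_nonneg _).trans (hD 0)
  obtain ⟨c, hc, hη⟩ := exists_isMollifier_stdMollifier
  have hε : Tendsto (fun n : ℕ => ((n : ℝ) + 1)⁻¹) atTop (nhds 0) := by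
    simpa using tendsto_one_div_add_atTop_nhds_zero_nat (𝕜 := ℝ)
  set F : ℕ → ℝ × E3 → ℝ := fun n q =>
    deriv ψ q.1 * (cutAvg φ (stdMollifier n) q.2 * ‖Z q.1 q.2‖ ^ 2)
        + ψ q.1 * (cutGradAvg φ (stdMollifier n) q.2 (V q.1 q.2) * ‖Z q.1 q.2‖ ^ 2
          + 2 * (cutGradAvg φ (stdMollifier n) q.2 (Z q.1 q.2) * Q q.1 q.2)) with hF
  have hFm : ∀ n, AEStronglyMeasurable (F n) (τ.prod μ) := by
    intro n
    have m1 : StronglyMeasurable (fun q : ℝ × E3 => cutAvg φ (stdMollifier n) q.2) :=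
      (stronglyMeasurable_cutAvg hφ (hη n)).comp_measurable measurable_snd
    have m2 : StronglyMeasurable (fun q : ℝ × E3 => cutGradAvg φ (stdMollifier n) q.2) :=
      (stronglyMeasurable_cutGradAvg (hη n)).comp_measurable measurable_snd
    have m3 : StronglyMeasurable (fun q : ℝ × E3 => deriv ψ q.1) :=
      ((hψ.continuous_deriv (by simp)).comp continuous_fst).stronglyMeasurable
    have m4 : StronglyMeasurable (fun q : ℝ × E3 => ψ q.1) :=
      (hψ.continuous.comp continuous_fst).stronglyMeasurable
    have m5 := stronglyMeasurable_fderiv_apply m2 h.measV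
    have m6 := stronglyMeasurable_fderiv_apply m2 h.measZ
    have m7 : StronglyMeasurable (fun q : ℝ × E3 => ‖Z q.1 q.2‖ ^ 2) := h.measZ.norm.pow 2
    exact ((m3.mul (m1.mul m7)).add
      (m4.mul ((m5.mul m7).add ((m6.mul hQm).const_mul 2)))).aestronglyMeasurable
  have hlim : Tendsto (fun n => ∫ q, F n q ∂(τ.prod μ)) atTop (nhds
      (∫ q, (deriv ψ q.1 * (φ q.2 * ‖Z q.1 q.2‖ ^ 2)
        + ψ q.1 * (fderiv ℝ φ q.2 (V q.1 q.2) * ‖Z q.1 q.2‖ ^ 2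
          + 2 * (fderiv ℝ φ q.2 (Z q.1 q.2) * Q q.1 q.2))) ∂(τ.prod μ))) := by
    refine tendsto_integral_of_dominated_convergence (fun q => D * ‖Z q.1 q.2‖ ^ 2
      + D * (L * (‖V q.1 q.2‖ * ‖Z q.1 q.2‖ ^ 2) + 2 * (L * (‖Z q.1 q.2‖ * ‖Q q.1 q.2‖))))
      hFm ?_ ?_ ?_
    · exact (iZ2.const_mul D).add (((iVZ2.const_mul (L : ℝ)).add
        ((iZQ.const_mul (L : ℝ)).const_mul 2)).const_mul D)
    · refine fun n => Eventually.of_forall fun q => ?_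
      have b1 := norm_cutAvg_le hφ (hη n) q.2
      have b2 := norm_cutGradAvg_le hφ (hη n) q.2
      have b3 := ((cutGradAvg φ (stdMollifier n) q.2).le_opNorm (V q.1 q.2)).trans
        (mul_le_mul_of_nonneg_right b2 (norm_nonneg _))
      have b4 := ((cutGradAvg φ (stdMollifier n) q.2).le_opNorm (Z q.1 q.2)).trans
        (mul_le_mul_of_nonneg_right b2 (norm_nonneg _))
      refine (norm_add_le _ _).trans (add_le_add ?_ ?_)
      · rw [norm_mul, norm_mul, norm_pow, norm_norm]
        calc _ ≤ D * (1 * ‖Z q.1 q.2‖ ^ 2) := by gcongr; exact hD' _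
          _ = _ := by ring
      · rw [norm_mul]
        refine mul_le_mul (hD _) ((norm_add_le _ _).trans (add_le_add ?_ ?_)) (norm_nonneg _) hD0
        · rw [norm_mul, norm_pow, norm_norm, ← mul_assoc]
          gcongr
        · rw [norm_mul, norm_mul, Real.norm_two, ← mul_assoc (L : ℝ)]
          gcongr
    · have t1 := ae_tendsto_stdMollifier (g := φ) hφ.lipschitz.continuous.locallyIntegrable
      have hli : LocallyIntegrable (fderiv ℝ φ) volume := by
        have hm : AEStronglyMeasurable (fderiv ℝ φ) volume :=
          (measurable_fderiv ℝ φ).stronglyMeasurable.aestronglyMeasurable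
        have hc : LocallyIntegrable (fun _ : E3 => (L : ℝ)) volume := locallyIntegrable_const _
        exact hc.mono hm (Eventually.of_forall fun x => by
          rw [Real.norm_of_nonneg L.coe_nonneg]; exact norm_fderiv_le_of_lipschitz ℝ hφ.lipschitz)
      have t2 := ae_tendsto_stdMollifier hli
      have t12 : ∀ᵐ y ∂μ, Tendsto (fun n => cutAvg φ (stdMollifier n) y) atTop (nhds (φ y)) ∧
          Tendsto (fun n => cutGradAvg φ (stdMollifier n) y) atTop (nhds (fderiv ℝ φ y)) := by
        refine ae_restrict_of_ae ?_
        filter_upwards [t1, t2] with y h1 h2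
        refine ⟨?_, h2⟩
        simpa [cutAvg, mul_comm] using h1
      filter_upwards [Measure.quasiMeasurePreserving_snd.ae t12] with q hq
      have hap : ∀ w : E3, Tendsto (fun n => cutGradAvg φ (stdMollifier n) q.2 w) atTop
          (nhds (fderiv ℝ φ q.2 w)) := fun w =>
        ((ContinuousLinearMap.apply ℝ ℝ w).continuous.tendsto _).comp hq.2
      exact ((hq.1.mul_const _).const_mul _).add ((((hap _).mul_const _).add
        (((hap _).mul_const _).const_mul 2)).const_mul _)
  set M : ℝ≥0∞ := ∫⁻ q, (1 + ‖V q.1 q.2‖ₑ ^ 3 + ‖Q q.1 q.2‖ₑ ^ (3 / 2 : ℝ)) ∂(τ.prod μ) with hM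
  have hMt : M ≠ (⊤ : ℝ≥0∞) := by
    have m1 : Measurable (fun q : ℝ × E3 => 1 + ‖V q.1 q.2‖ₑ ^ 3) :=
      measurable_const.add (h.measV.enorm.pow_const 3)
    rw [hM, lintegral_add_left m1, lintegral_add_left measurable_const, lintegral_one]
    have e1 : ∫⁻ q, ‖V q.1 q.2‖ₑ ^ 3 ∂(τ.prod μ) < (⊤ : ℝ≥0∞) := by
      simpa [HasFiniteIntegral] using hV3.2
    have e2 : ∫⁻ q, ‖Q q.1 q.2‖ₑ ^ (3 / 2 : ℝ) ∂(τ.prod μ) < (⊤ : ℝ≥0∞) := by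
      have := hQ3.2
      simp only [HasFiniteIntegral] at this
      refine (lintegral_mono fun q => ?_).trans_lt this
      rw [← ofReal_norm_rpow _ (by norm_num), Real.enorm_of_nonneg (by positivity)]
    have e3 : (τ.prod μ) univ < (⊤ : ℝ≥0∞) := measure_lt_top _ _
    exact (ENNReal.add_lt_top.2 ⟨ENNReal.add_lt_top.2 ⟨e3, e1⟩, e2⟩).ne
  have hle : ∀ᶠ n : ℕ in atTop, ‖∫ q, F n q ∂(τ.prod μ)‖ₑ ≤ ENNReal.ofReal D *
      (volume (Metric.ball (0 : E3) (2 * ((n : ℝ) + 1)⁻¹)) *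
      (ENNReal.ofReal (c * (2 + 3 * L) / ((n : ℝ) + 1)⁻¹ ^ 4) *
          (2 * (ENNReal.ofReal ((2 * ((n : ℝ) + 1)⁻¹) ^ (3 * r)) * B))
        + ENNReal.ofReal (c * (2 + 3 * L) / ((n : ℝ) + 1)⁻¹ ^ 3 * ((n : ℝ) + 1)⁻¹ ^ (1 / 2 : ℝ))
          * M)) := by
    filter_upwards [hε.eventually (gt_mem_nhds (show (0 : ℝ) < min ε₀ (1 / 2) by positivity))]
      with n hn
    have hn1 : ((n : ℝ) + 1)⁻¹ ≤ ε₀ := hn.le.trans (min_le_left _ _)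
    have hn2 : ((n : ℝ) + 1)⁻¹ ≤ 1 / 2 := hn.le.trans (min_le_right _ _)
    refine (h.enorm_smoothed_balance_le hT hφ (hη n) hΩm hΓc hΓΩ
      (fun x hx => (Metric.closedBall_subset_closedBall hn1).trans (hs x hx)) hψ hψc ha hb hψs
      hD hD' hS (fun y hy x hx => hSφ y hy x (hx.trans_le hn1)) hZ3 hV3 hQ3).trans ?_
    gcongr
    exact lintegral_smoothingError_le (by positivity) (by linarith) hφ (hη n) hc hΓm (by linarith)
      h.measZ h.measV hQm hBZ hBV hsub
  have hz := tendsto_of_tendsto_of_tendsto_of_le_of_le' tendsto_const_nhds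
    (tendsto_smoothing_bound (C := c * (2 + 3 * L)) (r := r) (D := ENNReal.ofReal D) (B := B)
      (M := M) (by positivity) hr ENNReal.ofReal_ne_top hB hMt)
    (Eventually.of_forall fun n => zero_le) hle
  have := tendsto_nhds_unique hlim.enorm hz
  exact enorm_eq_zero.1 this

/-! ### Cutoffs at distance `h` from the boundary -/

/-- The cutoff that vanishes at distance `≤ h` from the complement of `Ω`, equals `1` at distance
`≥ 2h`, and is an affine function of the distance in between. -/
noncomputable def collarCutoff (Ω : Set E3) (h : ℝ) (x : E3) : ℝ :=
  max 0 (min 1 (h⁻¹ * Metric.infDist x Ωᶜ - 1))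

section Collar

variable {Ω : Set E3} {h : ℝ}

theorem collarCutoff_nonneg (x : E3) : 0 ≤ collarCutoff Ω h x := le_max_left _ _

theorem collarCutoff_le_one (x : E3) : collarCutoff Ω h x ≤ 1 :=
  max_le zero_le_one (min_le_left _ _)

theorem abs_collarCutoff_le_one (x : E3) : |collarCutoff Ω h x| ≤ 1 := by
  rw [abs_of_nonneg (collarCutoff_nonneg x)]; exact collarCutoff_le_one x

theorem collarCutoff_eq_zero (hh : 0 < h) {x : E3} (hx : Metric.infDist x Ωᶜ ≤ h) :
    collarCutoff Ω h x = 0 := by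
  have : h⁻¹ * Metric.infDist x Ωᶜ ≤ 1 := by rwa [inv_mul_le_iff₀ hh, mul_one]
  exact max_eq_left ((min_le_right _ _).trans (by linarith))

theorem collarCutoff_eq_one (hh : 0 < h) {x : E3} (hx : 2 * h ≤ Metric.infDist x Ωᶜ) :
    collarCutoff Ω h x = 1 := by
  have : 2 ≤ h⁻¹ * Metric.infDist x Ωᶜ := by
    rw [le_inv_mul_iff₀ hh]; linarith
  rw [collarCutoff, min_eq_left (by linarith), max_eq_right zero_le_one]

theorem lipschitzWith_collarCutoff (hh : 0 < h) :
    LipschitzWith (Real.toNNReal h⁻¹) (collarCutoff Ω h) := by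
  refine ((LipschitzWith.of_dist_le_mul fun x y => ?_).const_min 1).const_max 0
  rw [Real.dist_eq, Real.coe_toNNReal _ (inv_nonneg.2 hh.le), sub_sub_sub_cancel_right, ← mul_sub,
    abs_mul, abs_of_nonneg (inv_nonneg.2 hh.le)]
  gcongr
  simpa [Real.dist_eq] using (Metric.lipschitz_infDist_pt (Ωᶜ)).dist_le_mul x y

theorem tsupport_collarCutoff_subset (hh : 0 < h) :
    tsupport (collarCutoff Ω h) ⊆ {x | h ≤ Metric.infDist x Ωᶜ} :=
  closure_minimal (fun x hx => by
    by_contra hc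
    exact hx (collarCutoff_eq_zero hh (not_le.1 hc).le))
    (isClosed_le continuous_const (Metric.continuous_infDist_pt _))

theorem setOf_le_infDist_compl_subset (hh : 0 < h) : {x | h ≤ Metric.infDist x Ωᶜ} ⊆ Ω := by
  intro x hx
  by_contra hc
  have : Metric.infDist x Ωᶜ = 0 := Metric.infDist_zero_of_mem hc
  have hx' : h ≤ Metric.infDist x Ωᶜ := hx
  linarith

theorem isCompact_setOf_le_infDist_compl (hΩ : Bornology.IsBounded Ω) (hh : 0 < h) :
    IsCompact {x | h ≤ Metric.infDist x Ωᶜ} :=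
  Metric.isCompact_of_isClosed_isBounded
    (isClosed_le continuous_const (Metric.continuous_infDist_pt _))
    (hΩ.subset (setOf_le_infDist_compl_subset hh))

theorem isLipCutoff_collarCutoff (hΩ : Bornology.IsBounded Ω) (hh : 0 < h) :
    IsLipCutoff (collarCutoff Ω h) (Real.toNNReal h⁻¹) where
  lipschitz := lipschitzWith_collarCutoff hh
  compact := (isCompact_setOf_le_infDist_compl hΩ hh).of_isClosed_subset (isClosed_tsupport _)
    (tsupport_collarCutoff_subset hh)
  abs_le := abs_collarCutoff_le_one

theorem fderiv_collarCutoff_of_le (hh : 0 < h) {x : E3} (hx : Metric.infDist x Ωᶜ ≤ h) :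
    fderiv ℝ (collarCutoff Ω h) x = 0 :=
  IsLocalMin.fderiv_eq_zero (Eventually.of_forall fun y => by
    rw [collarCutoff_eq_zero hh hx]; exact collarCutoff_nonneg y)

theorem fderiv_collarCutoff_of_ge (hh : 0 < h) {x : E3} (hx : 2 * h ≤ Metric.infDist x Ωᶜ) :
    fderiv ℝ (collarCutoff Ω h) x = 0 :=
  IsLocalMax.fderiv_eq_zero (Eventually.of_forall fun y => by
    rw [collarCutoff_eq_one hh hx]; exact collarCutoff_le_one y)

theorem fderiv_collarCutoff (hh : 0 < h) {x : E3} (h1 : h < Metric.infDist x Ωᶜ)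
    (h2 : Metric.infDist x Ωᶜ < 2 * h) :
    fderiv ℝ (collarCutoff Ω h) x = h⁻¹ • fderiv ℝ (fun y => Metric.infDist y Ωᶜ) x := by
  have hc := (Metric.continuous_infDist_pt (Ωᶜ)).continuousAt (x := x)
  have he : collarCutoff Ω h =ᶠ[nhds x]
      fun y => h⁻¹ • (fun y => Metric.infDist y Ωᶜ) y - 1 := by
    filter_upwards [hc.eventually (lt_mem_nhds h1), hc.eventually (gt_mem_nhds h2)] with y y1 y2
    have e1 : 1 < h⁻¹ * Metric.infDist y Ωᶜ := by rwa [lt_inv_mul_iff₀ hh, mul_one]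
    have e2 : h⁻¹ * Metric.infDist y Ωᶜ < 2 := by rw [inv_mul_lt_iff₀ hh]; linarith
    simp only [collarCutoff, smul_eq_mul]
    rw [min_eq_right (by linarith), max_eq_right (by linarith)]
  rw [he.fderiv_eq, fderiv_sub_const]
  exact congrFun (fderiv_const_smul_field (𝕜 := ℝ) (f := fun y : E3 => Metric.infDist y Ωᶜ) h⁻¹) x

theorem norm_fderiv_collarCutoff_apply_le (hh : 0 < h) (x w : E3) :
    ‖fderiv ℝ (collarCutoff Ω h) x w‖
      ≤ h⁻¹ * ‖fderiv ℝ (fun y => Metric.infDist y Ωᶜ) x w‖ := by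
  have h0 : 0 ≤ h⁻¹ * ‖fderiv ℝ (fun y => Metric.infDist y Ωᶜ) x w‖ := by positivity
  rcases le_or_gt (Metric.infDist x Ωᶜ) h with h1 | h1
  · rw [fderiv_collarCutoff_of_le hh h1]; simpa using h0
  rcases le_or_gt (2 * h) (Metric.infDist x Ωᶜ) with h2 | h2
  · rw [fderiv_collarCutoff_of_ge hh h2]; simpa using h0
  rw [fderiv_collarCutoff hh h1 h2]
  simp [abs_of_pos hh]

end Collar

/-- The collar `{x ∈ Ω | d(x, Ωᶜ) < h}`. -/
def collar (Ω : Set E3) (h : ℝ) : Set E3 := {x ∈ Ω | Metric.infDist x Ωᶜ < h}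

theorem measurableSet_collar {Ω : Set E3} (hΩ : MeasurableSet Ω) (h : ℝ) :
    MeasurableSet (collar Ω h) :=
  hΩ.inter (isOpen_lt (Metric.continuous_infDist_pt _) continuous_const).measurableSet

theorem mul_sq_le_cube_weighted {l d v : ℝ} (hl : 0 < l) (hd : 0 ≤ d) (hv : 0 ≤ v) :
    v * d ^ 2 ≤ l * d ^ 3 + (l ^ 2)⁻¹ * v ^ 3 := by
  rcases le_total v (l * d) with h | h
  · have : v * d ^ 2 ≤ l * d * d ^ 2 := by gcongr
    have h2 : 0 ≤ (l ^ 2)⁻¹ * v ^ 3 := by positivity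
    nlinarith
  · have h1 : d ≤ l⁻¹ * v := by rwa [le_inv_mul_iff₀ hl]
    have : v * d ^ 2 ≤ v * (l⁻¹ * v) ^ 2 := by gcongr
    have h2 : 0 ≤ l * d ^ 3 := by positivity
    have h3 : v * (l⁻¹ * v) ^ 2 = (l ^ 2)⁻¹ * v ^ 3 := by rw [mul_pow, inv_pow]; ring
    linarith

/-! ### The flux through the collars -/

theorem integrable_sq_prod_of_bound {Ω : Set E3} {T C : ℝ} {u : ℝ → E3 → E3}
    (hm : StronglyMeasurable (fun z : ℝ × E3 => u z.1 z.2))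
    (hC : ∀ᵐ t ∂(volume.restrict (Ioo 0 T)), ∫⁻ x in Ω, ‖u t x‖ₑ ^ 2 ≤ ENNReal.ofReal C) :
    Integrable (fun q : ℝ × E3 => ‖u q.1 q.2‖ ^ 2)
      ((volume.restrict (Ioo 0 T)).prod (volume.restrict Ω)) := by
  refine ⟨(hm.norm.pow 2).aestronglyMeasurable, ?_⟩
  have he : ∀ q : ℝ × E3, ‖‖u q.1 q.2‖ ^ 2‖ₑ = ‖u q.1 q.2‖ₑ ^ 2 := fun q => by
    rw [enorm_pow, enorm_norm]
  simp_rw [HasFiniteIntegral, he]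
  rw [lintegral_prod _ (hm.enorm.pow_const 2).aemeasurable]
  calc _ ≤ ∫⁻ _ in Ioo 0 T, ENNReal.ofReal C := lintegral_mono_ae hC
    _ < (⊤ : ℝ≥0∞) := by simp [ENNReal.mul_lt_top]

theorem infDist_compl_pos {Ω : Set E3} (hΩ : IsOpen Ω) (hΩb : Bornology.IsBounded Ω)
    {x : E3} (hx : x ∈ Ω) : 0 < Metric.infDist x Ωᶜ := by
  have hne : (Ωᶜ).Nonempty := by
    by_contra hemp
    rw [not_nonempty_iff_eq_empty, compl_empty_iff] at hemp
    exact NormedSpace.unbounded_univ ℝ E3 (hemp ▸ hΩb)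
  exact (hΩ.isClosed_compl.notMem_iff_infDist_pos hne).1 (fun hc => hc hx)

/-- The bound of the boundary flux, for the cutoff at distance `h`, by Young's inequality with
weight `l`. -/
theorem enorm_collar_flux_le {Ω : Set E3} {h l D : ℝ} (hh : 0 < h) (hl : 0 < l) (hD : 0 ≤ D)
    {z v : E3} {p s : ℝ} (hs : ‖s‖ ≤ D) (x : E3) :
    ‖s * (fderiv ℝ (collarCutoff Ω h) x v * ‖z‖ ^ 2
        + 2 * (fderiv ℝ (collarCutoff Ω h) x z * (collar Ω (3 * h)).indicator (fun _ => p) x))‖ₑ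
      ≤ (collar Ω (3 * h)).indicator (fun x => ENNReal.ofReal (2 * D * h⁻¹ * l) *
          (‖z‖ₑ ^ 3 + ‖p‖ₑ ^ (3 / 2 : ℝ))
        + ENNReal.ofReal (2 * D * h⁻¹ * (l ^ 2)⁻¹) *
          (‖fderiv ℝ (fun y => Metric.infDist y Ωᶜ) x v‖ₑ ^ 3
            + ‖fderiv ℝ (fun y => Metric.infDist y Ωᶜ) x z‖ₑ ^ 3)) x := by
  by_cases hx : x ∈ collar Ω (3 * h)
  · rw [indicator_of_mem hx, indicator_of_mem hx]
    set a := ‖fderiv ℝ (fun y => Metric.infDist y Ωᶜ) x v‖ with ha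
    set b := ‖fderiv ℝ (fun y => Metric.infDist y Ωᶜ) x z‖ with hb
    have h1 := norm_fderiv_collarCutoff_apply_le (Ω := Ω) hh x v
    have h2 := norm_fderiv_collarCutoff_apply_le (Ω := Ω) hh x z
    have y1 := mul_sq_le_cube_weighted hl (norm_nonneg z)
      (norm_nonneg (fderiv ℝ (fun y => Metric.infDist y Ωᶜ) x v))
    have y2 := mul_le_young hl (norm_nonneg (fderiv ℝ (fun y => Metric.infDist y Ωᶜ) x z))
      (norm_nonneg p)
    have e1 : (‖z‖ₑ ^ 3 + ‖p‖ₑ ^ (3 / 2 : ℝ)) = ENNReal.ofReal (‖z‖ ^ 3 + ‖p‖ ^ (3 / 2 : ℝ)) := by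
      rw [ENNReal.ofReal_add (by positivity) (by positivity), ofReal_norm_pow,
        ofReal_norm_rpow _ (by norm_num)]
    have e2 : (‖fderiv ℝ (fun y => Metric.infDist y Ωᶜ) x v‖ₑ ^ 3
            + ‖fderiv ℝ (fun y => Metric.infDist y Ωᶜ) x z‖ₑ ^ 3)
        = ENNReal.ofReal (a ^ 3 + b ^ 3) := by
      rw [ENNReal.ofReal_add (by positivity) (by positivity), ofReal_norm_pow, ofReal_norm_pow]
    rw [e1, e2, ← ENNReal.ofReal_mul (by positivity), ← ENNReal.ofReal_mul (by positivity),
      ← ENNReal.ofReal_add (by positivity) (by positivity), ← ofReal_norm]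
    refine ENNReal.ofReal_le_ofReal ?_
    rw [norm_mul]
    have hz : 0 ≤ ‖z‖ ^ 3 := by positivity
    have hp : 0 ≤ ‖p‖ ^ (3 / 2 : ℝ) := by positivity
    have hli : 0 ≤ (l ^ 2)⁻¹ * a ^ 3 := by positivity
    calc _ ≤ D * (h⁻¹ * a * ‖z‖ ^ 2 + 2 * (h⁻¹ * b * ‖p‖)) := by
          refine mul_le_mul hs ((norm_add_le _ _).trans (add_le_add ?_ ?_)) (norm_nonneg _) hD
          · rw [norm_mul, norm_pow, norm_norm]; gcongr
          · rw [norm_mul, norm_mul, Real.norm_two]; gcongr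
      _ = D * h⁻¹ * (a * ‖z‖ ^ 2 + 2 * (b * ‖p‖)) := by ring
      _ ≤ D * h⁻¹ * (2 * (l * ‖z‖ ^ 3 + (l ^ 2)⁻¹ * a ^ 3)
          + 2 * (l * ‖p‖ ^ (3 / 2 : ℝ) + (l ^ 2)⁻¹ * b ^ 3)) := by
          have : 0 ≤ l * ‖z‖ ^ 3 := by positivity
          exact mul_le_mul_of_nonneg_left (by linarith) (by positivity)
      _ = _ := by ring
  · have h0 : fderiv ℝ (collarCutoff Ω h) x = 0 := by
      rcases le_or_gt (2 * h) (Metric.infDist x Ωᶜ) with h1 | h1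
      · exact fderiv_collarCutoff_of_ge hh h1
      · refine fderiv_collarCutoff_of_le hh ?_
        have : x ∉ Ω := fun hxΩ => hx ⟨hxΩ, by linarith⟩
        rw [Metric.infDist_zero_of_mem (show x ∈ Ωᶜ from this)]
        exact hh.le
    rw [h0]; simp

/-- **Energy conservation from bounds near the boundary.** The hypotheses say that in the collar of
width `s` the integrals of `|Z|³` and `|P|^(3/2)` are `O(s)`, and those of the cubed components of `Z`
and `V` along the gradient of the distance `O(s^β)` with `β > 1`. By Young's inequality the flux
through the collar is at most `h⁻¹ (l O(h) + l⁻² O(h^β))` for every weight `l > 0`. -/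
theorem IsWeakTransport.ae_energy_eq_const {Ω : Set E3} {T : ℝ} {Z V : ℝ → E3 → E3}
    {P : ℝ → E3 → ℝ} (h : IsWeakTransport Ω T Z V P) (hT : 0 < T) (hΩ : IsOpen Ω)
    (hΩb : Bornology.IsBounded Ω)
    (hint : ∀ Γ : Set E3, IsOpen Γ → IsCompact (closure Γ) → closure Γ ⊆ Ω →
      ∃ r : ℝ, 1 / 3 < r ∧ ∃ B : ℝ≥0∞, B ≠ (⊤ : ℝ≥0∞) ∧
        IncrementBound T Γ r B Z ∧ IncrementBound T Γ r B V ∧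
        Integrable (fun q : ℝ × E3 => ‖Z q.1 q.2‖ ^ 3)
          ((volume.restrict (Ioo 0 T)).prod (volume.restrict Γ)) ∧
        Integrable (fun q : ℝ × E3 => ‖V q.1 q.2‖ ^ 3)
          ((volume.restrict (Ioo 0 T)).prod (volume.restrict Γ)))
    {σ C β : ℝ} (hσ : 0 < σ) (hC : 0 ≤ C) (hβ : 1 < β)
    (hZ : ∀ s ∈ Ioo 0 σ, ∫⁻ q, ‖Z q.1 q.2‖ₑ ^ 3
      ∂((volume.restrict (Ioo 0 T)).prod (volume.restrict (collar Ω s))) ≤ ENNReal.ofReal (C * s))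
    (hP : ∀ s ∈ Ioo 0 σ, ∫⁻ q, ‖P q.1 q.2‖ₑ ^ (3 / 2 : ℝ)
      ∂((volume.restrict (Ioo 0 T)).prod (volume.restrict (collar Ω s))) ≤ ENNReal.ofReal (C * s))
    (hnV : ∀ s ∈ Ioo 0 σ, ∫⁻ q, ‖fderiv ℝ (fun y => Metric.infDist y Ωᶜ) q.2 (V q.1 q.2)‖ₑ ^ 3
      ∂((volume.restrict (Ioo 0 T)).prod (volume.restrict (collar Ω s)))
        ≤ ENNReal.ofReal (C * s ^ β))
    (hnZ : ∀ s ∈ Ioo 0 σ, ∫⁻ q, ‖fderiv ℝ (fun y => Metric.infDist y Ωᶜ) q.2 (Z q.1 q.2)‖ₑ ^ 3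
      ∂((volume.restrict (Ioo 0 T)).prod (volume.restrict (collar Ω s)))
        ≤ ENNReal.ofReal (C * s ^ β)) :
    ∃ c : ℝ, ∀ᵐ t ∂(volume.restrict (Ioo 0 T)), ∫ x in Ω, ‖Z t x‖ ^ 2 = c := by
  obtain ⟨C₂, hC₂⟩ := h.boundZ
  have hZ2 := integrable_sq_prod_of_bound h.measZ hC₂
  refine ae_eq_const_of_integral_deriv_mul_eq_zero hT hZ2.integral_prod_left fun ψ hψ hψc hψs => ?_
  -- the support of `ψ` lies in a compact interval
  obtain ⟨a, b, ha, hb, hab⟩ : ∃ a b : ℝ, 0 < a ∧ b < T ∧ tsupport ψ ⊆ Icc a b := by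
    rcases (tsupport ψ).eq_empty_or_nonempty with he | hne
    · exact ⟨T / 2, T / 2, by linarith, by linarith, by simp [he]⟩
    · have hK : IsCompact (tsupport ψ) := hψc
      exact ⟨sInf (tsupport ψ), sSup (tsupport ψ), (hψs (hK.sInf_mem hne)).1,
        (hψs (hK.sSup_mem hne)).2, fun t ht => ⟨csInf_le hK.bddBelow ht, le_csSup hK.bddAbove ht⟩⟩
  have hsub : Icc a b ⊆ Ioo 0 T := fun t ht => ⟨ha.trans_le ht.1, ht.2.trans_lt hb⟩
  obtain ⟨D, hD⟩ := hψ.continuous.bounded_above_of_compact_support hψc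
  obtain ⟨D', hD'⟩ := (hψ.continuous_deriv (by simp)).bounded_above_of_compact_support hψc.deriv
  have hD0 : 0 ≤ D := (norm_nonneg _).trans (hD 0)
  set ν : Measure (ℝ × E3) := (volume.restrict (Ioo 0 T)).prod (volume.restrict Ω) with hν
  set e : ℕ → ℝ := fun n => ((n : ℝ) + 1)⁻¹ with he
  have hepos : ∀ n, 0 < e n := fun n => by positivity
  have he0 : Tendsto e atTop (nhds 0) := by
    simpa [he] using tendsto_one_div_add_atTop_nhds_zero_nat (𝕜 := ℝ)
  -- the localized energies converge
  have hψ'm : StronglyMeasurable (fun q : ℝ × E3 => deriv ψ q.1) :=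
    ((hψ.continuous_deriv (by simp)).comp continuous_fst).stronglyMeasurable
  have hlim : Tendsto (fun n => ∫ q, deriv ψ q.1 * (collarCutoff Ω (e n) q.2 * ‖Z q.1 q.2‖ ^ 2) ∂ν)
      atTop (nhds (∫ q, deriv ψ q.1 * ‖Z q.1 q.2‖ ^ 2 ∂ν)) := by
    refine tendsto_integral_of_dominated_convergence (fun q => D' * ‖Z q.1 q.2‖ ^ 2)
      (fun n => ?_) (hZ2.const_mul D') (fun n => Eventually.of_forall fun q => ?_) ?_
    · exact (hψ'm.mul ((((lipschitzWith_collarCutoff (Ω := Ω) (hepos n)).continuous.comp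
        continuous_snd).stronglyMeasurable).mul (h.measZ.norm.pow 2))).aestronglyMeasurable
    · rw [norm_mul, norm_mul, norm_pow, norm_norm]
      calc _ ≤ D' * (1 * ‖Z q.1 q.2‖ ^ 2) := by
            gcongr
            · exact (norm_nonneg _).trans (hD' 0)
            · exact hD' _
            · exact abs_collarCutoff_le_one _
        _ = _ := by ring
    · have : ∀ᵐ x ∂(volume.restrict Ω), x ∈ Ω := ae_restrict_mem hΩ.measurableSet
      filter_upwards [Measure.quasiMeasurePreserving_snd.ae this] with q hq
      have hdpos := infDist_compl_pos hΩ hΩb hq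
      refine tendsto_const_nhds.congr' ?_
      filter_upwards [he0.eventually (gt_mem_nhds (half_pos hdpos))] with n hn
      rw [collarCutoff_eq_one (hepos n) (by linarith), one_mul]
  -- the flux through the collars is controlled; the weight `l = h^κ` with `4κ = β - 1` makes its two
  -- terms `O(h^κ)` and `O(h^(β - 1 - 2κ)) = O(h^(2κ))`
  set κ := (β - 1) / 4 with hκ
  have hκ0 : 0 < κ := by rw [hκ]; linarith
  have hle : ∀ᶠ n in atTop,
      ‖∫ q, deriv ψ q.1 * (collarCutoff Ω (e n) q.2 * ‖Z q.1 q.2‖ ^ 2) ∂ν‖ₑ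
        ≤ ENNReal.ofReal (12 * D * C * e n ^ κ) * 1
          + ENNReal.ofReal (4 * D * C * 3 ^ β * e n ^ (2 * κ)) * 1 := by
    filter_upwards [he0.eventually (gt_mem_nhds (show 0 < σ / 3 by positivity))] with n hn
    set s := e n with hs
    have hspos : 0 < s := hepos n
    have h3s : 3 * s ∈ Ioo 0 σ := ⟨by positivity, by linarith⟩
    set Γ : Set E3 := {x | s / 4 < Metric.infDist x Ωᶜ} with hΓ
    have hΓo : IsOpen Γ := isOpen_lt continuous_const (Metric.continuous_infDist_pt _)
    have hcl : closure Γ ⊆ {x | s / 4 ≤ Metric.infDist x Ωᶜ} :=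
      closure_minimal (fun x hx => show s / 4 ≤ Metric.infDist x Ωᶜ from le_of_lt hx)
        (isClosed_le continuous_const (Metric.continuous_infDist_pt _))
    have hΓc : IsCompact (closure Γ) :=
      (isCompact_setOf_le_infDist_compl hΩb (by positivity)).of_isClosed_subset isClosed_closure hcl
    have hΓΩ : closure Γ ⊆ Ω := hcl.trans (setOf_le_infDist_compl_subset (by positivity))
    have hΓΩ' : Γ ⊆ Ω := subset_closure.trans hΓΩ
    obtain ⟨r, hr, B, hB, hBZ, hBV, iZ, iV⟩ := hint Γ hΓo hΓc hΓΩ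
    set S := collar Ω (3 * s) with hS
    have hSm : MeasurableSet S := measurableSet_collar hΩ.measurableSet _
    have hmono : ((volume.restrict (Icc a b)).prod (volume.restrict Γ) : Measure (ℝ × E3))
        ≤ (volume.restrict (Ioo 0 T)).prod (volume.restrict Γ) := by
      rw [Measure.prod_restrict, Measure.prod_restrict]
      exact Measure.restrict_mono (prod_mono_left hsub) le_rfl
    -- the cutoff is constant off the collar `S`, so that integrals of the flux reduce to it
    have hind : ∀ G : ℝ × E3 → ℝ≥0∞, Measurable G →
        ∫⁻ q, (Prod.snd ⁻¹' S).indicator G q ∂((volume.restrict (Icc a b)).prod (volume.restrict Γ))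
          ≤ ∫⁻ q, G q ∂((volume.restrict (Ioo 0 T)).prod (volume.restrict S)) := by
      intro G hG
      rw [lintegral_indicator (hSm.preimage measurable_snd)]
      refine lintegral_mono' ?_ le_rfl
      rw [Measure.prod_restrict, Measure.prod_restrict,
        Measure.restrict_restrict (hSm.preimage measurable_snd)]
      have hst : Prod.snd ⁻¹' S ∩ Icc a b ×ˢ Γ ⊆ Ioo 0 T ×ˢ S := fun q hq => ⟨hsub hq.2.1, hq.1⟩
      exact Measure.restrict_mono hst le_rfl
    have iP : Integrable (fun q : ℝ × E3 => ‖S.indicator (P q.1) q.2‖ ^ (3 / 2 : ℝ))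
        ((volume.restrict (Icc a b)).prod (volume.restrict Γ)) := by
      have hm : StronglyMeasurable (fun q : ℝ × E3 => S.indicator (P q.1) q.2) := by
        have : (fun q : ℝ × E3 => S.indicator (P q.1) q.2)
            = (Prod.snd ⁻¹' S).indicator (fun q : ℝ × E3 => P q.1 q.2) := rfl
        rw [this]
        exact h.measP.indicator (hSm.preimage measurable_snd)
      refine ⟨(hm.norm.measurable.pow_const _).aestronglyMeasurable, ?_⟩
      refine lt_of_le_of_lt (lintegral_mono fun q => ?_)
        (((hind _ (h.measP.enorm.pow_const (3 / 2 : ℝ))).trans (hP _ h3s)).trans_lt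
          ENNReal.ofReal_lt_top)
      beta_reduce
      by_cases hq : q.2 ∈ S
      · rw [indicator_of_mem hq, indicator_of_mem (show q ∈ Prod.snd ⁻¹' S from hq),
          ← ofReal_norm_rpow _ (by norm_num), Real.enorm_of_nonneg (by positivity)]
      · rw [indicator_of_notMem hq]
        simp [Real.zero_rpow]
    have hbal := h.local_balance hT (isLipCutoff_collarCutoff hΩb hspos) hΩ.measurableSet
      hΓo.measurableSet hΓc hΓΩ (ε₀ := s / 4) (by positivity) (fun x hx y hy => by
        have h1 : s ≤ Metric.infDist x Ωᶜ := tsupport_collarCutoff_subset hspos hx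
        have h2 := Metric.infDist_le_infDist_add_dist (s := Ωᶜ) (x := x) (y := y)
        rw [Metric.mem_closedBall, dist_comm] at hy
        change s / 4 < Metric.infDist y Ωᶜ
        linarith) hψ hψc ha hb hab hSm (fun y hy x hx => by
        have h1 := Metric.infDist_le_infDist_add_dist (s := Ωᶜ) (x := x) (y := y)
        have h2 := Metric.infDist_le_infDist_add_dist (s := Ωᶜ) (x := y) (y := x)
        rw [dist_comm y x, dist_eq_norm] at h2
        rw [dist_eq_norm] at h1
        by_cases hyΩ : y ∈ Ω
        · have : 3 * s ≤ Metric.infDist y Ωᶜ := by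
            by_contra hc
            exact hy ⟨hyΩ, not_le.1 hc⟩
          exact fderiv_collarCutoff_of_ge hspos (by linarith)
        · rw [Metric.infDist_zero_of_mem (show y ∈ Ωᶜ from hyΩ)] at h1
          exact fderiv_collarCutoff_of_le hspos (by linarith)) hr hB hBZ hBV
      (iZ.mono_measure hmono) (iV.mono_measure hmono) iP
    set A : ℝ × E3 → ℝ := fun q => deriv ψ q.1 * (collarCutoff Ω s q.2 * ‖Z q.1 q.2‖ ^ 2) with hA
    set F : ℝ × E3 → ℝ := fun q => ψ q.1 *
      (fderiv ℝ (collarCutoff Ω s) q.2 (V q.1 q.2) * ‖Z q.1 q.2‖ ^ 2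
        + 2 * (fderiv ℝ (collarCutoff Ω s) q.2 (Z q.1 q.2) * S.indicator (P q.1) q.2)) with hF
    set l := s ^ κ with hl
    have hlpos : 0 < l := Real.rpow_pos_of_pos hspos κ
    have mN : StronglyMeasurable (fun q : ℝ × E3 =>
        fderiv ℝ (fun y : E3 => Metric.infDist y Ωᶜ) q.2) :=
      (measurable_fderiv ℝ (fun y : E3 => Metric.infDist y Ωᶜ)).stronglyMeasurable.comp_measurable
        measurable_snd
    have mNV := (stronglyMeasurable_fderiv_apply mN h.measV).enorm.pow_const 3
    have mNZ := (stronglyMeasurable_fderiv_apply mN h.measZ).enorm.pow_const 3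
    have mZ := h.measZ.enorm.pow_const 3
    have mP := h.measP.enorm.pow_const (3 / 2 : ℝ)
    set G : ℝ × E3 → ℝ≥0∞ := fun q =>
      ENNReal.ofReal (2 * D * s⁻¹ * l) * (‖Z q.1 q.2‖ₑ ^ 3 + ‖P q.1 q.2‖ₑ ^ (3 / 2 : ℝ))
        + ENNReal.ofReal (2 * D * s⁻¹ * (l ^ 2)⁻¹) *
          (‖fderiv ℝ (fun y => Metric.infDist y Ωᶜ) q.2 (V q.1 q.2)‖ₑ ^ 3
            + ‖fderiv ℝ (fun y => Metric.infDist y Ωᶜ) q.2 (Z q.1 q.2)‖ₑ ^ 3) with hG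
    have mZP : Measurable (fun q : ℝ × E3 => ‖Z q.1 q.2‖ₑ ^ 3 + ‖P q.1 q.2‖ₑ ^ (3 / 2 : ℝ)) :=
      mZ.add mP
    have mNN : Measurable (fun q : ℝ × E3 =>
        ‖fderiv ℝ (fun y => Metric.infDist y Ωᶜ) q.2 (V q.1 q.2)‖ₑ ^ 3
          + ‖fderiv ℝ (fun y => Metric.infDist y Ωᶜ) q.2 (Z q.1 q.2)‖ₑ ^ 3) := mNV.add mNZ
    have mG1 : Measurable (fun q : ℝ × E3 => ENNReal.ofReal (2 * D * s⁻¹ * l) *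
        (‖Z q.1 q.2‖ₑ ^ 3 + ‖P q.1 q.2‖ₑ ^ (3 / 2 : ℝ))) := (mZ.add mP).const_mul _
    have mG : Measurable G := mG1.add ((mNV.add mNZ).const_mul _)
    have hFG : ∀ q, ‖F q‖ₑ ≤ (Prod.snd ⁻¹' S).indicator G q := fun q =>
      enorm_collar_flux_le hspos hlpos hD0 (hD q.1) q.2
    have hFint : ∫⁻ q, ‖F q‖ₑ ∂((volume.restrict (Icc a b)).prod (volume.restrict Γ))
        ≤ ENNReal.ofReal (12 * D * C * s ^ κ) * 1
          + ENNReal.ofReal (4 * D * C * 3 ^ β * s ^ (2 * κ)) * 1 := by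
      refine ((lintegral_mono hFG).trans (hind G mG)).trans ?_
      rw [hG, lintegral_add_left mG1, lintegral_const_mul _ mZP,
        lintegral_const_mul _ mNN, lintegral_add_left mZ, lintegral_add_left mNV]
      refine (add_le_add (mul_le_mul_right (add_le_add (hZ _ h3s) (hP _ h3s)) _)
        (mul_le_mul_right (add_le_add (hnV _ h3s) (hnZ _ h3s)) _)).trans (le_of_eq ?_)
      have hCs : 0 ≤ C * (3 * s) ^ β := by positivity
      rw [← ENNReal.ofReal_add (by positivity) (by positivity), ← ENNReal.ofReal_add hCs hCs,
        ← ENNReal.ofReal_mul (by positivity), ← ENNReal.ofReal_mul (by positivity), mul_one,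
        mul_one]
      congr 2
      · field_simp; ring
      · have e1 : s ^ β = s * l ^ 2 * s ^ (2 * κ) := by
          rw [hl, ← Real.rpow_natCast, ← Real.rpow_mul hspos.le]
          nth_rw 2 [← Real.rpow_one s]
          rw [← Real.rpow_add hspos, ← Real.rpow_add hspos]
          congr 1; rw [hκ]; push_cast; ring
        rw [Real.mul_rpow zero_le_three hspos.le, e1]
        field_simp; ring
    have hFm : AEStronglyMeasurable F ((volume.restrict (Icc a b)).prod (volume.restrict Γ)) := by
      have m1 : StronglyMeasurable (fun q : ℝ × E3 => fderiv ℝ (collarCutoff Ω s) q.2) :=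
        (measurable_fderiv ℝ (collarCutoff Ω s)).stronglyMeasurable.comp_measurable measurable_snd
      have m2 : StronglyMeasurable (fun q : ℝ × E3 => S.indicator (P q.1) q.2) := by
        have : (fun q : ℝ × E3 => S.indicator (P q.1) q.2)
            = (Prod.snd ⁻¹' S).indicator (fun q : ℝ × E3 => P q.1 q.2) := rfl
        rw [this]
        exact h.measP.indicator (hSm.preimage measurable_snd)
      have m3 : StronglyMeasurable (fun q : ℝ × E3 => ψ q.1) :=
        (hψ.continuous.comp continuous_fst).stronglyMeasurable
      exact (m3.mul (((stronglyMeasurable_fderiv_apply m1 h.measV).mul (h.measZ.norm.pow 2)).add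
        (((stronglyMeasurable_fderiv_apply m1 h.measZ).mul m2).const_mul 2))).aestronglyMeasurable
    have iF : Integrable F ((volume.restrict (Icc a b)).prod (volume.restrict Γ)) :=
      ⟨hFm, hFint.trans_lt (by finiteness)⟩
    have iA : Integrable A ((volume.restrict (Icc a b)).prod (volume.restrict Γ)) := by
      have i2 : Integrable (fun q : ℝ × E3 => ‖Z q.1 q.2‖ ^ 2)
          ((volume.restrict (Icc a b)).prod (volume.restrict Γ)) := by
        refine hZ2.mono_measure ?_
        rw [hν, Measure.prod_restrict, Measure.prod_restrict]
        exact Measure.restrict_mono (prod_mono hsub hΓΩ') le_rfl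
      exact (i2.bdd_mul ((lipschitzWith_collarCutoff (Ω := Ω) hspos).continuous.comp
        continuous_snd).aestronglyMeasurable
        (Eventually.of_forall fun q => abs_collarCutoff_le_one q.2)).bdd_mul
        hψ'm.aestronglyMeasurable (Eventually.of_forall fun q => hD' _)
    have hAF : ∫ q, A q ∂((volume.restrict (Icc a b)).prod (volume.restrict Γ))
        = - ∫ q, F q ∂((volume.restrict (Icc a b)).prod (volume.restrict Γ)) := by
      have := hbal
      change ∫ q, (A q + F q) ∂((volume.restrict (Icc a b)).prod (volume.restrict Γ)) = 0 at this
      rw [integral_add iA iF] at this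
      linarith
    have hAν : ∫ q, A q ∂ν = ∫ q, A q ∂((volume.restrict (Icc a b)).prod (volume.restrict Γ)) := by
      rw [hν, Measure.prod_restrict, Measure.prod_restrict]
      refine setIntegral_eq_of_subset_of_forall_sdiff_eq_zero
        (measurableSet_Ioo.prod hΩ.measurableSet) (prod_mono hsub hΓΩ') fun q hq => ?_
      by_cases h1 : q.1 ∈ Icc a b
      · have h2 : q.2 ∉ Γ := fun h2 => hq.2 ⟨h1, h2⟩
        have h3 : Metric.infDist q.2 Ωᶜ ≤ s / 4 := not_lt.1 h2
        rw [hA]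
        simp only [collarCutoff_eq_zero hspos (show Metric.infDist q.2 Ωᶜ ≤ s by linarith)]
        ring
      · have h2 : deriv ψ q.1 = 0 := by
          by_contra hc
          exact h1 (hab (tsupport_deriv_subset (subset_closure (Function.mem_support.2 hc))))
        rw [hA]
        simp only [h2, zero_mul]
    rw [hAν, hAF, enorm_neg]
    exact (enorm_integral_le_lintegral_enorm _).trans hFint
  have hz : Tendsto (fun n => ENNReal.ofReal (12 * D * C * e n ^ κ) * 1
          + ENNReal.ofReal (4 * D * C * 3 ^ β * e n ^ (2 * κ)) * 1) atTop (nhds 0) := by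
    simpa using (tendsto_ofReal_rpow_mul (C := 12 * D * C) hκ0 ENNReal.one_ne_top).add
      (tendsto_ofReal_rpow_mul (C := 4 * D * C * 3 ^ β) (s := 2 * κ) (by positivity)
        ENNReal.one_ne_top)
  have h0 : ∫ q, deriv ψ q.1 * ‖Z q.1 q.2‖ ^ 2 ∂ν = 0 := enorm_eq_zero.1
    (tendsto_nhds_unique hlim.enorm (tendsto_of_tendsto_of_tendsto_of_le_of_le'
      tendsto_const_nhds hz (Eventually.of_forall fun n => zero_le) hle))
  have hi : Integrable (fun q : ℝ × E3 => deriv ψ q.1 * ‖Z q.1 q.2‖ ^ 2) ν :=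
    hZ2.bdd_mul hψ'm.aestronglyMeasurable (Eventually.of_forall fun q => hD' _)
  rw [hν, integral_prod _ hi] at h0
  simpa only [integral_const_mul] using h0

/-! ### The distance to the boundary of a `C²` domain -/

theorem exists_mem_frontier_dist_eq {Ω : Set E3} (hΩ : IsOpen Ω) (hΩb : Bornology.IsBounded Ω)
    {x : E3} (hx : x ∈ Ω) : ∃ y ∈ frontier Ω, Metric.infDist x Ωᶜ = dist x y := by
  refine exists_mem_frontier_infDist_compl_eq_dist hx ?_
  rintro rfl
  exact NormedSpace.unbounded_univ ℝ E3 hΩb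

theorem bdryDist_eq_infDist_compl {Ω : Set E3} (hΩ : IsOpen Ω) (hΩb : Bornology.IsBounded Ω)
    {x : E3} (hx : x ∈ Ω) : bdryDist Ω x = Metric.infDist x Ωᶜ := by
  obtain ⟨y, hy, hxy⟩ := exists_mem_frontier_dist_eq hΩ hΩb hx
  refine le_antisymm ?_ ?_
  · rw [hxy]; exact Metric.infDist_le_dist_of_mem hy
  · refine Metric.infDist_le_infDist_of_subset (fun z hz hzΩ => ?_) ⟨y, hy⟩
    exact hz.2 (by rwa [hΩ.interior_eq])

theorem bdryLayer_eq_collar {Ω : Set E3} (hΩ : IsOpen Ω) (hΩb : Bornology.IsBounded Ω) (s : ℝ) :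
    bdryLayer Ω s = collar Ω s := by
  ext x
  simp only [bdryLayer, collar, mem_ofPred_eq]
  refine and_congr_right fun hx => ?_
  rw [bdryDist_eq_infDist_compl hΩ hΩb hx]

theorem nearestBdryPoint_spec {Ω : Set E3} (hΩ : IsOpen Ω) (hΩb : Bornology.IsBounded Ω)
    {x : E3} (hx : x ∈ Ω) : nearestBdryPoint Ω x ∈ frontier Ω ∧
      dist x (nearestBdryPoint Ω x) = Metric.infDist x Ωᶜ := by
  rw [← bdryDist_eq_infDist_compl hΩ hΩb hx]
  obtain ⟨y, hy, hxy⟩ := exists_mem_frontier_dist_eq hΩ hΩb hx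
  rw [← bdryDist_eq_infDist_compl hΩ hΩb hx] at hxy
  exact Classical.epsilon_spec (p := fun y => y ∈ frontier Ω ∧ dist x y = bdryDist Ω x)
    ⟨y, hy, hxy.symm⟩

theorem IsLocalDefiningFunction.contDiffAt {Ω U : Set E3} {ρ : E3 → ℝ}
    (h : IsLocalDefiningFunction Ω U ρ) {p : E3} (hp : p ∈ U) : ContDiffAt ℝ 2 ρ p :=
  h.contDiffOn.contDiffAt (h.isOpen.mem_nhds hp)

theorem IsLocalDefiningFunction.eq_zero {Ω U : Set E3} {ρ : E3 → ℝ} (hΩ : IsOpen Ω)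
    (h : IsLocalDefiningFunction Ω U ρ) {p : E3} (hp : p ∈ U) (hpf : p ∈ frontier Ω) :
    ρ p = 0 := by
  have hc := (h.contDiffAt hp).continuousAt
  refine le_antisymm ?_ ?_
  · by_contra! hpos
    have hev := (hc.eventually (lt_mem_nhds hpos)).and (h.isOpen.mem_nhds hp)
    obtain ⟨y, ⟨hy1, hy2⟩, hyΩ⟩ := mem_closure_iff_nhds.1 (frontier_subset_closure hpf) _ hev
    have : y ∈ {x ∈ U | ρ x < 0} := h.inter_eq ▸ ⟨hyΩ, hy2⟩
    exact absurd this.2 (not_lt.2 (le_of_lt hy1))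
  · by_contra! hneg
    have : p ∈ Ω ∩ U := by rw [h.inter_eq]; exact ⟨hp, hneg⟩
    exact hpf.2 (by rw [hΩ.interior_eq]; exact this.1)

/-- At a boundary point touched by an interior ball, the gradient of a defining function points
away from the center of the ball. -/
theorem IsLocalDefiningFunction.gradient_eq {Ω U : Set E3} {ρ : E3 → ℝ} (hΩ : IsOpen Ω)
    (h : IsLocalDefiningFunction Ω U ρ) {x m : E3} (hm : m ∈ U) (hmf : m ∈ frontier Ω)
    (hball : Metric.ball x (dist x m) ⊆ Ω) (hxm : x ≠ m) :
    ∃ s < (0 : ℝ), gradient ρ m = s • (x - m) := by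
  set g := gradient ρ m with hg
  set v := x - m with hv
  have hv0 : v ≠ 0 := sub_ne_zero.2 hxm
  have hvpos : 0 < ‖v‖ ^ 2 := by positivity
  have hd : DifferentiableAt ℝ ρ m := (h.contDiffAt hm).differentiableAt (by simp)
  have key : ∀ w : E3, 0 < inner ℝ w v → inner ℝ g w ≤ 0 := by
    intro w hw
    have hder : HasDerivAt (fun t : ℝ => ρ (m + t • w)) (inner ℝ g w) 0 := by
      have h1 : HasFDerivAt ρ (fderiv ℝ ρ m) (m + (0 : ℝ) • w) := by simpa using hd.hasFDerivAt
      have h2 : HasDerivAt (fun t : ℝ => m + t • w) w 0 := by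
        simpa using ((hasDerivAt_id (0 : ℝ)).smul_const w).const_add m
      have h3 := h1.comp_hasDerivAt (0 : ℝ) h2
      rwa [← inner_gradient_left] at h3
    have hlim := hder.tendsto_slope_zero_right
    refine le_of_tendsto hlim ?_
    have hU : ∀ᶠ t : ℝ in nhds 0, m + t • w ∈ U := by
      have : Continuous fun t : ℝ => m + t • w := by fun_prop
      exact this.continuousAt.eventually_mem (by simpa using h.isOpen.mem_nhds hm)
    have hsmall : ∀ᶠ t : ℝ in nhds 0, t * ‖w‖ ^ 2 < 2 * inner ℝ w v := by
      have : Continuous fun t : ℝ => t * ‖w‖ ^ 2 := by fun_prop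
      exact this.continuousAt.eventually (gt_mem_nhds (by simpa using hw))
    filter_upwards [self_mem_nhdsWithin, nhdsWithin_le_nhds hU, nhdsWithin_le_nhds hsmall]
      with t ht htU hts
    have ht0 : (0 : ℝ) < t := ht
    have hin : m + t • w ∈ Metric.ball x (dist x m) := by
      rw [Metric.mem_ball, dist_eq_norm, dist_eq_norm, ← hv]
      have e : m + t • w - x = t • w - v := by rw [hv]; abel
      rw [e]
      refine lt_of_pow_lt_pow_left₀ 2 (norm_nonneg _) ?_
      rw [norm_sub_sq_real, inner_smul_left, norm_smul, mul_pow, Real.norm_of_nonneg ht0.le]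
      simp only [conj_trivial]
      nlinarith
    have hneg : ρ (m + t • w) < 0 := by
      have : m + t • w ∈ {x ∈ U | ρ x < 0} := h.inter_eq ▸ ⟨hball hin, htU⟩
      exact this.2
    simp only [zero_add, zero_smul, add_zero, h.eq_zero hΩ hm hmf, sub_zero, smul_eq_mul]
    exact mul_nonpos_of_nonneg_of_nonpos (inv_nonneg.2 ht0.le) hneg.le
  have hgv : inner ℝ g v ≤ 0 := key v (by rw [real_inner_self_eq_norm_sq]; exact hvpos)
  set s := inner ℝ g v / ‖v‖ ^ 2 with hs
  set w := g - s • v with hw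
  have hwv : inner ℝ w v = 0 := by
    rw [hw, inner_sub_left, inner_smul_left, real_inner_self_eq_norm_sq, hs]
    simp only [conj_trivial]
    field_simp; ring
  have hgw : inner ℝ g w = ‖w‖ ^ 2 := by
    have : g = w + s • v := by rw [hw]; abel
    rw [← real_inner_self_eq_norm_sq]
    nth_rw 1 [this]
    rw [inner_add_left, inner_smul_left, real_inner_comm, real_inner_comm w v, hwv]
    simp
  have hw0 : ‖w‖ ^ 2 ≤ 0 := by
    refine le_of_forall_pos_le_add fun δ hδ => ?_
    -- `w` is tangent to the sphere; tilted slightly towards the center it points into the ball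
    set η := δ / (1 + |inner ℝ g v|) with hη
    have hη0 : 0 < η := by positivity
    have := key (w + η • v) (by
      rw [inner_add_left, hwv, inner_smul_left, real_inner_self_eq_norm_sq]
      simp only [conj_trivial, zero_add]; positivity)
    rw [inner_add_right, hgw, inner_smul_right] at this
    have h1 : η * |inner ℝ g v| ≤ δ := by
      rw [hη, div_mul_eq_mul_div, div_le_iff₀ (by positivity)]
      nlinarith [abs_nonneg (inner ℝ g v)]
    have h2 := mul_le_mul_of_nonneg_left (neg_abs_le (inner ℝ g v)) hη0.le
    linarith
  have hwz : w = 0 := by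
    have : ‖w‖ = 0 := by nlinarith [norm_nonneg w]
    exact norm_eq_zero.1 this
  have hgs : g = s • v := sub_eq_zero.1 hwz
  refine ⟨s, lt_of_le_of_ne (div_nonpos_of_nonpos_of_nonneg hgv hvpos.le) fun h0 => ?_, hgs⟩
  exact h.gradient_ne_zero m hm (by rw [← hg, hgs, h0, zero_smul])

/-- The ball around `x` of radius `d(x)` touches the boundary from inside at the nearest point, so
that the normal there points from `x` to the nearest point. -/
theorem outwardNormal_nearestBdryPoint {Ω : Set E3} (hΩ : IsBoundedC2Domain Ω) {x : E3}
    (hx : x ∈ Ω) : outwardNormal Ω (nearestBdryPoint Ω x)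
      = (Metric.infDist x Ωᶜ)⁻¹ • (nearestBdryPoint Ω x - x) := by
  obtain ⟨hmf, hdist⟩ := nearestBdryPoint_spec hΩ.isOpen hΩ.isBounded hx
  set m := nearestBdryPoint Ω x with hm
  have hpos := infDist_compl_pos hΩ.isOpen hΩ.isBounded hx
  have hxm : x ≠ m := by rw [← dist_pos, hdist]; exact hpos
  have hball : Metric.ball x (dist x m) ⊆ Ω := by
    rw [hdist]; intro y hy
    by_contra hc
    have := Metric.infDist_le_dist_of_mem (x := x) (show y ∈ Ωᶜ from hc)
    rw [Metric.mem_ball, dist_comm] at hy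
    linarith
  have hex : ∃ ν, IsOutwardUnitNormal Ω m ν := by
    obtain ⟨U, ρ, hmU, hρ⟩ := hΩ.boundary m hmf
    have hg := hρ.gradient_ne_zero m hmU
    refine ⟨‖gradient ρ m‖⁻¹ • gradient ρ m, ?_, U, ρ, hmU, hρ, ?_⟩
    · rw [norm_smul, norm_inv, norm_norm, inv_mul_cancel₀ (norm_ne_zero_iff.2 hg)]
    · rw [smul_smul, mul_inv_cancel₀ (norm_ne_zero_iff.2 hg), one_smul]
  obtain ⟨-, U, ρ, hmU, hρ, hgrad⟩ : IsOutwardUnitNormal Ω m (outwardNormal Ω m) :=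
    Classical.epsilon_spec hex
  obtain ⟨s, hs, hgs⟩ := hρ.gradient_eq hΩ.isOpen hmU hmf hball hxm
  rw [hgs, norm_smul, Real.norm_of_nonpos hs.le, ← dist_eq_norm, hdist] at hgrad
  have hne : -s * Metric.infDist x Ωᶜ ≠ 0 := by
    have : 0 < -s * Metric.infDist x Ωᶜ := mul_pos (by linarith) hpos
    exact this.ne'
  have : outwardNormal Ω m = (-s * Metric.infDist x Ωᶜ)⁻¹ • s • (x - m) := by
    rw [hgrad, smul_smul, inv_mul_cancel₀ hne, one_smul]
  rw [this, smul_smul, ← neg_sub m x, smul_neg, ← neg_smul]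
  congr 1
  have := hpos.ne'
  have := hs.ne
  field_simp

/-- The gradient of the distance to the boundary is minus the outward normal at the nearest
boundary point `m`: the function `|y - m|² - d(y)²` is nonnegative and vanishes at `x`, so its
derivative there is zero. -/
theorem fderiv_infDist_compl {Ω : Set E3} (hΩ : IsBoundedC2Domain Ω) {x : E3} (hx : x ∈ Ω)
    (hd : DifferentiableAt ℝ (fun y => Metric.infDist y Ωᶜ) x) (w : E3) :
    fderiv ℝ (fun y => Metric.infDist y Ωᶜ) x w
      = - inner ℝ w (outwardNormal Ω (nearestBdryPoint Ω x)) := by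
  rw [outwardNormal_nearestBdryPoint hΩ hx]
  obtain ⟨hmf, hdist⟩ := nearestBdryPoint_spec hΩ.isOpen hΩ.isBounded hx
  set m := nearestBdryPoint Ω x with hm
  have hpos := infDist_compl_pos hΩ.isOpen hΩ.isBounded hx
  have hmΩ : m ∈ Ωᶜ := fun hc => hmf.2 (by rwa [hΩ.isOpen.interior_eq])
  have hmin : IsLocalMin (fun y => ‖y - m‖ ^ 2 - Metric.infDist y Ωᶜ ^ 2) x := by
    refine Eventually.of_forall fun y => ?_
    have h1 : Metric.infDist y Ωᶜ ≤ ‖y - m‖ := by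
      rw [← dist_eq_norm]; exact Metric.infDist_le_dist_of_mem hmΩ
    have h2 : ‖x - m‖ = Metric.infDist x Ωᶜ := by rw [← dist_eq_norm]; exact hdist
    have h3 := pow_le_pow_left₀ Metric.infDist_nonneg h1 2
    simp only [h2, sub_self]
    linarith
  have h1 : HasFDerivAt (fun y : E3 => ‖y - m‖ ^ 2)
      (2 • (innerSL ℝ (x - m)).comp (ContinuousLinearMap.id ℝ E3)) x :=
    ((hasFDerivAt_id x).sub_const m).norm_sq
  have h2 := hd.hasFDerivAt.pow 2
  have h3 := hmin.hasFDerivAt_eq_zero (h1.sub h2)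
  have h4 := congrArg (fun l : E3 →L[ℝ] ℝ => l w) h3
  simp at h4
  rw [inner_smul_right, inner_sub_right, real_inner_comm, real_inner_comm x]
  field_simp
  linarith

/-! ### The volume of the boundary layer -/

/-- Near a point where a defining function is strictly differentiable, the zero set has
`s`-neighbourhoods of volume `O(s)`: a line in the direction of the gradient meets such a
neighbourhood in a set of length at most `6s`. -/
theorem exists_volume_thickening_le {ρ : E3 → ℝ} {p : E3} (hρ : ContDiffAt ℝ 2 ρ p)
    (hg : gradient ρ p ≠ 0) : ∃ r > 0, ∃ C : ℝ, 0 ≤ C ∧ ∀ A ⊆ Metric.ball p r, (∀ x ∈ A, ρ x = 0) →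
      ∀ s, 0 < s → s ≤ r → volume (Metric.thickening s A) ≤ ENNReal.ofReal (C * s) := by
  set g := gradient ρ p with hgdef
  set c := ‖g‖ with hc
  have hcpos : 0 < c := norm_pos_iff.2 hg
  set e := c⁻¹ • g with he
  have hge : inner ℝ g e = c := by
    rw [he, inner_smul_right, real_inner_self_eq_norm_sq, ← hc]; field_simp
  have hen : ‖e‖ = 1 := by
    rw [he, norm_smul, norm_inv, hc, norm_norm, inv_mul_cancel₀ hcpos.ne']
  have hstrict : HasStrictFDerivAt ρ (fderiv ℝ ρ p) p := hρ.hasStrictFDerivAt (by simp)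
  have hev := hstrict.isLittleO.def (half_pos hcpos)
  rw [nhds_prod_eq, ← nhds_prod_eq, Metric.eventually_nhds_iff_ball] at hev
  obtain ⟨R, hR, hball⟩ := hev
  have hap : ∀ x ∈ Metric.ball p R, ∀ y ∈ Metric.ball p R,
      |ρ x - ρ y - inner ℝ g (x - y)| ≤ c / 2 * ‖x - y‖ := by
    intro x hx y hy
    have := hball (x, y) (by rw [← ball_prod_same]; exact ⟨hx, hy⟩)
    rwa [← inner_gradient_left, Real.norm_eq_abs] at this
  set r := R / 4 with hr
  have hrpos : 0 < r := by positivity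
  set M := (volume (Metric.ball p R)).toReal with hM
  refine ⟨r, hrpos, M * 6 / (2 * r), by positivity, fun A hA hA0 s hs hsr => ?_⟩
  set S := Metric.thickening s A with hS
  have hSo : IsOpen S := Metric.isOpen_thickening
  have hSball : ∀ x ∈ S, x ∈ Metric.ball p (2 * r) := by
    intro x hx
    obtain ⟨z, hz, hxz⟩ := Metric.mem_thickening_iff.1 hx
    have h1 := hA hz
    rw [Metric.mem_ball] at h1 ⊢
    linarith [dist_triangle x z p]
  have hSρ : ∀ x ∈ S, |ρ x| ≤ 3 / 2 * c * s := by
    intro x hx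
    obtain ⟨z, hz, hxz⟩ := Metric.mem_thickening_iff.1 hx
    have h1 := hap x (Metric.ball_subset_ball (by linarith) (hSball x hx)) z
      (Metric.ball_subset_ball (by linarith) (hA hz))
    rw [hA0 z hz, sub_zero] at h1
    rw [dist_eq_norm] at hxz
    have h2 := abs_real_inner_le_norm g (x - z)
    rw [← hc] at h2
    have h3 : |ρ x| ≤ |ρ x - inner ℝ g (x - z)| + |inner ℝ g (x - z)| := by
      simpa using abs_add_le (ρ x - inner ℝ g (x - z)) (inner ℝ g (x - z))
    nlinarith
  -- each line in the direction `e` meets the neighbourhood in a short set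
  have hline : ∀ x : E3, volume {t : ℝ | x - t • e ∈ S} ≤ ENNReal.ofReal (6 * s) := by
    intro x
    refine (Real.volume_le_diam _).trans (Metric.ediam_le fun t ht t' ht' => ?_)
    rw [edist_dist]
    refine ENNReal.ofReal_le_ofReal ?_
    have h1 := hap _ (Metric.ball_subset_ball (by linarith) (hSball _ ht)) _
      (Metric.ball_subset_ball (by linarith) (hSball _ ht'))
    have e1 : x - t • e - (x - t' • e) = (t' - t) • e := by rw [sub_smul]; abel
    rw [e1, inner_smul_right, hge, norm_smul, hen, mul_one, Real.norm_eq_abs] at h1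
    have h2 := hSρ _ ht
    have h3 := hSρ _ ht'
    have h4 : |(t' - t) * c| ≤ c / 2 * |t' - t| + 3 * c * s := by
      have := abs_sub_abs_le_abs_sub ((t' - t) * c) (ρ (x - t • e) - ρ (x - t' • e))
      rw [abs_sub_comm ((t' - t) * c)] at this
      have h5 := abs_sub (ρ (x - t • e)) (ρ (x - t' • e))
      linarith
    rw [abs_mul, abs_of_pos hcpos] at h4
    rw [Real.dist_eq, abs_sub_comm]
    by_contra! hcon
    nlinarith
  -- Fubini for the translates of the neighbourhood
  have hmeas : Measurable (fun q : ℝ × E3 => S.indicator (fun _ => (1 : ℝ≥0∞)) (q.2 - q.1 • e)) :=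
    (measurable_const.indicator hSo.measurableSet).comp
      (show Continuous fun q : ℝ × E3 => q.2 - q.1 • e by fun_prop).measurable
  have hF : ENNReal.ofReal (2 * r) * volume S ≤ ENNReal.ofReal (6 * s) * volume (Metric.ball p R) :=
    calc ENNReal.ofReal (2 * r) * volume S
        = ∫⁻ t in Icc 0 (2 * r), ∫⁻ x : E3, S.indicator (fun _ => (1 : ℝ≥0∞)) (x - t • e) := by
          have : ∀ t : ℝ, ∫⁻ x : E3, S.indicator (fun _ => (1 : ℝ≥0∞)) (x - t • e) = volume S := by
            intro t
            rw [lintegral_sub_right_eq_self (fun x => S.indicator (fun _ => (1 : ℝ≥0∞)) x),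
              lintegral_indicator hSo.measurableSet]
            simp
          simp_rw [this]
          simp [mul_comm]
      _ = ∫⁻ x : E3, ∫⁻ t in Icc 0 (2 * r), S.indicator (fun _ => (1 : ℝ≥0∞)) (x - t • e) :=
          lintegral_lintegral_swap hmeas.aemeasurable
      _ ≤ ∫⁻ x : E3, (Metric.ball p R).indicator (fun _ => ENNReal.ofReal (6 * s)) x := by
          refine lintegral_mono fun x => ?_
          by_cases hx : x ∈ Metric.ball p R
          · rw [indicator_of_mem hx]
            have hm : MeasurableSet {t : ℝ | x - t • e ∈ S} :=
              (hSo.preimage (show Continuous fun t : ℝ => x - t • e by fun_prop)).measurableSet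
            calc _ ≤ ∫⁻ t : ℝ, S.indicator (fun _ => (1 : ℝ≥0∞)) (x - t • e) :=
                  setLIntegral_le_lintegral _ _
              _ = ∫⁻ t : ℝ, {t : ℝ | x - t • e ∈ S}.indicator (fun _ => (1 : ℝ≥0∞)) t := rfl
              _ = volume {t : ℝ | x - t • e ∈ S} := by
                  rw [lintegral_indicator hm]; simp
              _ ≤ _ := hline x
          · rw [indicator_of_notMem hx, nonpos_iff_eq_zero]
            refine setLIntegral_eq_zero measurableSet_Icc fun t ht => ?_
            refine indicator_of_notMem (fun hS' => hx ?_) _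
            have h1 := hSball _ hS'
            rw [Metric.mem_ball] at h1 ⊢
            have h2 : dist x (x - t • e) ≤ 2 * r := by
              rw [dist_eq_norm, sub_sub_cancel, norm_smul, hen, mul_one, Real.norm_of_nonneg ht.1]
              exact ht.2
            linarith [dist_triangle x (x - t • e) p]
      _ = _ := by
          rw [lintegral_indicator measurableSet_ball]; simp
  have hMeq : volume (Metric.ball p R) = ENNReal.ofReal M :=
    (ENNReal.ofReal_toReal measure_ball_lt_top.ne).symm
  have h2r : ENNReal.ofReal (2 * r) ≠ 0 := by simpa using hrpos
  rw [mul_comm, ← ENNReal.le_div_iff_mul_le (Or.inl h2r) (Or.inl ENNReal.ofReal_ne_top)] at hF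
  refine hF.trans (le_of_eq ?_)
  rw [hMeq, ← ENNReal.ofReal_mul (by positivity), ← ENNReal.ofReal_div_of_pos (by positivity)]
  congr 1; ring

/-- The volume of the collar of width `s` is `O(s)`. -/
theorem exists_volume_collar_le {Ω : Set E3} (hΩ : IsBoundedC2Domain Ω) :
    ∃ r > 0, ∃ C : ℝ, 0 ≤ C ∧ ∀ s ∈ Ioo 0 r, volume (collar Ω s) ≤ ENNReal.ofReal (C * s) := by
  have hcomp : IsCompact (frontier Ω) := Metric.isCompact_of_isClosed_isBounded isClosed_frontier
    (hΩ.isBounded.closure.subset frontier_subset_closure)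
  have hloc : ∀ p ∈ frontier Ω, ∃ r > 0, ∃ C : ℝ, 0 ≤ C ∧ ∀ s, 0 < s → s ≤ r →
      volume (Metric.thickening s (frontier Ω ∩ Metric.ball p r)) ≤ ENNReal.ofReal (C * s) := by
    intro p hp
    obtain ⟨U, ρ, hpU, hρ⟩ := hΩ.boundary p hp
    obtain ⟨r, hr, C, hC, h⟩ := exists_volume_thickening_le (hρ.contDiffAt hpU)
      (hρ.gradient_ne_zero p hpU)
    obtain ⟨R, hR, hRU⟩ := Metric.isOpen_iff.1 hρ.isOpen p hpU
    refine ⟨min r R, lt_min hr hR, C, hC, fun s hs hsr => ?_⟩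
    refine h _ (fun x hx => Metric.ball_subset_ball (min_le_left _ _) hx.2) (fun x hx => ?_) s hs
      (hsr.trans (min_le_left _ _))
    exact hρ.eq_zero hΩ.isOpen (hRU (Metric.ball_subset_ball (min_le_right _ _) hx.2)) hx.1
  choose! r hr C hC hvol using hloc
  obtain ⟨t, htf, htc⟩ := hcomp.elim_nhds_subcover (fun p => Metric.ball p (r p))
    (fun p hp => Metric.ball_mem_nhds p (hr p hp))
  obtain ⟨r₀, hr₀, hr₀t⟩ : ∃ r₀ > 0, ∀ p ∈ t, r₀ ≤ r p := by
    rcases t.eq_empty_or_nonempty with rfl | hne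
    · exact ⟨1, one_pos, by simp⟩
    · obtain ⟨p, hp, hmin⟩ := t.exists_min_image r hne
      exact ⟨r p, hr p (htf p hp), hmin⟩
  refine ⟨r₀, hr₀, ∑ p ∈ t, C p, Finset.sum_nonneg fun p hp => hC p (htf p hp), fun s hs => ?_⟩
  have hsub : collar Ω s ⊆ ⋃ p ∈ t, Metric.thickening s (frontier Ω ∩ Metric.ball p (r p)) := by
    intro x hx
    obtain ⟨y, hy, hxy⟩ := exists_mem_frontier_dist_eq hΩ.isOpen hΩ.isBounded hx.1
    obtain ⟨p, hp, hyp⟩ := mem_iUnion₂.1 (htc hy)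
    exact mem_iUnion₂.2 ⟨p, hp, Metric.mem_thickening_iff.2 ⟨y, ⟨hy, hyp⟩, hxy ▸ hx.2⟩⟩
  calc volume (collar Ω s) ≤ ∑ p ∈ t, volume (Metric.thickening s
        (frontier Ω ∩ Metric.ball p (r p))) := (measure_mono hsub).trans (measure_biUnion_finset_le _ _)
    _ ≤ ∑ p ∈ t, ENNReal.ofReal (C p * s) := Finset.sum_le_sum fun p hp =>
        hvol p (htf p hp) s hs.1 (hs.2.le.trans (hr₀t p hp))
    _ = _ := by
        rw [← ENNReal.ofReal_sum_of_nonneg fun p hp => mul_nonneg (hC p (htf p hp)) hs.1.le,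
          Finset.sum_mul]

/-! ### Modification on null sets and change of sign -/

/-- `u` and `u'` agree almost everywhere in `Ω` at almost every time in `(0,T)`. -/
def AEEqOn {F : Type*} (Ω : Set E3) (T : ℝ) (u u' : ℝ → E3 → F) : Prop :=
  ∀ᵐ t ∂(volume.restrict (Ioo 0 T)), u t =ᵐ[volume.restrict Ω] u' t

theorem aeEqOn_of_ae_prod {F : Type*} {Ω : Set E3} {T : ℝ} {u u' : ℝ → E3 → F}
    (h : ∀ᵐ z ∂((volume : Measure (ℝ × E3)).restrict (Ioo 0 T ×ˢ Ω)), u z.1 z.2 = u' z.1 z.2) :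
    AEEqOn Ω T u u' := by
  rw [Measure.volume_eq_prod, ← Measure.prod_restrict] at h
  exact Measure.ae_ae_of_ae_prod h

theorem exists_stronglyMeasurable_aeEqOn {F : Type*} [TopologicalSpace F] {Ω : Set E3} {T : ℝ}
    {u : ℝ → E3 → F} (h : AEStronglyMeasurable (fun z : ℝ × E3 => u z.1 z.2)
      (volume.restrict (Ioo 0 T ×ˢ Ω))) :
    ∃ u' : ℝ → E3 → F, StronglyMeasurable (fun z : ℝ × E3 => u' z.1 z.2) ∧
      (∀ᵐ z ∂((volume : Measure (ℝ × E3)).restrict (Ioo 0 T ×ˢ Ω)), u z.1 z.2 = u' z.1 z.2) ∧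
      AEEqOn Ω T u u' :=
  ⟨fun t x => h.mk _ (t, x), h.stronglyMeasurable_mk, h.ae_eq_mk, aeEqOn_of_ae_prod h.ae_eq_mk⟩

theorem FiniteLqTime.congr {T q : ℝ} {N N' : ℝ → ℝ≥0∞} (hN : FiniteLqTime T q N)
    (h : ∀ᵐ t ∂(volume.restrict (Ioo 0 T)), N t = N' t) : FiniteLqTime T q N' := by
  unfold FiniteLqTime at *
  rwa [← lintegral_congr_ae (h.mono fun t ht => congrArg (· ^ q) ht)]

theorem eBesovNorm_congr {p : ℝ≥0∞} {a : ℝ} {Γ : Set E3} (hΓ : MeasurableSet Γ) {f g : E3 → E3}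
    (h : f =ᵐ[volume.restrict Γ] g) : eBesovNorm p a Γ f = eBesovNorm p a Γ g := by
  unfold eBesovNorm
  congr 1
  · exact eLpNorm_congr_ae h
  · refine iSup_congr fun y => iSup_congr fun _ => ?_
    congr 1
    refine eLpNorm_congr_ae ?_
    have hm : MeasurableSet {x | x - y ∈ Γ} := hΓ.preimage (measurable_id.sub_const y)
    have h' := (ae_restrict_iff' hΓ).1 h
    have h'' : ∀ᵐ x : E3, x - y ∈ Γ → f (x - y) = g (x - y) :=
      (measurePreserving_sub_right volume y).quasiMeasurePreserving.ae h'
    rw [EventuallyEq, ae_restrict_iff' (hΓ.inter hm)]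
    filter_upwards [h', h''] with x h1 h2 hx
    rw [h1 hx.1, h2 hx.2]

theorem MemLqBesov.congr {Ω Γ : Set E3} {T q a : ℝ} {p : ℝ≥0∞} {u u' : ℝ → E3 → E3}
    (hu : MemLqBesov T q p a Γ u) (hΓ : MeasurableSet Γ) (hΓΩ : Γ ⊆ Ω) (h : AEEqOn Ω T u u') :
    MemLqBesov T q p a Γ u' :=
  FiniteLqTime.congr hu (h.mono fun _ ht =>
    eBesovNorm_congr hΓ (ae_restrict_of_ae_restrict_of_subset hΓΩ ht))

theorem MemLqLp.congr {F : Type*} [NormedAddCommGroup F] {Ω S : Set E3} {T q : ℝ} {p : ℝ≥0∞}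
    {u u' : ℝ → E3 → F} (hu : MemLqLp T q p S u) (hS : S ⊆ Ω) (h : AEEqOn Ω T u u') :
    MemLqLp T q p S u' :=
  FiniteLqTime.congr hu (h.mono fun _ ht =>
    eLpNorm_congr_ae (ae_restrict_of_ae_restrict_of_subset hS ht))

theorem BesovContinuousNearBdry.congr {Ω : Set E3} {T a : ℝ} {u u' : ℝ → E3 → E3}
    (hu : BesovContinuousNearBdry Ω T a u) (h : AEEqOn Ω T u u') :
    BesovContinuousNearBdry Ω T a u' := by
  obtain ⟨h₀, hpos, hfin⟩ := hu
  refine ⟨h₀, hpos, hfin.congr (h.mono fun t ht => ?_)⟩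
  refine iSup_congr fun s => iSup_congr fun _ => ?_
  congr 1
  refine eLpNorm_congr_ae ?_
  filter_upwards [ae_restrict_of_ae_restrict_of_subset (s := bdryLayer Ω s) (fun x hx => hx.1) ht]
    with x hx
  rw [hx]

theorem MemLinftyL2.congr {Ω : Set E3} {T : ℝ} {u u' : ℝ → E3 → E3} (hu : MemLinftyL2 Ω T u)
    (h : ∀ᵐ z ∂((volume : Measure (ℝ × E3)).restrict (Ioo 0 T ×ˢ Ω)), u z.1 z.2 = u' z.1 z.2) :
    MemLinftyL2 Ω T u' := by
  refine ⟨hu.1.congr h, ?_⟩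
  obtain ⟨C, hC⟩ := hu.2
  refine ⟨C, ?_⟩
  filter_upwards [hC, aeEqOn_of_ae_prod h] with t h1 h2
  rwa [← eLpNorm_congr_ae h2]

theorem WeaklyDivFree.congr {Ω : Set E3} {T : ℝ} {u u' : ℝ → E3 → E3} (hu : WeaklyDivFree Ω T u)
    (h : AEEqOn Ω T u u') : WeaklyDivFree Ω T u' := by
  intro φ h1 h2 h3
  filter_upwards [hu φ h1 h2 h3, h] with t ht hut
  rw [← ht]
  refine integral_congr_ae ?_
  filter_upwards [hut] with x hx
  rw [hx]

theorem IsWeakMHDSolution.congr {Ω : Set E3} {T : ℝ} {u b u' b' : ℝ → E3 → E3}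
    {π π' : ℝ → E3 → ℝ} (hsol : IsWeakMHDSolution Ω T u b π) (hΩ : IsOpen Ω)
    (hu : ∀ᵐ z ∂((volume : Measure (ℝ × E3)).restrict (Ioo 0 T ×ˢ Ω)), u z.1 z.2 = u' z.1 z.2)
    (hb : ∀ᵐ z ∂((volume : Measure (ℝ × E3)).restrict (Ioo 0 T ×ˢ Ω)), b z.1 z.2 = b' z.1 z.2)
    (hπ : ∀ᵐ z ∂((volume : Measure (ℝ × E3)).restrict (Ioo 0 T ×ˢ Ω)), π z.1 z.2 = π' z.1 z.2) :
    IsWeakMHDSolution Ω T u' b' π' where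
  u_mem := hsol.u_mem.congr hu
  b_mem := hsol.b_mem.congr hb
  pressure_mem := fun z hz => by
    obtain ⟨s, hs, hi⟩ := hsol.pressure_mem z hz
    have hO : MeasurableSet (Ioo 0 T ×ˢ Ω) := measurableSet_Ioo.prod hΩ.measurableSet
    refine ⟨s ∩ Ioo 0 T ×ˢ Ω, inter_mem hs self_mem_nhdsWithin, ?_⟩
    exact (hi.mono_set inter_subset_left).congr_fun_ae
      (ae_restrict_of_ae_restrict_of_subset inter_subset_right hπ)
  momentum := fun Φ hΦ => by
    refine Eq.trans ?_ (hsol.momentum Φ hΦ)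
    refine integral_congr_ae ?_
    filter_upwards [aeEqOn_of_ae_prod hu, aeEqOn_of_ae_prod hb, aeEqOn_of_ae_prod hπ] with t h1 h2 h3
    refine integral_congr_ae ?_
    filter_upwards [h1, h2, h3] with x x1 x2 x3
    rw [x1, x2, x3]
  induction := fun Φ hΦ => by
    refine Eq.trans ?_ (hsol.induction Φ hΦ)
    refine integral_congr_ae ?_
    filter_upwards [aeEqOn_of_ae_prod hu, aeEqOn_of_ae_prod hb] with t h1 h2
    refine integral_congr_ae ?_
    filter_upwards [h1, h2] with x x1 x2
    rw [x1, x2]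
  u_divFree := hsol.u_divFree.congr (aeEqOn_of_ae_prod hu)
  b_divFree := hsol.b_divFree.congr (aeEqOn_of_ae_prod hb)

theorem MemLqBesov.neg {Γ : Set E3} {T q a : ℝ} {p : ℝ≥0∞} {u : ℝ → E3 → E3}
    (hu : MemLqBesov T q p a Γ u) : MemLqBesov T q p a Γ (-u) := by
  refine FiniteLqTime.congr hu (Eventually.of_forall fun t => ?_)
  unfold eBesovNorm
  congr 1
  · exact (eLpNorm_neg (u t) p _).symm
  · refine iSup_congr fun y => iSup_congr fun _ => ?_
    rw [← eLpNorm_neg]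
    congr 2
    ext1 x
    simp only [Pi.neg_apply]; abel

theorem MemLqLp.neg {S : Set E3} {T q : ℝ} {p : ℝ≥0∞} {u : ℝ → E3 → E3}
    (hu : MemLqLp T q p S u) : MemLqLp T q p S (-u) :=
  FiniteLqTime.congr hu (Eventually.of_forall fun t => (eLpNorm_neg (u t) p _).symm)

theorem BesovContinuousNearBdry.neg {Ω : Set E3} {T a : ℝ} {u : ℝ → E3 → E3}
    (hu : BesovContinuousNearBdry Ω T a u) : BesovContinuousNearBdry Ω T a (-u) := by
  obtain ⟨h₀, hpos, hfin⟩ := hu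
  refine ⟨h₀, hpos, hfin.congr (Eventually.of_forall fun t => ?_)⟩
  refine iSup_congr fun s => iSup_congr fun _ => ?_
  rw [← eLpNorm_neg]
  congr 2
  ext1 x
  simp

/-- Changing the sign of the magnetic field maps weak solutions to weak solutions. -/
theorem IsWeakMHDSolution.neg {Ω : Set E3} {T : ℝ} {u b : ℝ → E3 → E3}
    {π : ℝ → E3 → ℝ} (hsol : IsWeakMHDSolution Ω T u b π) : IsWeakMHDSolution Ω T u (-b) π where
  u_mem := hsol.u_mem
  b_mem := by
    obtain ⟨h1, C, hC⟩ := hsol.b_mem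
    exact ⟨h1.neg, C, hC.mono fun t ht => (eLpNorm_neg (b t) 2 _).trans_le ht⟩
  pressure_mem := hsol.pressure_mem
  momentum := fun Φ hΦ => by
    refine Eq.trans ?_ (hsol.momentum Φ hΦ)
    simp [tensorGrad]
  induction := fun Φ hΦ => by
    refine neg_eq_zero.1 (Eq.trans ?_ (hsol.induction Φ hΦ))
    rw [← integral_neg]
    congr 1; ext t
    rw [← integral_neg]
    congr 1; ext x
    simp only [tensorGrad, Pi.neg_apply, inner_neg_left, map_neg, inner_neg_right]
    ring
  u_divFree := hsol.u_divFree
  b_divFree := fun φ h1 h2 h3 => by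
    filter_upwards [hsol.b_divFree φ h1 h2 h3] with t ht
    simp only [Pi.neg_apply, inner_neg_left, integral_neg, ht, neg_zero]

/-! ### The Elsässer variables -/

theorem lintegral_enorm_sq_eq {F : Type*} [NormedAddCommGroup F] {μ : Measure E3} (f : E3 → F) :
    ∫⁻ x, ‖f x‖ₑ ^ 2 ∂μ = eLpNorm f 2 μ ^ 2 := by
  have := eLpNorm_nnreal_pow_eq_lintegral (f := f) (μ := μ) (p := 2) (by norm_num)
  norm_num at this
  exact this.symm

theorem lintegral_enorm_cube_eq {F : Type*} [NormedAddCommGroup F] {μ : Measure E3} (f : E3 → F) :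
    ∫⁻ x, ‖f x‖ₑ ^ 3 ∂μ = eLpNorm f 3 μ ^ 3 := by
  have := eLpNorm_nnreal_pow_eq_lintegral (f := f) (μ := μ) (p := 3) (by norm_num)
  norm_num at this
  exact this.symm

theorem enorm_add_sq_le {F : Type*} [NormedAddCommGroup F] (x y : F) :
    ‖x + y‖ₑ ^ 2 ≤ 2 * (‖x‖ₑ ^ 2 + ‖y‖ₑ ^ 2) := by
  have h : ‖x + y‖ ^ 2 ≤ 2 * (‖x‖ ^ 2 + ‖y‖ ^ 2) := by
    have := pow_le_pow_left₀ (norm_nonneg _) (norm_add_le x y) 2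
    nlinarith [sq_nonneg (‖x‖ - ‖y‖)]
  have := ENNReal.ofReal_le_ofReal h
  rwa [ENNReal.ofReal_mul zero_le_two, ENNReal.ofReal_add (by positivity) (by positivity),
    ofReal_norm_pow, ofReal_norm_pow, ofReal_norm_pow, ENNReal.ofReal_ofNat] at this

theorem MemLinftyL2.exists_lintegral_le {Ω : Set E3} {T : ℝ} {u : ℝ → E3 → E3}
    (hu : MemLinftyL2 Ω T u) : ∃ C : ℝ, 0 ≤ C ∧ ∀ᵐ t ∂(volume.restrict (Ioo 0 T)),
      ∫⁻ x in Ω, ‖u t x‖ₑ ^ 2 ≤ ENNReal.ofReal C := by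
  obtain ⟨-, C, hC⟩ := hu
  refine ⟨(max C 0) ^ 2, by positivity, hC.mono fun t ht => ?_⟩
  rw [lintegral_enorm_sq_eq, ENNReal.ofReal_pow (le_max_right _ _)]
  exact pow_le_pow_left' (ht.trans (ENNReal.ofReal_le_ofReal (le_max_left _ _))) 2

theorem exists_lintegral_add_le {Ω : Set E3} {T C C' : ℝ} {u b : ℝ → E3 → E3} (hC : 0 ≤ C)
    (hC' : 0 ≤ C') (hm : StronglyMeasurable (fun z : ℝ × E3 => u z.1 z.2))
    (hu : ∀ᵐ t ∂(volume.restrict (Ioo 0 T)), ∫⁻ x in Ω, ‖u t x‖ₑ ^ 2 ≤ ENNReal.ofReal C)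
    (hb : ∀ᵐ t ∂(volume.restrict (Ioo 0 T)), ∫⁻ x in Ω, ‖b t x‖ₑ ^ 2 ≤ ENNReal.ofReal C') :
    ∃ C : ℝ, ∀ᵐ t ∂(volume.restrict (Ioo 0 T)),
      ∫⁻ x in Ω, ‖u t x + b t x‖ₑ ^ 2 ≤ ENNReal.ofReal C := by
  refine ⟨2 * (C + C'), ?_⟩
  filter_upwards [hu, hb] with t h1 h2
  have hmt : Measurable (fun x => ‖u t x‖ₑ ^ 2) :=
    (hm.comp_measurable (measurable_prodMk_left (x := t))).enorm.pow_const 2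
  calc _ ≤ ∫⁻ x in Ω, 2 * (‖u t x‖ₑ ^ 2 + ‖b t x‖ₑ ^ 2) :=
        lintegral_mono fun x => enorm_add_sq_le _ _
    _ = 2 * ((∫⁻ x in Ω, ‖u t x‖ₑ ^ 2) + ∫⁻ x in Ω, ‖b t x‖ₑ ^ 2) := by
        rw [lintegral_const_mul' _ _ (by finiteness), lintegral_add_left hmt]
    _ ≤ 2 * (ENNReal.ofReal C + ENNReal.ofReal C') := by gcongr
    _ = _ := by
        rw [ENNReal.ofReal_mul zero_le_two, ENNReal.ofReal_add hC hC', ENNReal.ofReal_ofNat]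

section TestFields

variable {ψ : ℝ → ℝ} {ζ : E3 → ℝ} {i : Fin 3}

/-- The test field `ψ(t) ζ(x) eᵢ`. -/
noncomputable def productTest (ψ : ℝ → ℝ) (ζ : E3 → ℝ) (i : Fin 3) (z : ℝ × E3) : E3 :=
  (ψ z.1 * ζ z.2) • EuclideanSpace.single i (1 : ℝ)

theorem isSpaceTimeTest_productTest {Ω : Set E3} {T : ℝ} (hψ : ContDiff ℝ ∞ ψ)
    (hψc : HasCompactSupport ψ) (hψs : tsupport ψ ⊆ Ioo 0 T) (hζ : ContDiff ℝ ∞ ζ)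
    (hζc : HasCompactSupport ζ) (hζs : tsupport ζ ⊆ Ω) :
    IsSpaceTimeTest Ω T (productTest ψ ζ i) := by
  have hsub : tsupport (productTest ψ ζ i) ⊆ tsupport ψ ×ˢ tsupport ζ := by
    refine closure_minimal (fun z hz => ⟨?_, ?_⟩)
      ((isClosed_tsupport ψ).prod (isClosed_tsupport ζ))
    · refine subset_closure fun h => hz ?_
      simp [productTest, h]
    · refine subset_closure fun h => hz ?_
      simp [productTest, h]
  refine ⟨?_, ?_, hsub.trans (prod_mono hψs hζs)⟩
  · exact ((hψ.comp contDiff_fst).mul (hζ.comp contDiff_snd)).smul contDiff_const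
  · exact (IsCompact.prod hψc hζc).of_isClosed_subset (isClosed_tsupport _) hsub

theorem inner_single_right (v : E3) (c : ℝ) (i : Fin 3) :
    inner ℝ v (c • EuclideanSpace.single i (1 : ℝ)) = c * v i := by
  rw [inner_smul_right, EuclideanSpace.inner_single_right]; simp

theorem deriv_productTest (hψ : ContDiff ℝ ∞ ψ) (t : ℝ) (x : E3) :
    deriv (fun s => productTest ψ ζ i (s, x)) t
      = (deriv ψ t * ζ x) • EuclideanSpace.single i (1 : ℝ) := by
  have h : HasDerivAt ψ (deriv ψ t) t := (hψ.differentiable (by simp) t).hasDerivAt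
  exact ((h.mul_const (ζ x)).smul_const _).deriv

theorem fderiv_productTest (hζ : ContDiff ℝ ∞ ζ) (t : ℝ) (x w : E3) :
    fderiv ℝ (fun y => productTest ψ ζ i (t, y)) x w
      = (ψ t * fderiv ℝ ζ x w) • EuclideanSpace.single i (1 : ℝ) := by
  have h : HasFDerivAt ζ (fderiv ℝ ζ x) x := (hζ.differentiable (by simp) x).hasFDerivAt
  have h2 := (h.const_mul (ψ t)).smul_const (EuclideanSpace.single i (1 : ℝ))
  have h3 : fderiv ℝ (fun y => productTest ψ ζ i (t, y)) x = _ := h2.fderiv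
  rw [h3]; simp

theorem tensorGrad_productTest (hζ : ContDiff ℝ ∞ ζ) (t : ℝ) (x v w : E3) :
    tensorGrad v w (fun y => productTest ψ ζ i (t, y)) x = ψ t * (fderiv ℝ ζ x w * v i) := by
  rw [tensorGrad, fderiv_productTest hζ, inner_single_right]; ring

theorem divergence_productTest (hζ : ContDiff ℝ ∞ ζ) (t : ℝ) (x : E3) :
    divergence (fun y => productTest ψ ζ i (t, y)) x
      = ψ t * fderiv ℝ ζ x (EuclideanSpace.single i 1) := by
  rw [divergence, Finset.sum_eq_single i]
  · rw [fderiv_productTest hζ]; simp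
  · intro j _ hj
    rw [fderiv_productTest hζ]; simp [hj.symm]
  · simp

end TestFields

theorem integrable_time_mul_fderiv_mul {ν : Measure (ℝ × E3)} {v w : ℝ × E3 → E3} {ψ : ℝ → ℝ}
    {ζ : E3 → ℝ} (hv : StronglyMeasurable v) (hw : StronglyMeasurable w)
    (hv2 : Integrable (fun q => ‖v q‖ ^ 2) ν) (hw2 : Integrable (fun q => ‖w q‖ ^ 2) ν)
    (hψ : ContDiff ℝ ∞ ψ) (hψc : HasCompactSupport ψ) (hζ : ContDiff ℝ ∞ ζ)
    (hζc : HasCompactSupport ζ) (i : Fin 3) :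
    Integrable (fun q => ψ q.1 * (fderiv ℝ ζ q.2 (v q) * w q i)) ν := by
  obtain ⟨D, hD⟩ := hψ.continuous.bounded_above_of_compact_support hψc
  obtain ⟨L, hL⟩ := (hζ.continuous_fderiv (by simp)).bounded_above_of_compact_support
    (hζc.fderiv ℝ)
  have hD0 : 0 ≤ D := (norm_nonneg _).trans (hD 0)
  have hL0 : 0 ≤ L := (norm_nonneg _).trans (hL 0)
  have m1 : StronglyMeasurable (fun q : ℝ × E3 => fderiv ℝ ζ q.2) :=
    ((hζ.continuous_fderiv (by simp)).comp continuous_snd).stronglyMeasurable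
  have m2 : StronglyMeasurable (fun q : ℝ × E3 => ψ q.1) :=
    (hψ.continuous.comp continuous_fst).stronglyMeasurable
  refine ((hv2.add hw2).const_mul (D * L)).mono' (m2.mul ((stronglyMeasurable_fderiv_apply m1
    hv).mul (stronglyMeasurable_coord hw i))).aestronglyMeasurable
    (Eventually.of_forall fun q => ?_)
  rw [norm_mul, norm_mul]
  have h1 := (fderiv ℝ ζ q.2).le_of_opNorm_le (hL q.2) (v q)
  calc _ ≤ D * (L * ‖v q‖ * ‖w q‖) := by
        gcongr
        · exact hD _
        · exact abs_coord_le _ _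
    _ = D * L * (‖v q‖ * ‖w q‖) := by ring
    _ ≤ D * L * (‖v q‖ ^ 2 + ‖w q‖ ^ 2) := by
        gcongr
        nlinarith [sq_nonneg (‖v q‖ - ‖w q‖), sq_nonneg (‖v q‖ + ‖w q‖)]

theorem integrable_time_mul_coord {ν : Measure (ℝ × E3)} [IsFiniteMeasure ν] {w : ℝ × E3 → E3}
    {ψ : ℝ → ℝ} {ζ : E3 → ℝ} (hw : StronglyMeasurable w)
    (hw2 : Integrable (fun q => ‖w q‖ ^ 2) ν) (hψ : Continuous ψ) (hψc : HasCompactSupport ψ)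
    (hζ : Continuous ζ) (hζc : HasCompactSupport ζ) (i : Fin 3) :
    Integrable (fun q => ψ q.1 * (ζ q.2 * w q i)) ν := by
  obtain ⟨D, hD⟩ := hψ.bounded_above_of_compact_support hψc
  obtain ⟨L, hL⟩ := hζ.bounded_above_of_compact_support hζc
  have hwi : Integrable (fun q => w q i) ν := by
    refine ((integrable_const (1 : ℝ)).add hw2).mono'
      (stronglyMeasurable_coord hw i).aestronglyMeasurable (Eventually.of_forall fun q => ?_)
    refine (abs_coord_le (w q) i).trans ?_
    simp only [Pi.add_apply]
    nlinarith [sq_nonneg (‖w q‖ - 1)]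
  exact (hwi.bdd_mul (hζ.comp continuous_snd).aestronglyMeasurable
    (Eventually.of_forall fun q => hL _)).bdd_mul
    (hψ.comp continuous_fst).aestronglyMeasurable (Eventually.of_forall fun q => hD _)

theorem integrable_time_mul_pressure {Ω : Set E3} {T : ℝ} {P : ℝ → E3 → ℝ} {ψ : ℝ → ℝ} {ζ : E3 → ℝ}
    (hP : LocallyIntegrableOn (fun z : ℝ × E3 => P z.1 z.2) (Ioo 0 T ×ˢ Ω))
    (hψ : ContDiff ℝ ∞ ψ) (hψc : HasCompactSupport ψ) (hψs : tsupport ψ ⊆ Ioo 0 T)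
    (hζ : ContDiff ℝ ∞ ζ) (hζc : HasCompactSupport ζ) (hζs : tsupport ζ ⊆ Ω) (e : E3) :
    Integrable (fun q : ℝ × E3 => ψ q.1 * (P q.1 q.2 * fderiv ℝ ζ q.2 e))
      ((volume.restrict (Ioo 0 T)).prod (volume.restrict Ω)) := by
  obtain ⟨D, hD⟩ := hψ.continuous.bounded_above_of_compact_support hψc
  have hcl : Continuous (fun x => fderiv ℝ ζ x e) := (hζ.continuous_fderiv (by simp)).clm_apply
    continuous_const
  obtain ⟨L, hL⟩ := hcl.bounded_above_of_compact_support (hζc.fderiv_apply ℝ e)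
  have hK : IsCompact (tsupport ψ ×ˢ tsupport ζ) := IsCompact.prod hψc hζc
  have hi : IntegrableOn (fun z : ℝ × E3 => P z.1 z.2) (tsupport ψ ×ˢ tsupport ζ) :=
    hP.integrableOn_compact_subset (prod_mono hψs hζs) hK
  have hi2 : IntegrableOn (fun q : ℝ × E3 => ψ q.1 * (P q.1 q.2 * fderiv ℝ ζ q.2 e))
      (tsupport ψ ×ˢ tsupport ζ) :=
    (hi.mul_bdd (c := L) (hcl.comp continuous_snd).aestronglyMeasurable
      (Eventually.of_forall fun q => hL _)).bdd_mul
      (hψ.continuous.comp continuous_fst).aestronglyMeasurable (Eventually.of_forall fun q => hD _)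
  have hi3 : Integrable (fun q : ℝ × E3 => ψ q.1 * (P q.1 q.2 * fderiv ℝ ζ q.2 e)) := by
    rw [← integrableOn_iff_integrable_of_support_subset (s := tsupport ψ ×ˢ tsupport ζ)]
    · exact hi2
    · intro q hq
      refine ⟨subset_closure fun h => hq ?_, ?_⟩
      · simp only [h, zero_mul]
      · by_contra h
        exact hq (by simp only [fderiv_of_notMem_tsupport ℝ h, zero_apply, mul_zero])
  rw [Measure.prod_restrict, ← Measure.volume_eq_prod]
  exact hi3.restrict

/-- `Z = u + b` is transported by `V = u - b`: the sum of the momentum and induction equations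
contains `u ⊗ u - b ⊗ b + b ⊗ u - u ⊗ b = (u + b) ⊗ (u - b)`. -/
theorem IsWeakMHDSolution.isWeakTransport {Ω : Set E3} {T : ℝ} {u b : ℝ → E3 → E3}
    {π : ℝ → E3 → ℝ} (h : IsWeakMHDSolution Ω T u b π) (hΩb : Bornology.IsBounded Ω)
    (hu : StronglyMeasurable (fun z : ℝ × E3 => u z.1 z.2))
    (hb : StronglyMeasurable (fun z : ℝ × E3 => b z.1 z.2))
    (hπ : StronglyMeasurable (fun z : ℝ × E3 => π z.1 z.2)) :
    IsWeakTransport Ω T (fun t x => u t x + b t x) (fun t x => u t x - b t x) π := by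
  have hfin : IsFiniteMeasure (volume.restrict Ω : Measure E3) :=
    ⟨by simpa using hΩb.measure_lt_top⟩
  obtain ⟨C1, hC1, hu2⟩ := h.u_mem.exists_lintegral_le
  obtain ⟨C2, hC2, hb2⟩ := h.b_mem.exists_lintegral_le
  have iu := integrable_sq_prod_of_bound hu hu2
  have ib := integrable_sq_prod_of_bound hb hb2
  have hdiv : ∀ ζ : E3 → ℝ, ContDiff ℝ ∞ ζ → HasCompactSupport ζ → tsupport ζ ⊆ Ω →
      ∀ᵐ t ∂(volume.restrict (Ioo 0 T)),
        (Integrable (fun x => fderiv ℝ ζ x (u t x)) (volume.restrict Ω) ∧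
          Integrable (fun x => fderiv ℝ ζ x (b t x)) (volume.restrict Ω)) ∧
        ∫ x in Ω, fderiv ℝ ζ x (u t x) = 0 ∧ ∫ x in Ω, fderiv ℝ ζ x (b t x) = 0 := by
    intro ζ h1 h2 h3
    obtain ⟨L, hL⟩ := (h1.continuous_fderiv (by simp)).bounded_above_of_compact_support
      (h2.fderiv ℝ)
    have hint : ∀ {w : ℝ → E3 → E3}, StronglyMeasurable (fun z : ℝ × E3 => w z.1 z.2) →
        ∀ t, Integrable (fun x => ‖w t x‖ ^ 2) (volume.restrict Ω) →
          Integrable (fun x => fderiv ℝ ζ x (w t x)) (volume.restrict Ω) := by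
      intro w hw t hi
      have hwt : StronglyMeasurable (w t) := hw.comp_measurable (measurable_prodMk_left (x := t))
      refine ((integrable_norm_of_sq hwt.aestronglyMeasurable hi).const_mul L).mono'
        (stronglyMeasurable_fderiv_apply (h1.continuous_fderiv (by simp)).stronglyMeasurable
          hwt).aestronglyMeasurable (Eventually.of_forall fun x => ?_)
      exact (fderiv ℝ ζ x).le_of_opNorm_le (hL x) _
    filter_upwards [h.u_divFree ζ h1 h2 h3, h.b_divFree ζ h1 h2 h3, iu.prod_right_ae,
      ib.prod_right_ae] with t t1 t2 t3 t4
    simp only [inner_gradient_right, conj_trivial] at t1 t2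
    exact ⟨⟨hint hu t t3, hint hb t t4⟩, t1, t2⟩
  refine ⟨hu.add hb, hu.sub hb, hπ, ?_, ?_, fun K hK hKΩ a c ha hc => ?_, ?_, ?_, ?_⟩
  · exact exists_lintegral_add_le hC1 hC2 hu hu2 hb2
  · have := exists_lintegral_add_le (b := fun t x => - b t x) hC1 hC2 hu hu2
      (by simpa only [enorm_neg] using hb2)
    simpa only [← sub_eq_add_neg] using this
  · exact h.pressure_mem.integrableOn_compact_subset
      (prod_mono (fun t ht => ⟨ha.trans_le ht.1, ht.2.trans_lt hc⟩) hKΩ) (isCompact_Icc.prod hK)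
  · intro ψ hψ hψc hψs ζ hζ hζc hζs i
    set ν : Measure (ℝ × E3) := (volume.restrict (Ioo 0 T)).prod (volume.restrict Ω) with hν
    have hΦ := isSpaceTimeTest_productTest (i := i) hψ hψc hψs hζ hζc hζs
    have hmom := h.momentum _ hΦ
    have hind := h.induction _ hΦ
    simp only [deriv_productTest hψ, inner_single_right, tensorGrad_productTest hζ,
      divergence_productTest hζ] at hmom hind
    have kψ' : Continuous (deriv ψ) := hψ.continuous_deriv (by simp)
    have i1 := integrable_time_mul_coord hu iu kψ' hψc.deriv hζ.continuous hζc i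
    have i2 := integrable_time_mul_coord hb ib kψ' hψc.deriv hζ.continuous hζc i
    have iuu := integrable_time_mul_fderiv_mul hu hu iu iu hψ hψc hζ hζc i
    have iub := integrable_time_mul_fderiv_mul hu hb iu ib hψ hψc hζ hζc i
    have ibu := integrable_time_mul_fderiv_mul hb hu ib iu hψ hψc hζ hζc i
    have ibb := integrable_time_mul_fderiv_mul hb hb ib ib hψ hψc hζ hζc i
    have ip := integrable_time_mul_pressure h.pressure_mem hψ hψc hψs hζ hζc hζs
      (EuclideanSpace.single i 1)
    have k1 : Integrable (fun q : ℝ × E3 => deriv ψ q.1 * (ζ q.2 * u q.1 q.2 i)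
        + ψ q.1 * (fderiv ℝ ζ q.2 (u q.1 q.2) * u q.1 q.2 i)
        - ψ q.1 * (fderiv ℝ ζ q.2 (b q.1 q.2) * b q.1 q.2 i)
        + ψ q.1 * (π q.1 q.2 * fderiv ℝ ζ q.2 (EuclideanSpace.single i 1))) ν := ((i1.add iuu).sub ibb).add ip
    have k2 : Integrable (fun q : ℝ × E3 => deriv ψ q.1 * (ζ q.2 * b q.1 q.2 i)
        + ψ q.1 * (fderiv ℝ ζ q.2 (u q.1 q.2) * b q.1 q.2 i)
        - ψ q.1 * (fderiv ℝ ζ q.2 (b q.1 q.2) * u q.1 q.2 i)) ν := (i2.add iub).sub ibu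
    have e1 : ∫ q, (deriv ψ q.1 * (ζ q.2 * u q.1 q.2 i)
        + ψ q.1 * (fderiv ℝ ζ q.2 (u q.1 q.2) * u q.1 q.2 i)
        - ψ q.1 * (fderiv ℝ ζ q.2 (b q.1 q.2) * b q.1 q.2 i)
        + ψ q.1 * (π q.1 q.2 * fderiv ℝ ζ q.2 (EuclideanSpace.single i 1))) ∂ν = 0 := by
      rw [← hmom, integral_prod _ k1]
      refine integral_congr_ae (Eventually.of_forall fun t => integral_congr_ae
        (Eventually.of_forall fun x => ?_))
      beta_reduce; ring
    have e2 : ∫ q, (deriv ψ q.1 * (ζ q.2 * b q.1 q.2 i)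
        + ψ q.1 * (fderiv ℝ ζ q.2 (u q.1 q.2) * b q.1 q.2 i)
        - ψ q.1 * (fderiv ℝ ζ q.2 (b q.1 q.2) * u q.1 q.2 i)) ∂ν = 0 := by
      rw [← hind, integral_prod _ k2]
      refine integral_congr_ae (Eventually.of_forall fun t => integral_congr_ae
        (Eventually.of_forall fun x => ?_))
      beta_reduce; ring
    have j1 : Integrable (fun q : ℝ × E3 =>
        deriv ψ q.1 * (ζ q.2 * (u q.1 q.2 + b q.1 q.2) i)) ν := by
      refine (i1.add i2).congr (Eventually.of_forall fun q => ?_)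
      simp only [Pi.add_apply, PiLp.add_apply]; ring
    have j2 : Integrable (fun q : ℝ × E3 =>
        ψ q.1 * (fderiv ℝ ζ q.2 (u q.1 q.2 - b q.1 q.2) * (u q.1 q.2 + b q.1 q.2) i
          + π q.1 q.2 * fderiv ℝ ζ q.2 (EuclideanSpace.single i 1))) ν := by
      refine ((((iuu.add iub).sub ibu).sub ibb).add ip).congr (Eventually.of_forall fun q => ?_)
      simp only [Pi.add_apply, Pi.sub_apply, PiLp.add_apply, map_sub]; ring
    have e3 : ∫ q, deriv ψ q.1 * (ζ q.2 * (u q.1 q.2 + b q.1 q.2) i) ∂ν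
        + ∫ q, ψ q.1 * (fderiv ℝ ζ q.2 (u q.1 q.2 - b q.1 q.2) * (u q.1 q.2 + b q.1 q.2) i
          + π q.1 q.2 * fderiv ℝ ζ q.2 (EuclideanSpace.single i 1)) ∂ν = 0 := by
      rw [← integral_add j1 j2, ← add_zero (0 : ℝ)]
      nth_rw 1 [← e1]
      rw [← e2, ← integral_add k1 k2]
      refine integral_congr_ae (Eventually.of_forall fun q => ?_)
      simp only [PiLp.add_apply, map_sub]; ring
    rw [hν, integral_prod _ j1, integral_prod _ j2] at e3
    simp only [integral_const_mul] at e3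
    linarith
  · intro ζ h1 h2 h3
    filter_upwards [hdiv ζ h1 h2 h3] with t ht
    simp only [map_add]
    rw [integral_add ht.1.1 ht.1.2, ht.2.1, ht.2.2, add_zero]
  · intro ζ h1 h2 h3
    filter_upwards [hdiv ζ h1 h2 h3] with t ht
    simp only [map_sub]
    rw [integral_sub ht.1.1 ht.1.2, ht.2.1, ht.2.2, sub_zero]

/-! ### Consequences of the regularity hypotheses -/

theorem enorm_cube_le_of_norm_le {F G H : Type*} [NormedAddCommGroup F] [NormedAddCommGroup G]
    [NormedAddCommGroup H] {x : F} {y : G} {z : H} (h : ‖x‖ ≤ ‖y‖ + ‖z‖) :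
    ‖x‖ₑ ^ 3 ≤ 4 * (‖y‖ₑ ^ 3 + ‖z‖ₑ ^ 3) := by
  have h : ‖x‖ ^ 3 ≤ 4 * (‖y‖ ^ 3 + ‖z‖ ^ 3) := by
    have h1 := pow_le_pow_left₀ (norm_nonneg _) h 3
    have h2 : 0 ≤ (‖y‖ + ‖z‖) * (‖y‖ - ‖z‖) ^ 2 := by positivity
    nlinarith
  have := ENNReal.ofReal_le_ofReal h
  rwa [ENNReal.ofReal_mul (by norm_num), ENNReal.ofReal_add (by positivity) (by positivity),
    ofReal_norm_pow, ofReal_norm_pow, ofReal_norm_pow, ENNReal.ofReal_ofNat] at this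

theorem lintegral_enorm_cube_le {α F G H : Type*} [MeasurableSpace α] [NormedAddCommGroup F]
    [NormedAddCommGroup G] [NormedAddCommGroup H] {μ : Measure α} {f : α → F} {g : α → G}
    {k : α → H} (hg : StronglyMeasurable g) (h : ∀ x, ‖f x‖ ≤ ‖g x‖ + ‖k x‖) :
    ∫⁻ x, ‖f x‖ₑ ^ 3 ∂μ ≤ 4 * ((∫⁻ x, ‖g x‖ₑ ^ 3 ∂μ) + ∫⁻ x, ‖k x‖ₑ ^ 3 ∂μ) := by
  rw [← lintegral_add_left (hg.enorm.pow_const 3), ← lintegral_const_mul' _ _ (by finiteness)]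
  exact lintegral_mono fun x => enorm_cube_le_of_norm_le (h x)

theorem IncrementBound.of_norm_sub_le {T r : ℝ} {Γ : Set E3} {B B' : ℝ≥0∞} {u b Z : ℝ → E3 → E3}
    (hm : StronglyMeasurable (fun z : ℝ × E3 => u z.1 z.2))
    (hu : IncrementBound T Γ r B u) (hb : IncrementBound T Γ r B' b)
    (hZ : ∀ t x y, ‖Z t x - Z t y‖ ≤ ‖u t x - u t y‖ + ‖b t x - b t y‖) :
    IncrementBound T Γ r (4 * (B + B')) Z := by
  intro w hw
  have mu : StronglyMeasurable (fun z : ℝ × E3 => u z.1 z.2 - u z.1 (z.2 - w)) :=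
    hm.sub (hm.comp_measurable (measurable_fst.prodMk (measurable_snd.sub_const w)))
  have mt : ∀ t, StronglyMeasurable (fun x => u t x - u t (x - w)) := fun t =>
    mu.comp_measurable (measurable_prodMk_left (x := t))
  set S := Γ ∩ {x | x - w ∈ Γ} with hS
  have mI : Measurable (fun t => ∫⁻ x in S, ‖u t x - u t (x - w)‖ₑ ^ 3) :=
    Measurable.lintegral_prod_right' (ν := volume.restrict S)
      (f := fun z : ℝ × E3 => ‖u z.1 z.2 - u z.1 (z.2 - w)‖ₑ ^ 3) (mu.enorm.pow_const 3)
  calc _ ≤ ∫⁻ t in Ioo 0 T, 4 * ((∫⁻ x in S, ‖u t x - u t (x - w)‖ₑ ^ 3)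
          + ∫⁻ x in S, ‖b t x - b t (x - w)‖ₑ ^ 3) :=
        lintegral_mono fun t => lintegral_enorm_cube_le (mt t) fun x => hZ t x (x - w)
    _ = 4 * ((∫⁻ t in Ioo 0 T, ∫⁻ x in S, ‖u t x - u t (x - w)‖ₑ ^ 3)
          + ∫⁻ t in Ioo 0 T, ∫⁻ x in S, ‖b t x - b t (x - w)‖ₑ ^ 3) := by
        rw [lintegral_const_mul' _ _ (by finiteness), lintegral_add_left mI]
    _ ≤ 4 * (ENNReal.ofReal (‖w‖ ^ (3 * r)) * B + ENNReal.ofReal (‖w‖ ^ (3 * r)) * B') := by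
        gcongr
        · exact hu w hw
        · exact hb w hw
    _ = _ := by ring

/-- The exponent may be lowered, since only increments over `‖w‖ < 1` matter. -/
theorem MemLqBesov.incrementBound {T a r : ℝ} {Γ : Set E3} {u : ℝ → E3 → E3}
    (hra : r ≤ a) :
    IncrementBound T Γ r (∫⁻ t in Ioo 0 T, eBesovNorm 3 a Γ (u t) ^ (3 : ℝ)) u := by
  intro w hw
  rcases eq_or_ne w 0 with rfl | hw0
  · simp
  have hwpos : 0 < ‖w‖ := norm_pos_iff.2 hw0
  rw [← lintegral_const_mul' _ _ ENNReal.ofReal_ne_top]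
  refine lintegral_mono fun t => ?_
  rw [lintegral_enorm_cube_eq (fun x => u t x - u t (x - w))]
  have h1 : eLpNorm (fun x => u t x - u t (x - w)) 3 (volume.restrict (Γ ∩ {x | x - w ∈ Γ}))
      / ENNReal.ofReal (‖w‖ ^ a) ≤ eBesovNorm 3 a Γ (u t) :=
    (le_iSup₂ (f := fun (y : E3) (_ : y ≠ 0) =>
      eLpNorm (fun x => u t x - u t (x - y)) 3 (volume.restrict (Γ ∩ {x | x - y ∈ Γ})) /
        ENNReal.ofReal (‖y‖ ^ a)) w hw0).trans le_add_self
  have hpos : 0 < ‖w‖ ^ a := Real.rpow_pos_of_pos hwpos a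
  rw [ENNReal.div_le_iff (by simpa using hpos) ENNReal.ofReal_ne_top] at h1
  calc _ ≤ (eBesovNorm 3 a Γ (u t) * ENNReal.ofReal (‖w‖ ^ a)) ^ 3 := pow_le_pow_left' h1 3
    _ = ENNReal.ofReal (‖w‖ ^ (3 * a)) * eBesovNorm 3 a Γ (u t) ^ (3 : ℝ) := by
        rw [mul_pow, ← ENNReal.ofReal_pow hpos.le, ← Real.rpow_natCast (‖w‖ ^ a),
          ← Real.rpow_mul hwpos.le, mul_comm, mul_comm a]
        norm_num
    _ ≤ _ := by
        gcongr ?_ * _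
        exact ENNReal.ofReal_le_ofReal
          (Real.rpow_le_rpow_of_exponent_ge hwpos hw.le (by linarith))

theorem MemLqBesov.lintegral_cube_lt_top {T a : ℝ} {Γ : Set E3} {u : ℝ → E3 → E3}
    (h : MemLqBesov T 3 3 a Γ u) (hm : StronglyMeasurable (fun z : ℝ × E3 => u z.1 z.2)) :
    ∫⁻ q, ‖u q.1 q.2‖ₑ ^ 3 ∂((volume.restrict (Ioo 0 T)).prod (volume.restrict Γ))
      < (⊤ : ℝ≥0∞) := by
  rw [lintegral_prod _ (hm.enorm.pow_const 3).aemeasurable]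
  refine lt_of_le_of_lt (lintegral_mono fun t => ?_) h
  rw [lintegral_enorm_cube_eq (u t)]
  have h1 : eLpNorm (u t) 3 (volume.restrict Γ) ≤ eBesovNorm 3 a Γ (u t) := le_self_add
  have := pow_le_pow_left' h1 3
  have e : eBesovNorm 3 a Γ (u t) ^ (3 : ℝ) = eBesovNorm 3 a Γ (u t) ^ 3 := by norm_num
  rwa [e]

theorem integrable_cube_of_norm_le {T : ℝ} {Γ : Set E3} {u b Z : ℝ → E3 → E3}
    (hm : StronglyMeasurable (fun z : ℝ × E3 => u z.1 z.2))
    (hZm : StronglyMeasurable (fun z : ℝ × E3 => Z z.1 z.2))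
    (hZ : ∀ t x, ‖Z t x‖ ≤ ‖u t x‖ + ‖b t x‖)
    (hu : ∫⁻ q, ‖u q.1 q.2‖ₑ ^ 3 ∂((volume.restrict (Ioo 0 T)).prod (volume.restrict Γ))
      < (⊤ : ℝ≥0∞))
    (hb : ∫⁻ q, ‖b q.1 q.2‖ₑ ^ 3 ∂((volume.restrict (Ioo 0 T)).prod (volume.restrict Γ))
      < (⊤ : ℝ≥0∞)) :
    Integrable (fun q : ℝ × E3 => ‖Z q.1 q.2‖ ^ 3)
      ((volume.restrict (Ioo 0 T)).prod (volume.restrict Γ)) := by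
  refine ⟨(hZm.norm.pow 3).aestronglyMeasurable, ?_⟩
  have he : ∀ q : ℝ × E3, ‖‖Z q.1 q.2‖ ^ 3‖ₑ = ‖Z q.1 q.2‖ₑ ^ 3 := fun q => by
    rw [enorm_pow, enorm_norm]
  simp_rw [HasFiniteIntegral, he]
  refine (lintegral_enorm_cube_le hm fun q => hZ q.1 q.2).trans_lt ?_
  finiteness

/-- A function bounded in the layer has small integrals over thinner layers. -/
theorem lintegral_collar_rpow_le {F : Type*} [NormedAddCommGroup F] {Ω : Set E3} {T q σ s : ℝ}
    {u : ℝ → E3 → F} (hq : 0 ≤ q) (hm : StronglyMeasurable (fun z : ℝ × E3 => u z.1 z.2))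
    (hs : s ≤ σ) (hv : volume (collar Ω s) ≠ (⊤ : ℝ≥0∞)) :
    ∫⁻ z, ‖u z.1 z.2‖ₑ ^ q ∂((volume.restrict (Ioo 0 T)).prod (volume.restrict (collar Ω s)))
      ≤ (∫⁻ t in Ioo 0 T, eLpNorm (u t) (⊤ : ℝ≥0∞) (volume.restrict (collar Ω σ)) ^ q)
        * volume (collar Ω s) := by
  have hsub : collar Ω s ⊆ collar Ω σ := fun x hx => ⟨hx.1, hx.2.trans_le hs⟩
  rw [lintegral_prod _ (hm.enorm.pow_const q).aemeasurable]
  have key : ∀ t, ∫⁻ x in collar Ω s, ‖u t x‖ₑ ^ q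
      ≤ eLpNorm (u t) (⊤ : ℝ≥0∞) (volume.restrict (collar Ω σ)) ^ q * volume (collar Ω s) := by
    intro t
    have h1 : ∀ᵐ x ∂(volume.restrict (collar Ω s)),
        ‖u t x‖ₑ ≤ eLpNorm (u t) (⊤ : ℝ≥0∞) (volume.restrict (collar Ω σ)) := by
      rw [eLpNorm_exponent_top]
      exact ae_restrict_of_ae_restrict_of_subset hsub (enorm_ae_le_eLpNormEssSup _ _)
    calc _ ≤ ∫⁻ _ in collar Ω s, eLpNorm (u t) (⊤ : ℝ≥0∞) (volume.restrict (collar Ω σ)) ^ q :=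
          lintegral_mono_ae (h1.mono fun x hx => ENNReal.rpow_le_rpow hx hq)
      _ = _ := by simp
  exact (lintegral_mono key).trans (lintegral_mul_const' _ _ hv).le

/-- The normal component near the boundary, expressed through the gradient of the distance. -/
theorem BesovContinuousNearBdry.exists_lintegral_le {Ω : Set E3} {T a : ℝ} {u : ℝ → E3 → E3}
    (h : BesovContinuousNearBdry Ω T a u) (hΩ : IsBoundedC2Domain Ω)
    (hm : StronglyMeasurable (fun z : ℝ × E3 => u z.1 z.2)) :
    ∃ h₀ > 0, ∃ K : ℝ≥0∞, K ≠ (⊤ : ℝ≥0∞) ∧ ∀ s ∈ Ioo 0 h₀,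
      ∫⁻ q, ‖fderiv ℝ (fun y => Metric.infDist y Ωᶜ) q.2 (u q.1 q.2)‖ₑ ^ 3
        ∂((volume.restrict (Ioo 0 T)).prod (volume.restrict (collar Ω s)))
        ≤ ENNReal.ofReal (s ^ (3 * a)) * K := by
  obtain ⟨h₀, hpos, hfin⟩ := h
  refine ⟨h₀, hpos, _, ne_of_lt hfin, fun s hs => ?_⟩
  have mN : StronglyMeasurable (fun q : ℝ × E3 =>
      fderiv ℝ (fun y : E3 => Metric.infDist y Ωᶜ) q.2) :=
    (measurable_fderiv ℝ (fun y : E3 => Metric.infDist y Ωᶜ)).stronglyMeasurable.comp_measurable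
      measurable_snd
  rw [lintegral_prod _ ((stronglyMeasurable_fderiv_apply mN hm).enorm.pow_const 3).aemeasurable,
    ← lintegral_const_mul' _ _ ENNReal.ofReal_ne_top]
  refine lintegral_mono fun t => ?_
  have hd : ∀ᵐ x : E3, DifferentiableAt ℝ (fun y => Metric.infDist y Ωᶜ) x :=
    (Metric.lipschitz_infDist_pt (Ωᶜ)).ae_differentiableAt
  have e1 : ∫⁻ x in collar Ω s, ‖fderiv ℝ (fun y => Metric.infDist y Ωᶜ) x (u t x)‖ₑ ^ 3
      = ∫⁻ x in collar Ω s, ‖inner ℝ (u t x) (outwardNormal Ω (nearestBdryPoint Ω x))‖ₑ ^ 3 := by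
    refine lintegral_congr_ae ?_
    filter_upwards [ae_restrict_of_ae hd,
      ae_restrict_mem (measurableSet_collar hΩ.isOpen.measurableSet s)] with x hx hxs
    rw [fderiv_infDist_compl hΩ hxs.1 hx, enorm_neg]
  rw [e1, lintegral_enorm_cube_eq (fun x =>
    (inner ℝ (u t x) (outwardNormal Ω (nearestBdryPoint Ω x)) : ℝ)),
    ← bdryLayer_eq_collar hΩ.isOpen hΩ.isBounded]
  set N := ⨆ (h : ℝ) (_ : h ∈ Ioo 0 h₀),
      eLpNorm (fun x => (inner ℝ (u t x) (outwardNormal Ω (nearestBdryPoint Ω x)) : ℝ)) 3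
          (volume.restrict (bdryLayer Ω h)) / ENNReal.ofReal (h ^ a) with hN
  have h1 : eLpNorm (fun x => (inner ℝ (u t x) (outwardNormal Ω (nearestBdryPoint Ω x)) : ℝ)) 3
      (volume.restrict (bdryLayer Ω s)) / ENNReal.ofReal (s ^ a) ≤ N :=
    le_iSup₂ (f := fun (h : ℝ) (_ : h ∈ Ioo 0 h₀) =>
      eLpNorm (fun x => (inner ℝ (u t x) (outwardNormal Ω (nearestBdryPoint Ω x)) : ℝ)) 3
          (volume.restrict (bdryLayer Ω h)) / ENNReal.ofReal (h ^ a)) s hs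
  have hsa : 0 < s ^ a := Real.rpow_pos_of_pos hs.1 a
  rw [ENNReal.div_le_iff (by simpa using hsa) ENNReal.ofReal_ne_top] at h1
  calc _ ≤ (N * ENNReal.ofReal (s ^ a)) ^ 3 := pow_le_pow_left' h1 3
    _ = ENNReal.ofReal (s ^ (3 * a)) * N ^ (3 : ℝ) := by
        rw [mul_pow, ← ENNReal.ofReal_pow hsa.le, ← Real.rpow_natCast (s ^ a),
          ← Real.rpow_mul hs.1.le, mul_comm, mul_comm a]
        norm_num

/-! ### Energies of the Elsässer variables -/

theorem ofReal_mul_le_ofReal {a s C : ℝ} {K : ℝ≥0∞} (hK : K ≠ (⊤ : ℝ≥0∞)) (hs : 0 ≤ s)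
    (hC : a * K.toReal ≤ C) : ENNReal.ofReal (a * s) * K ≤ ENNReal.ofReal (C * s) := by
  rw [← ENNReal.ofReal_toReal hK, ← ENNReal.ofReal_mul' ENNReal.toReal_nonneg]
  refine ENNReal.ofReal_le_ofReal ?_
  nlinarith

/-- A field bounded near the boundary by `u` and `b` has cubes of integral `O(s)` over the collar of
width `s`, since the collar has volume `O(s)`. -/
theorem lintegral_collar_cube_le {Ω : Set E3} {T σ₀ C₀ s : ℝ} {u b w : ℝ → E3 → E3}
    (mu : StronglyMeasurable (fun z : ℝ × E3 => u z.1 z.2))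
    (mb : StronglyMeasurable (fun z : ℝ × E3 => b z.1 z.2))
    (hw : ∀ t x, ‖w t x‖ ≤ ‖u t x‖ + ‖b t x‖) (hs : s ≤ σ₀)
    (hv : volume (collar Ω s) ≤ ENNReal.ofReal (C₀ * s)) :
    ∫⁻ q, ‖w q.1 q.2‖ₑ ^ 3 ∂((volume.restrict (Ioo 0 T)).prod (volume.restrict (collar Ω s)))
      ≤ ENNReal.ofReal (C₀ * s) * (4 *
        ((∫⁻ t in Ioo 0 T, eLpNorm (u t) (⊤ : ℝ≥0∞) (volume.restrict (collar Ω σ₀)) ^ (3 : ℝ))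
        + ∫⁻ t in Ioo 0 T, eLpNorm (b t) (⊤ : ℝ≥0∞) (volume.restrict (collar Ω σ₀)) ^ (3 : ℝ))) := by
  have hvt := ne_top_of_le_ne_top ENNReal.ofReal_ne_top hv
  have b1 := lintegral_collar_rpow_le (T := T) (q := 3) zero_le_three mu hs hvt
  have b2 := lintegral_collar_rpow_le (T := T) (q := 3) zero_le_three mb hs hvt
  set Ku := ∫⁻ t in Ioo 0 T, eLpNorm (u t) (⊤ : ℝ≥0∞) (volume.restrict (collar Ω σ₀)) ^ (3 : ℝ)
  set Kb := ∫⁻ t in Ioo 0 T, eLpNorm (b t) (⊤ : ℝ≥0∞) (volume.restrict (collar Ω σ₀)) ^ (3 : ℝ)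
  simp only [ENNReal.rpow_ofNat] at b1 b2
  calc _ ≤ 4 * (Ku * volume (collar Ω s) + Kb * volume (collar Ω s)) :=
        (lintegral_enorm_cube_le mu fun q => hw q.1 q.2).trans
          (mul_le_mul_right (add_le_add b1 b2) _)
    _ = volume (collar Ω s) * (4 * (Ku + Kb)) := by ring
    _ ≤ _ := mul_le_mul_left hv _

/-- The components of `w` along the gradient of the distance are controlled by those of `u` and `b`,
with the smaller of the two exponents. -/
theorem lintegral_collar_normal_le {Ω : Set E3} {T α₁ α₂ s : ℝ} {u b w : ℝ → E3 → E3}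
    {K₁ K₂ : ℝ≥0∞} (mu : StronglyMeasurable (fun z : ℝ × E3 => u z.1 z.2))
    (hw : ∀ (l : E3 →L[ℝ] ℝ) t x, ‖l (w t x)‖ ≤ ‖l (u t x)‖ + ‖l (b t x)‖) (hs : 0 < s)
    (hs1 : s ≤ 1)
    (hu : ∫⁻ q, ‖fderiv ℝ (fun y => Metric.infDist y Ωᶜ) q.2 (u q.1 q.2)‖ₑ ^ 3
        ∂((volume.restrict (Ioo 0 T)).prod (volume.restrict (collar Ω s)))
        ≤ ENNReal.ofReal (s ^ (3 * α₁)) * K₁)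
    (hb : ∫⁻ q, ‖fderiv ℝ (fun y => Metric.infDist y Ωᶜ) q.2 (b q.1 q.2)‖ₑ ^ 3
        ∂((volume.restrict (Ioo 0 T)).prod (volume.restrict (collar Ω s)))
        ≤ ENNReal.ofReal (s ^ (3 * α₂)) * K₂) :
    ∫⁻ q, ‖fderiv ℝ (fun y => Metric.infDist y Ωᶜ) q.2 (w q.1 q.2)‖ₑ ^ 3
        ∂((volume.restrict (Ioo 0 T)).prod (volume.restrict (collar Ω s)))
      ≤ ENNReal.ofReal (1 * s ^ (3 * min α₁ α₂)) * (4 * (K₁ + K₂)) := by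
  have mN : StronglyMeasurable (fun q : ℝ × E3 =>
      fderiv ℝ (fun y : E3 => Metric.infDist y Ωᶜ) q.2) :=
    (measurable_fderiv ℝ (fun y : E3 => Metric.infDist y Ωᶜ)).stronglyMeasurable.comp_measurable
      measurable_snd
  have p1 : s ^ (3 * α₁) ≤ s ^ (3 * min α₁ α₂) :=
    Real.rpow_le_rpow_of_exponent_ge hs hs1 (by linarith [min_le_left α₁ α₂])
  have p2 : s ^ (3 * α₂) ≤ s ^ (3 * min α₁ α₂) :=
    Real.rpow_le_rpow_of_exponent_ge hs hs1 (by linarith [min_le_right α₁ α₂])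
  calc _ ≤ 4 * (ENNReal.ofReal (s ^ (3 * α₁)) * K₁ + ENNReal.ofReal (s ^ (3 * α₂)) * K₂) :=
        (lintegral_enorm_cube_le (stronglyMeasurable_fderiv_apply mN mu)
          fun q => hw _ q.1 q.2).trans (mul_le_mul_right (add_le_add hu hb) _)
    _ ≤ 4 * (ENNReal.ofReal (s ^ (3 * min α₁ α₂)) * K₁
        + ENNReal.ofReal (s ^ (3 * min α₁ α₂)) * K₂) := by
        gcongr
    _ = _ := by rw [one_mul]; ring

/-- The energy of the Elsässer variable `u + b` is constant. -/
theorem IsWeakMHDSolution.ae_integral_norm_add_sq_eq_const {Ω : Set E3}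
    (hΩ : IsBoundedC2Domain Ω) {T : ℝ} (hT : 0 < T) {u b : ℝ → E3 → E3} {π : ℝ → E3 → ℝ}
    (hsol : IsWeakMHDSolution Ω T u b π)
    (mu : StronglyMeasurable (fun z : ℝ × E3 => u z.1 z.2))
    (mb : StronglyMeasurable (fun z : ℝ × E3 => b z.1 z.2))
    (mπ : StronglyMeasurable (fun z : ℝ × E3 => π z.1 z.2))
    (hinterior : ∀ Γ : Set E3, IsOpen Γ → IsCompact (closure Γ) → closure Γ ⊆ Ω →
      ∃ a₁ ∈ Ioo (1 / 3 : ℝ) 1, ∃ a₂ ∈ Ioo (1 / 3 : ℝ) 1,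
        MemLqBesov T 3 3 a₁ Γ u ∧ MemLqBesov T 3 3 a₂ Γ b)
    {σ₀ : ℝ} (hσ₀ : 0 < σ₀)
    (hu_bdd : MemLqLp T 3 (⊤ : ℝ≥0∞) (bdryLayer Ω σ₀) u)
    (hb_bdd : MemLqLp T 3 (⊤ : ℝ≥0∞) (bdryLayer Ω σ₀) b)
    (hπ_bdd : MemLqLp T (3 / 2) (⊤ : ℝ≥0∞) (bdryLayer Ω σ₀) π)
    {α₁ α₂ : ℝ} (hα₁ : 1 / 3 < α₁) (hα₂ : 1 / 3 < α₂)
    (hu_bdry : BesovContinuousNearBdry Ω T α₁ u)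
    (hb_bdry : BesovContinuousNearBdry Ω T α₂ b) :
    ∃ c : ℝ, ∀ᵐ t ∂(volume.restrict (Ioo 0 T)), ∫ x in Ω, ‖u t x + b t x‖ ^ 2 = c := by
  have htr := hsol.isWeakTransport hΩ.isBounded mu mb mπ
  rw [bdryLayer_eq_collar hΩ.isOpen hΩ.isBounded] at hu_bdd hb_bdd hπ_bdd
  obtain ⟨r, hr, C₀, hC₀, hvol⟩ := exists_volume_collar_le hΩ
  obtain ⟨h₁, hh₁, K₁, hK₁, hnu⟩ := hu_bdry.exists_lintegral_le hΩ mu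
  obtain ⟨h₂, hh₂, K₂, hK₂, hnb⟩ := hb_bdry.exists_lintegral_le hΩ mb
  set Ku := ∫⁻ t in Ioo 0 T, eLpNorm (u t) (⊤ : ℝ≥0∞) (volume.restrict (collar Ω σ₀)) ^ (3 : ℝ)
    with hKu
  set Kb := ∫⁻ t in Ioo 0 T, eLpNorm (b t) (⊤ : ℝ≥0∞) (volume.restrict (collar Ω σ₀)) ^ (3 : ℝ)
    with hKb
  set Kp := ∫⁻ t in Ioo 0 T, eLpNorm (π t) (⊤ : ℝ≥0∞) (volume.restrict (collar Ω σ₀)) ^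
    (3 / 2 : ℝ) with hKp
  have hKut : Ku ≠ (⊤ : ℝ≥0∞) := ne_of_lt hu_bdd
  have hKbt : Kb ≠ (⊤ : ℝ≥0∞) := ne_of_lt hb_bdd
  have hKpt : Kp ≠ (⊤ : ℝ≥0∞) := ne_of_lt hπ_bdd
  set KZ := 4 * (Ku + Kb) with hKZ
  have hKZt : KZ ≠ (⊤ : ℝ≥0∞) := by finiteness
  set KN := 4 * (K₁ + K₂) with hKN
  have hKNt : KN ≠ (⊤ : ℝ≥0∞) := by finiteness
  set C := C₀ * KZ.toReal + C₀ * Kp.toReal + KN.toReal with hC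
  have c1 : 0 ≤ C₀ * KZ.toReal := by positivity
  have c2 : 0 ≤ C₀ * Kp.toReal := by positivity
  have c3 : 0 ≤ KN.toReal := ENNReal.toReal_nonneg
  set α := min α₁ α₂ with hα
  have hα3 : 1 / 3 < α := lt_min hα₁ hα₂
  set σ := min (min r 1) (min σ₀ (min h₁ h₂)) with hσ
  have hσpos : 0 < σ := by positivity
  have hsσ : ∀ s ∈ Ioo 0 σ, s ∈ Ioo 0 r ∧ s < 1 ∧ s ≤ σ₀ ∧ s ∈ Ioo 0 h₁ ∧ s ∈ Ioo 0 h₂ := by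
    intro s hs
    have := hs.2
    simp only [hσ, lt_min_iff] at this
    exact ⟨⟨hs.1, this.1.1⟩, this.1.2, this.2.1.le, ⟨hs.1, this.2.2.1⟩, ⟨hs.1, this.2.2.2⟩⟩
  have hcube : ∀ (w : ℝ → E3 → E3), (∀ t x, ‖w t x‖ ≤ ‖u t x‖ + ‖b t x‖) → ∀ s ∈ Ioo 0 σ,
      ∫⁻ q, ‖w q.1 q.2‖ₑ ^ 3
        ∂((volume.restrict (Ioo 0 T)).prod (volume.restrict (collar Ω s)))
        ≤ ENNReal.ofReal (C * s) := by
    intro w hw s hs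
    obtain ⟨s1, s2, s3, s4, s5⟩ := hsσ s hs
    exact (lintegral_collar_cube_le mu mb hw s3 (hvol s s1)).trans
      (ofReal_mul_le_ofReal hKZt hs.1.le (by rw [hC]; linarith))
  have hnormal : ∀ (w : ℝ → E3 → E3), (∀ (l : E3 →L[ℝ] ℝ) t x,
      ‖l (w t x)‖ ≤ ‖l (u t x)‖ + ‖l (b t x)‖) → ∀ s ∈ Ioo 0 σ,
      ∫⁻ q, ‖fderiv ℝ (fun y => Metric.infDist y Ωᶜ) q.2 (w q.1 q.2)‖ₑ ^ 3
        ∂((volume.restrict (Ioo 0 T)).prod (volume.restrict (collar Ω s)))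
        ≤ ENNReal.ofReal (C * s ^ (3 * α)) := by
    intro w hw s hs
    obtain ⟨s1, s2, s3, s4, s5⟩ := hsσ s hs
    exact (lintegral_collar_normal_le mu hw hs.1 s2.le (hnu s s4) (hnb s s5)).trans
      (ofReal_mul_le_ofReal hKNt (Real.rpow_nonneg hs.1.le _) (by rw [hC]; linarith))
  refine htr.ae_energy_eq_const hT hΩ.isOpen hΩ.isBounded (fun Γ hΓo hΓc hΓΩ => ?_) hσpos
    (C := C) (β := 3 * α) (by positivity) (by linarith)
    (hcube (fun t x => u t x + b t x) fun t x => norm_add_le _ _) (fun s hs => ?_)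
    (hnormal (fun t x => u t x - b t x) fun l t x => by rw [map_sub]; exact norm_sub_le _ _)
    (hnormal (fun t x => u t x + b t x) fun l t x => by rw [map_add]; exact norm_add_le _ _)
  · obtain ⟨a₁, ha₁, a₂, ha₂, hu, hb⟩ := hinterior Γ hΓo hΓc hΓΩ
    have ha : 1 / 3 < min a₁ a₂ := lt_min ha₁.1 ha₂.1
    have iu := MemLqBesov.incrementBound (T := T) (Γ := Γ) (u := u) (r := min a₁ a₂)
      (min_le_left a₁ a₂)
    have ib := MemLqBesov.incrementBound (T := T) (Γ := Γ) (u := b) (r := min a₁ a₂)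
      (min_le_right a₁ a₂)
    have fu := hu.lintegral_cube_lt_top mu
    have fb := hb.lintegral_cube_lt_top mb
    refine ⟨min a₁ a₂, ha, _, ?_, iu.of_norm_sub_le (Z := fun t x => u t x + b t x) mu ib fun t x y => ?_,
      iu.of_norm_sub_le (Z := fun t x => u t x - b t x) mu ib fun t x y => ?_, ?_, ?_⟩
    · have h1 := ne_of_lt hu
      have h2 := ne_of_lt hb
      finiteness
    · rw [add_sub_add_comm]; exact norm_add_le _ _
    · rw [sub_sub_sub_comm]; exact norm_sub_le _ _
    · exact integrable_cube_of_norm_le (Z := fun t x => u t x + b t x) mu htr.measZ (fun t x => norm_add_le _ _) fu fb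
    · exact integrable_cube_of_norm_le (Z := fun t x => u t x - b t x) mu htr.measV (fun t x => norm_sub_le _ _) fu fb
  · obtain ⟨s1, s2, s3, s4, s5⟩ := hsσ s hs
    have v := hvol s s1
    calc _ ≤ Kp * volume (collar Ω s) := lintegral_collar_rpow_le (by norm_num) mπ s3
          (ne_top_of_le_ne_top ENNReal.ofReal_ne_top v)
      _ ≤ ENNReal.ofReal (C₀ * s) * Kp := by rw [mul_comm]; gcongr
      _ ≤ _ := ofReal_mul_le_ofReal hKpt hs.1.le (by rw [hC]; linarith)

theorem theorem1p1 (Ω : Set E3) (hΩ : IsBoundedC2Domain Ω) (T : ℝ) (hT : 0 < T)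
    (u b : ℝ → E3 → E3) (π : ℝ → E3 → ℝ)
    (hsol : IsWeakMHDSolution Ω T u b π)
    (hinterior : ∀ Γ : Set E3, IsOpen Γ → IsCompact (closure Γ) → closure Γ ⊆ Ω →
      ∃ a₁ ∈ Ioo (1 / 3 : ℝ) 1, ∃ a₂ ∈ Ioo (1 / 3 : ℝ) 1,
        MemLqBesov T 3 3 a₁ Γ u ∧ MemLqBesov T 3 3 a₂ Γ b)
    (σ₀ : ℝ) (hσ₀ : 0 < σ₀)
    (hu_bdd : MemLqLp T 3 ∞ (bdryLayer Ω σ₀) u)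
    (hb_bdd : MemLqLp T 3 ∞ (bdryLayer Ω σ₀) b)
    (hπ_bdd : MemLqLp T (3 / 2) ∞ (bdryLayer Ω σ₀) π)
    (α₁ α₂ : ℝ) (hα₁ : α₁ ∈ Ioo (1 / 3 : ℝ) 1) (hα₂ : α₂ ∈ Ioo (1 / 3 : ℝ) 1)
    (hu_bdry : BesovContinuousNearBdry Ω T α₁ u)
    (hb_bdry : BesovContinuousNearBdry Ω T α₂ b) :
    (∃ c : ℝ, ∀ᵐ t ∂(volume.restrict (Ioo 0 T)), totalEnergy Ω u b t = c) ∧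
      (∃ c : ℝ, ∀ᵐ t ∂(volume.restrict (Ioo 0 T)), crossHelicity Ω u b t = c) := by
  -- measurable representatives; all hypotheses are invariant under changes on null sets
  obtain ⟨u', mu, zu, eu⟩ := exists_stronglyMeasurable_aeEqOn hsol.u_mem.1
  obtain ⟨b', mb, zb, eb⟩ := exists_stronglyMeasurable_aeEqOn hsol.b_mem.1
  obtain ⟨π', mπ, zπ, eπ⟩ := exists_stronglyMeasurable_aeEqOn hsol.pressure_mem.aestronglyMeasurable
  have hlayer : bdryLayer Ω σ₀ ⊆ Ω := fun x hx => hx.1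
  have hsol' := hsol.congr hΩ.isOpen zu zb zπ
  have hint' : ∀ Γ : Set E3, IsOpen Γ → IsCompact (closure Γ) → closure Γ ⊆ Ω →
      ∃ a₁ ∈ Ioo (1 / 3 : ℝ) 1, ∃ a₂ ∈ Ioo (1 / 3 : ℝ) 1,
        MemLqBesov T 3 3 a₁ Γ u' ∧ MemLqBesov T 3 3 a₂ Γ b' := by
    intro Γ h1 h2 h3
    obtain ⟨a₁, ha₁, a₂, ha₂, h4, h5⟩ := hinterior Γ h1 h2 h3
    have h6 := subset_closure.trans h3
    exact ⟨a₁, ha₁, a₂, ha₂, h4.congr h1.measurableSet h6 eu, h5.congr h1.measurableSet h6 eb⟩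
  have hu1 := hu_bdd.congr hlayer eu
  have hb1 := hb_bdd.congr hlayer eb
  have hπ1 := hπ_bdd.congr hlayer eπ
  have hu2 := hu_bdry.congr eu
  have hb2 := hb_bdry.congr eb
  obtain ⟨c₁, hc₁⟩ := hsol'.ae_integral_norm_add_sq_eq_const hΩ hT mu mb mπ hint' hσ₀ hu1 hb1 hπ1
    hα₁.1 hα₂.1 hu2 hb2
  -- the second Elsässer variable is the first one of the solution `(u, -b, π)`
  obtain ⟨c₂, hc₂⟩ := hsol'.neg.ae_integral_norm_add_sq_eq_const hΩ hT mu mb.neg mπ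
    (fun Γ h1 h2 h3 => by
      obtain ⟨a₁, ha₁, a₂, ha₂, h4, h5⟩ := hint' Γ h1 h2 h3
      exact ⟨a₁, ha₁, a₂, ha₂, h4, h5.neg⟩) hσ₀ hu1 hb1.neg hπ1 hα₁.1 hα₂.1 hu2 hb2.neg
  obtain ⟨C1, -, hC1⟩ := hsol'.u_mem.exists_lintegral_le
  obtain ⟨C2, -, hC2⟩ := hsol'.b_mem.exists_lintegral_le
  have iu := (integrable_sq_prod_of_bound mu hC1).prod_right_ae
  have ib := (integrable_sq_prod_of_bound mb hC2).prod_right_ae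
  -- polarization: `|u ± b|² = |u|² + |b|² ± 2 u · b`
  have key : ∀ᵐ t ∂(volume.restrict (Ioo 0 T)),
      totalEnergy Ω u b t = (c₁ + c₂) / 2 ∧ crossHelicity Ω u b t = (c₁ - c₂) / 4 := by
    filter_upwards [eu, eb, hc₁, hc₂, iu, ib] with t t1 t2 t3 t4 t5 t6
    have e1 : totalEnergy Ω u b t = ∫ x in Ω, (‖u' t x‖ ^ 2 + ‖b' t x‖ ^ 2) := by
      refine integral_congr_ae ?_
      filter_upwards [t1, t2] with x x1 x2
      rw [x1, x2]
    have e2 : crossHelicity Ω u b t = ∫ x in Ω, inner ℝ (u' t x) (b' t x) := by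
      refine integral_congr_ae ?_
      filter_upwards [t1, t2] with x x1 x2
      rw [x1, x2]
    have mu' : StronglyMeasurable (u' t) := mu.comp_measurable (measurable_prodMk_left (x := t))
    have mb' : StronglyMeasurable (b' t) := mb.comp_measurable (measurable_prodMk_left (x := t))
    have i1 : Integrable (fun x => ‖u' t x‖ ^ 2 + ‖b' t x‖ ^ 2) (volume.restrict Ω) := t5.add t6
    have i2 : Integrable (fun x => (inner ℝ (u' t x) (b' t x) : ℝ)) (volume.restrict Ω) := by
      refine i1.mono' (mu'.inner mb').aestronglyMeasurable (Eventually.of_forall fun x => ?_)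
      refine (norm_inner_le_norm _ _).trans ?_
      nlinarith [sq_nonneg (‖u' t x‖ - ‖b' t x‖), sq_nonneg (‖u' t x‖ + ‖b' t x‖)]
    have p1 : ∫ x in Ω, ‖u' t x + b' t x‖ ^ 2 = (∫ x in Ω, (‖u' t x‖ ^ 2 + ‖b' t x‖ ^ 2))
        + 2 * ∫ x in Ω, inner ℝ (u' t x) (b' t x) := by
      rw [← integral_const_mul, ← integral_add i1 (i2.const_mul 2)]
      refine integral_congr_ae (Eventually.of_forall fun x => ?_)
      simp only [norm_add_sq_real]; ring
    have p2 : ∫ x in Ω, ‖u' t x + (-b') t x‖ ^ 2 = (∫ x in Ω, (‖u' t x‖ ^ 2 + ‖b' t x‖ ^ 2))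
        - 2 * ∫ x in Ω, inner ℝ (u' t x) (b' t x) := by
      rw [← integral_const_mul, ← integral_sub i1 (i2.const_mul 2)]
      refine integral_congr_ae (Eventually.of_forall fun x => ?_)
      simp only [Pi.neg_apply, ← sub_eq_add_neg, norm_sub_sq_real]; ring
    rw [e1, e2]
    constructor <;> linarith
  exact ⟨⟨_, key.mono fun t ht => ht.1⟩, ⟨_, key.mono fun t ht => ht.2⟩⟩
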